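/- **Setting.** Let $G=\mathrm{GL}_4$, let $\mathbb A=\mathbb R\times\mathbb A_f$ be the adeles of $\mathbb Q$, $G_\infty=G(\mathbb R)$, $K_f=\prod_p \mathrm{GL}_4(\mathbb Z_p)$, $K=O(4)K_f$, and $g\cdot x=g\,x\,{}^tg$. Let $P\subset G$ be the standard (block upper triangular) parabolic subgroup of type $(2,2)$. For $\mu=(\mu_1,\mu_2)\in\mathbb C^2$ with $\mu_1+\mu_2=0$ let $\varphi_\mu(pk)=|\det m_1|_{\mathbb A}^{\mu_1+1}|\det m_2|_{\mathbb A}^{\mu_2-1}$ for $k\in K$ and $p\in P(\mathbb A)$ with diagonal blocks $m_1,m_2$, and let $$E_P(g;\mu)=\sum_{\gamma\in P(\mathbb Q)\backslash G(\mathbb Q)}\varphi_\mu(\gamma g),\qquad g\in G(\mathbb A).$$ For a positive definite symmetric real matrix $x=\theta\cdot I_4$ with $\theta\in G_\infty$ put $E_P(x;\mu)=E_P(\theta;\mu)$. For a positive definite symmetric $x\in M_4(\mathbb Q)$ let $Q_x(\xi)={}^t\xi x\xi$, let $Q_{\wedge^2x}$ be the quadratic form on $\wedge^2\mathbb Q^4$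 whose matrix in the basis $e_i\wedge e_j$ $(i<j)$ consists of the $2\times2$ minors of $x$, and for $k>0$ let $$r_P(x;k)=\#\{\delta\in P(\mathbb Z)\backslash G(\mathbb Z):\ Q_{\wedge^2x}(v_2(\delta))=k\},$$ where $v_2(\delta)$ is the vector of the $2\times 2$ minors of the two bottom rows of $\delta$ (well defined up to sign). Let $[[x]]$ be the genus of $x$, i.e. the set of invertible symmetric rational matrices in $(G_\infty K_f)\cdot x$, let $\sim$ be $\mathrm{GL}_4(\mathbb Z)$-equivalence on it, $\epsilon(y)=\#\{g\in \mathrm{GL}_4(\mathbb Z): g\cdot y=y\}$, and $$r_P(\mathrm{gen}(x);k)=\sum_{y\in[[x]]/\sim}\epsilon(y)^{-1}r_P(y;k).$$ Suppose that either $x$ has integer entries, and put $N=1$; or, more generally, $Q_x(\xi)\in\mathbb Z$ for all $\xi\in\mathbb Z^4$, and put $N=4$. Let $$Z_P(x;s)=\sum_{k\in\frac1N\mathbb Z_{>0}}\frac{r_P(x;k)}{k^s},\qquad Z_P(\mathrm{gen}(x);s)=\sum_{k\in\frac1N\mathbb Z_{>0}}\frac{r_P(\mathrm{gen}(x);k)}{k^s}.$$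 Let $H^x=\{g\in G: g\cdot x=x\}$, fix a Haar measure on $H^x_{\mathbb A}$ and give $H^x_{\mathbb Q}\backslash H^x_{\mathbb A}$ the quotient by counting measure on $H^x_{\mathbb Q}$. This quotient measure exists and is unique, and $[[x]]/\sim$ is finite. **Proposition.** There is a constant $c$, independent of $x$, such that for $\mu_1+\mu_2=0$ and $\mathrm{Re}(\mu_1-\mu_2)>c$ the series $E_P(g;\mu)$ (for every $g\in G(\mathbb A)$) and the two Dirichlet series at $s=(\mu_1-\mu_2+2)/2$ converge absolutely, and for every $x$ as above $$E_P(x;\mu)=\det x^{(\mu_1+1)/2}\,Z_P\big(x;(\mu_1-\mu_2+2)/2\big).$$ Moreover, if $\theta\in G_\infty$ satisfies $\theta\cdot I_4=x$, then $h\mapsto E_P(h\theta;\mu)$ is integrable on $H^x_{\mathbb Q}\backslash H^x_{\mathbb A}$ and $$\int_{H^x_{\mathbb Q}\backslash H^x_{\mathbb A}}E_P(h\theta;\mu)\,dh=\mathrm{vol}\big((H^x_{\mathbb A_f}\cap K_f)H^x_\infty\big)\,\det x^{(\mu_1+1)/2}\,Z_P\big(\mathrm{gen}(x);(\mu_1-\mu_2+2)/2\big).$$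 If $E_P(g;(\mu_1,-\mu_1))$ denotes, for every $g\in G(\mathbb A)$, the meromorphic continuation to $\mu_1\in\mathbb C$, then $Z_P(x;s)$ and $Z_P(\mathrm{gen}(x);s)$ also continue meromorphically to $\mathbb C$, and both identities hold between the continuations, for all $\mu_1$ outside a closed discrete set. -/

import Mathlib

open MeasureTheory Filter
open scoped ENNReal

noncomputable section

namespace OrthPeriod

/-! ### The adele ring of the rationals -/

instance factPrime (p : Nat.Primes) : Fact (p : ℕ).Prime := ⟨p.2⟩

/-- The ring of finite adeles of `ℚ`: the restricted product of the fields `ℚ_p` with respect to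
the subrings `ℤ_p`, with its restricted product topology. -/
abbrev FinAdele : Type :=
  RestrictedProduct (fun p : Nat.Primes => ℚ_[(p : ℕ)])
    (fun p => (PadicInt.subring (p : ℕ) : Set ℚ_[(p : ℕ)])) cofinite

/-- The adele ring `𝔸 = ℝ × 𝔸_f` of `ℚ`. -/
abbrev Adele : Type := ℝ × FinAdele

theorem ratCast_eventually_integral (q : ℚ) :
    ∀ᶠ p : Nat.Primes in cofinite,
      (q : ℚ_[(p : ℕ)]) ∈ (PadicInt.subring (p : ℕ) : Set ℚ_[(p : ℕ)]) := by
  have hfin : {p : Nat.Primes | (p : ℕ) ∣ q.den}.Finite := by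
    refine Set.Finite.of_finite_image (f := fun p : Nat.Primes => (p : ℕ)) ?_
      (Subtype.val_injective.injOn)
    refine (Set.finite_Iic q.den).subset ?_
    rintro _ ⟨p, hp, rfl⟩
    exact Nat.le_of_dvd q.den_pos hp
  filter_upwards [hfin.compl_mem_cofinite] with p hp
  exact Padic.norm_rat_le_one hp

/-- The diagonal embedding `ℚ → 𝔸_f`. -/
def ratToFinAdele : ℚ →+* FinAdele where
  toFun q := RestrictedProduct.mk (fun p => (q : ℚ_[(p : ℕ)])) (ratCast_eventually_integral q)
  map_one' := by ext p; simp
  map_mul' a b := by ext p; simp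
  map_zero' := by ext p; simp
  map_add' a b := by ext p; simp

/-- The diagonal embedding `ℚ → 𝔸`. -/
def ratToAdele : ℚ →+* Adele := (Rat.castHom ℝ).prod ratToFinAdele

/-- The projection of `𝔸` to its real component. -/
def adeleToReal : Adele →+* ℝ := RingHom.fst ℝ FinAdele

/-- The projection of `𝔸` to its component at the prime `p`. -/
def adeleToPadic (p : Nat.Primes) : Adele →+* ℚ_[(p : ℕ)] where
  toFun a := a.2 p
  map_one' := rfl
  map_mul' _ _ := rfl
  map_zero' := rfl
  map_add' _ _ := rfl

/-- The idelic absolute value `|a|_𝔸 = |a_∞| ∏_p |a_p|_p` (a finite product for ideles `a`). -/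
def ideleAbs (a : Adele) : ℝ := |a.1| * ∏ᶠ p : Nat.Primes, ‖a.2 p‖

/-! ### The group `GL_4`, symmetric matrices and orthogonal groups -/

/-- `GL_4(R)`. -/
abbrev G (R : Type) [CommRing R] : Type := Matrix.GeneralLinearGroup (Fin 4) R

/-- `4 × 4` matrices over `R`. -/
abbrev M4 (R : Type) : Type := Matrix (Fin 4) (Fin 4) R

/-- The action `g • x = g x ᵗg`. -/
def act {R : Type} [CommRing R] (g : G R) (x : M4 R) : M4 R :=
  (g : M4 R) * x * (g : M4 R).transpose

theorem act_one {R : Type} [CommRing R] (x : M4 R) : act 1 x = x := by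
  simp [act]

theorem act_mul {R : Type} [CommRing R] (g h : G R) (x : M4 R) :
    act (g * h) x = act g (act h x) := by
  simp [act, Matrix.mul_assoc, Matrix.transpose_mul]

/-- The orthogonal group `H^x(R) = {g ∈ GL_4(R) : g • x = x}`. -/
def orthGroup (R : Type) [CommRing R] (x : M4 R) : Subgroup (G R) where
  carrier := {g | act g x = x}
  one_mem' := act_one x
  mul_mem' {g h} hg hh := by
    simp only [Set.mem_ofPred_eq] at hg hh ⊢
    rw [act_mul, hh, hg]
  inv_mem' {g} hg := by
    simp only [Set.mem_ofPred_eq] at hg ⊢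
    calc act g⁻¹ x = act g⁻¹ (act g x) := by rw [hg]
      _ = x := by rw [← act_mul, inv_mul_cancel, act_one]

/-- A symmetric matrix over `ℚ` regarded over the adeles. -/
abbrev toAdeleMatrix (x : M4 ℚ) : M4 Adele := x.map ratToAdele

/-- The inclusion `G_ℚ → G_𝔸`. -/
abbrev ratToG : G ℚ →* G Adele := Matrix.GeneralLinearGroup.map ratToAdele

/-- The inclusion `G_∞ → G_𝔸`: the element `θ` at the real place and `1` at every prime. -/
def realToG (θ : G ℝ) : G Adele where
  val := Matrix.of fun i j => ((θ : M4 ℝ) i j, (1 : M4 FinAdele) i j)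
  inv := Matrix.of fun i j => (((θ⁻¹ : G ℝ) : M4 ℝ) i j, (1 : M4 FinAdele) i j)
  val_inv := by
    ext i j
    · have h := congrFun (congrFun (θ.mul_inv) i) j
      simp only [Matrix.mul_apply] at h
      simp only [Matrix.mul_apply, Matrix.of_apply, Prod.mk_mul_mk, Prod.fst_sum]
      rw [h]
      by_cases hij : i = j
      · subst hij; simp
      · simp [Matrix.one_apply_ne hij]
    · have h := congrFun (congrFun (one_mul (1 : M4 FinAdele)) i) j
      simp only [Matrix.mul_apply] at h
      simp only [Matrix.mul_apply, Matrix.of_apply, Prod.mk_mul_mk, Prod.snd_sum]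
      rw [h]
      by_cases hij : i = j
      · subst hij; simp
      · simp [Matrix.one_apply_ne hij]
  inv_val := by
    ext i j
    · have h := congrFun (congrFun (θ.inv_mul) i) j
      simp only [Matrix.mul_apply] at h
      simp only [Matrix.mul_apply, Matrix.of_apply, Prod.mk_mul_mk, Prod.fst_sum]
      rw [h]
      by_cases hij : i = j
      · subst hij; simp
      · simp [Matrix.one_apply_ne hij]
    · have h := congrFun (congrFun (one_mul (1 : M4 FinAdele)) i) j
      simp only [Matrix.mul_apply] at h
      simp only [Matrix.mul_apply, Matrix.of_apply, Prod.mk_mul_mk, Prod.snd_sum]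
      rw [h]
      by_cases hij : i = j
      · subst hij; simp
      · simp [Matrix.one_apply_ne hij]

/-- The open subgroup `G_∞ K_f` of `G_𝔸`, with `K_f = ∏_p GL_4(ℤ_p)`. -/
def GInfKf : Subgroup (G Adele) :=
  ⨅ p : Nat.Primes, (Matrix.GeneralLinearGroup.map (n := Fin 4)
    (PadicInt.Coe.ringHom (p := (p : ℕ)))).range.comap
      (Matrix.GeneralLinearGroup.map (adeleToPadic p))

/-- The maximal compact subgroup `K = O(4) ∏_p GL_4(ℤ_p)` of `G_𝔸`. -/
def K : Subgroup (G Adele) :=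
  (orthGroup ℝ 1).comap (Matrix.GeneralLinearGroup.map adeleToReal) ⊓ GInfKf

/-- The upper left `2 × 2` block. -/
def blockUL {R : Type} (m : M4 R) : Matrix (Fin 2) (Fin 2) R :=
  m.submatrix (Fin.castAdd 2) (Fin.castAdd 2)

/-- The lower right `2 × 2` block. -/
def blockLR {R : Type} (m : M4 R) : Matrix (Fin 2) (Fin 2) R :=
  m.submatrix (Fin.natAdd 2) (Fin.natAdd 2)

/-- Membership in `P`: the lower left `2 × 2` block vanishes. -/
def LowerLeftZero {R : Type} [CommRing R] (m : M4 R) : Prop :=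
  ∀ i j : Fin 2, m (Fin.natAdd 2 i) (Fin.castAdd 2 j) = 0

theorem lowerLeftZero_iff {R : Type} [CommRing R] (m : M4 R) :
    LowerLeftZero m ↔ m.BlockTriangular (fun i : Fin 4 => decide (2 ≤ (i : ℕ))) := by
  constructor
  · intro h i j hij
    have h00 := h 0 0
    have h01 := h 0 1
    have h10 := h 1 0
    have h11 := h 1 1
    fin_cases i <;> fin_cases j <;> first | (exfalso; revert hij; decide) | assumption
  · intro h i j
    apply h
    fin_cases i <;> fin_cases j <;> decide

/-- The standard parabolic subgroup `P(R) ⊆ GL_4(R)` of type `(2,2)`, containing the upper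
triangular matrices. -/
def parabolic (R : Type) [CommRing R] : Subgroup (G R) where
  carrier := {g | LowerLeftZero (g : M4 R)}
  one_mem' := by
    simp only [Set.mem_ofPred_eq, lowerLeftZero_iff]
    exact Matrix.blockTriangular_one
  mul_mem' {g h} hg hh := by
    simp only [Set.mem_ofPred_eq, lowerLeftZero_iff] at hg hh ⊢
    exact hg.mul hh
  inv_mem' {g} hg := by
    simp only [Set.mem_ofPred_eq, lowerLeftZero_iff] at hg ⊢
    have : Invertible (g : M4 R) := g.invertible
    rw [Matrix.coe_units_inv]
    exact Matrix.blockTriangular_inv_of_blockTriangular hg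

/-- The coset space `P(R) \ GL_4(R)`. -/
abbrev Flag (R : Type) [CommRing R] : Type := Quotient (QuotientGroup.rightRel (parabolic R))

/-! ### The `(2,2)` Eisenstein series -/

open Classical in
/-- The spherical section `φ_μ(p k) = |det m₁|^{μ₁+1} |det m₂|^{μ₂-1}` for `k ∈ K` and `p ∈ P_𝔸`
with diagonal blocks `m₁, m₂`. By the Iwasawa decomposition `G_𝔸 = P_𝔸 K` the first branch always
applies, and the value does not depend on the chosen decomposition. -/
def sphericalSection (μ : ℂ × ℂ) (g : G Adele) : ℂ :=
  if h : ∃ p ∈ parabolic Adele, p⁻¹ * g ∈ K then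
    (ideleAbs (blockUL (h.choose : M4 Adele)).det : ℂ) ^ (μ.1 + 1) *
      (ideleAbs (blockLR (h.choose : M4 Adele)).det : ℂ) ^ (μ.2 - 1)
  else 0

/-- The term `φ_μ(γ g)` of the Eisenstein series at a coset `P_ℚ γ` (it does not depend on the
representative `γ`). -/
def eisensteinTerm (g : G Adele) (μ : ℂ × ℂ) (q : Flag ℚ) : ℂ :=
  sphericalSection μ (ratToG (Quotient.out q) * g)

/-- The Eisenstein series `E_P(g; μ) = ∑_{γ ∈ P_ℚ \ G_ℚ} φ_μ(γ g)`. -/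
def eisenstein (g : G Adele) (μ : ℂ × ℂ) : ℂ := ∑' q : Flag ℚ, eisensteinTerm g μ q

/-- `F` is the meromorphic continuation to `ℂ` of a function `f` given on some right half-plane.
(Normal form fixes the value of `F` at removable singularities by continuity, so `F` is unique.) -/
def IsMeromorphicContinuation (f F : ℂ → ℂ) : Prop :=
  MeromorphicNFOn F Set.univ ∧ ∃ c : ℝ, ∀ z : ℂ, c < z.re → F z = f z

/-! ### Representation numbers and their Dirichlet series -/

/-- The pairs `(i, j)` with `i < j`, indexing the basis `e_i ∧ e_j` of `⋀² R⁴`. -/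
abbrev Pair : Type := {p : Fin 4 × Fin 4 // p.1 < p.2}

/-- The matrix of `⋀² x`: its entries are the `2 × 2` minors of `x`. -/
def wedgeSq {R : Type} [CommRing R] (x : M4 R) : Matrix Pair Pair R :=
  Matrix.of fun I J => x I.1.1 J.1.1 * x I.1.2 J.1.2 - x I.1.1 J.1.2 * x I.1.2 J.1.1

/-- The quadratic form `Q_{⋀² x}` on `⋀² R⁴`. -/
def QWedge {R : Type} [CommRing R] (x : M4 R) (v : Pair → R) : R :=
  dotProduct v ((wedgeSq x).mulVec v)

/-- The Plücker vector `v₂(g)`: all `2 × 2` minors of the two bottom rows of `g`. -/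
def plucker {R : Type} [CommRing R] (g : M4 R) : Pair → R :=
  fun J => g 2 J.1.1 * g 3 J.1.2 - g 2 J.1.2 * g 3 J.1.1

/-- The value of `Q_{⋀² x}` at the Plücker vector, well defined up to sign, of a point of
`P_ℤ \ G_ℤ`. -/
def pluckerValue (x : M4 ℚ) (q : Flag ℤ) : ℚ :=
  QWedge x (fun J => ((plucker (Units.val (Quotient.out q : G ℤ)) J : ℤ) : ℚ))

/-- The representation number `r_P(x; k) = #{v ∈ P_ℤ \ G_ℤ : Q_{⋀² x}(v) = k}`. -/
def rP (x : M4 ℚ) (k : ℚ) : ℕ := Nat.card {q : Flag ℤ // pluckerValue x q = k}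

/-- The inclusion `GL_4(ℤ) → GL_4(ℚ)`. -/
abbrev intToG : G ℤ →* G ℚ := Matrix.GeneralLinearGroup.map (Int.castRingHom ℚ)

/-- The genus `[[x]] = X_ℚ ∩ (G_∞ K_f) • x`. -/
def genus (x : M4 ℚ) : Set (M4 ℚ) :=
  {y | y.IsSymm ∧ IsUnit y.det ∧ ∃ g ∈ GInfKf, act g (toAdeleMatrix x) = toAdeleMatrix y}

/-- The relation `y ∼ y'` of lying in the same `GL_4(ℤ)`-class. -/
def classSetoid : Setoid (M4 ℚ) where
  r y y' := ∃ u : G ℤ, act (intToG u) y = y'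
  iseqv :=
    { refl := fun y => ⟨1, by rw [map_one, act_one]⟩
      symm := by
        rintro y _ ⟨u, rfl⟩
        exact ⟨u⁻¹, by rw [← act_mul, ← map_mul, inv_mul_cancel, map_one, act_one]⟩
      trans := by
        rintro y _ _ ⟨u, rfl⟩ ⟨v, rfl⟩
        exact ⟨v * u, by rw [map_mul, act_mul]⟩ }

/-- The set `[[x]]/∼` of classes in the genus of `x`. -/
abbrev GenusClass (x : M4 ℚ) : Type :=
  Quotient (classSetoid.comap (Subtype.val : genus x → M4 ℚ))

/-- A matrix representing a class. -/
def classRep {x : M4 ℚ} (C : GenusClass x) : M4 ℚ := (Quotient.out C).1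

/-- `ε(y) = #{g ∈ GL_4(ℤ) : g • y = y}`. -/
def autCard (y : M4 ℚ) : ℕ := Nat.card {g : G ℤ // act (intToG g) y = y}

/-- The genus representation number `r_P(gen(x); k) = ∑_{y ∈ [[x]]/∼} ε(y)⁻¹ r_P(y; k)`. -/
def rPGen (x : M4 ℚ) (k : ℚ) : ℚ :=
  ∑ᶠ C : GenusClass x, (autCard (classRep C) : ℚ)⁻¹ * (rP (classRep C) k : ℚ)

/-- The general term `a(k) / k^s` of a Dirichlet series, at `k = n / N`. -/
def dirichletTerm (a : ℚ → ℂ) (N : ℕ) (s : ℂ) (n : ℕ+) : ℂ :=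
  a ((n : ℚ) / N) / ((((n : ℚ) / N : ℚ) : ℂ)) ^ s

/-- The Dirichlet series `Z_P(x; s) = ∑_k r_P(x; k) k^{-s}` over `k ∈ N⁻¹ ℤ_{> 0}`; for `N = 1`
this is a sum over positive integers `k`. -/
def ZP (N : ℕ) (x : M4 ℚ) (s : ℂ) : ℂ :=
  ∑' n : ℕ+, dirichletTerm (fun k => (rP x k : ℂ)) N s n

/-- The genus Dirichlet series `Z_P(gen(x); s) = ∑_k r_P(gen(x); k) k^{-s}` over
`k ∈ N⁻¹ ℤ_{> 0}`. -/
def ZPGen (N : ℕ) (x : M4 ℚ) (s : ℂ) : ℂ :=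
  ∑' n : ℕ+, dirichletTerm (fun k => (rPGen x k : ℂ)) N s n

/-- `Q_x(ξ) = ᵗξ x ξ` is an integer for every `ξ ∈ ℤ⁴`. -/
def IntegralForm (x : M4 ℚ) : Prop :=
  ∀ ξ : Fin 4 → ℤ, ∃ m : ℤ,
    dotProduct (fun i => (ξ i : ℚ)) (x.mulVec fun i => (ξ i : ℚ)) = (m : ℚ)

/-! ### The orthogonal period -/

/-- The adelic orthogonal group `H^x_𝔸`, with the topology induced from `GL_4(𝔸)`. -/
abbrev HA (x : M4 ℚ) : Subgroup (G Adele) := orthGroup Adele (toAdeleMatrix x)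

/-- The group `H^x_ℚ = H^x_𝔸 ∩ G_ℚ`, as a subgroup of `H^x_𝔸`. -/
def HQ (x : M4 ℚ) : Subgroup (HA x) := ratToG.range.subgroupOf (HA x)

/-- The quotient `H^x_ℚ \ H^x_𝔸`, with the quotient σ-algebra. -/
abbrev HQuot (x : M4 ℚ) : Type := Quotient (QuotientGroup.rightRel (HQ x))

/-- `ν` is the quotient of the measure `μ` on `H^x_𝔸` by the counting measure on `H^x_ℚ`:
`∫_{H_𝔸} f dμ = ∫_{H_ℚ \ H_𝔸} ∑_{γ ∈ H_ℚ} f(γ h) dν(h)` for all measurable `f ≥ 0`. -/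
def IsQuotientMeasure (x : M4 ℚ) [MeasurableSpace (HA x)] (μ : Measure (HA x))
    (ν : Measure (HQuot x)) : Prop :=
  ∀ f : HA x → ℝ≥0∞, Measurable f →
    ∫⁻ h, f h ∂μ = ∫⁻ q : HQuot x, ∑' γ : HQ x, f ((γ : HA x) * Quotient.out q) ∂ν

/-- The subgroup `(H^x_{𝔸_f} ∩ K_f) H^x_∞` of `H^x_𝔸`. -/
def HCompact (x : M4 ℚ) : Set (HA x) := {h | (h : G Adele) ∈ GInfKf}

/-- The element `h θ` of `G_𝔸`, with `h` the representative of a point of `H^x_ℚ \ H^x_𝔸`; left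
`G_ℚ`-invariant functions on `G_𝔸` take a value there that does not depend on `h`. -/
def periodPoint (x : M4 ℚ) (θ : G ℝ) (q : HQuot x) : G Adele :=
  ((Quotient.out q : HA x) : G Adele) * realToG θ

end OrthPeriod

end

open OrthPeriod

noncomputable section

namespace OrthPeriod

section


/-! ### Integrality in the adele ring and the class number of `GL_4` -/

open Matrix

/-! The Eisenstein series unfolds over integral flags. Class number one for `GL_4`
(`exists_rat_mul_GInfKf`) writes every adelic point as `γ k` with `γ` rational and `k ∈ G_∞ K_f`,
and every rational flag has an integral representative, so `P_ℚ \ G_ℚ` can be replaced by `P_ℤ \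
G_ℤ` (`flagMap_bijective`). On `G_∞ K_f` the Iwasawa decomposition takes place at the real place
alone. Because `μ₁ + μ₂ = 0`, the section there is a power of the determinant times a power of the
Gram determinant of the two bottom rows, and Cauchy–Binet identifies the latter with the value of
`⋀² X` at the Plücker vector (`eisensteinTerm_flagEquiv`). Collecting flags of equal value gives the
Dirichlet series. Plücker vectors are distinct points of a lattice of rank 6, whence convergence for
`Re s > 3`, that is, `Re (μ₁ - μ₂) > 4`.

For the period, write `h = γ k` in `H^x_𝔸`. Then `γ⁻¹ • x` lies in the genus, its class depends only
on `h`, and so does the value of the series at `h θ`, through that class alone. The points of the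
quotient over the class of `y` have measure `vol / ε(y)` (`quotientMeasure_classFiber`), because
`ε(y)` rational points carry a given point into a given coset of the compact open subgroup. The same
count yields a weight with sum one over rational orbits, and the quotient measure is the image of
the weighted Haar measure (`isQuotientMeasure_iff`). The integral is thus a finite sum over the
genus. Its finiteness comes from Hermite reduction (`exists_hermite_bound`).

That every class of the genus occurs is the weak Hasse principle (`exists_rat_act_eq`). Two definite
diagonal forms `a`, `b` are equivalent exactly when `a ⊥ -b` has an isotropic subspace of half the
dimension, so the principle becomes a statement in the Witt group of `ℚ`. There primes are
eliminated from the largest down: if the form is metabolic over `ℚ_p`, its second residue is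
metabolic over `𝔽_p`, and this allows the terms involving `p` to be traded for terms with smaller
prime factors. In the end only `±1` remain, and the real place counts them.

For the continuation, the Dirichlet series are expressed through the given continuations of the
Eisenstein series, and uniqueness of meromorphic continuation shows that the continued integrand
still depends only on the class (`continuation_identities`). -/

/-- The component at `p` of an element of `G_𝔸`. -/
abbrev atPrime (p : Nat.Primes) : G Adele →* G ℚ_[(p : ℕ)] :=
  Matrix.GeneralLinearGroup.map (adeleToPadic p)

/-- The real component of an element of `G_𝔸`. -/
abbrev atReal : G Adele →* G ℝ := Matrix.GeneralLinearGroup.map adeleToReal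

/-- The inclusion `GL_4(ℤ_p) → GL_4(ℚ_p)`. -/
abbrev padicIntToG (p : ℕ) [Fact p.Prime] : G ℤ_[p] →* G ℚ_[p] :=
  Matrix.GeneralLinearGroup.map (n := Fin 4) (PadicInt.Coe.ringHom (p := p))

theorem ratToFinAdele_apply (q : ℚ) (p : Nat.Primes) : ratToFinAdele q p = (q : ℚ_[(p : ℕ)]) := rfl

theorem ratToAdele_snd (q : ℚ) (p : Nat.Primes) : (ratToAdele q).2 p = (q : ℚ_[(p : ℕ)]) := rfl

theorem mem_range_padicIntToG {p : ℕ} [Fact p.Prime] (X : G ℚ_[p]) :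
    X ∈ (padicIntToG p).range ↔
      (∀ i j, ‖(X : M4 ℚ_[p]) i j‖ ≤ 1) ∧ ∀ i j, ‖((X⁻¹ : G ℚ_[p]) : M4 ℚ_[p]) i j‖ ≤ 1 := by
  constructor
  · rintro ⟨k, rfl⟩
    refine ⟨fun i j => ?_, fun i j => ?_⟩
    · exact ((k : M4 ℤ_[p]) i j).2
    · rw [← map_inv]
      exact (((k⁻¹ : G ℤ_[p]) : M4 ℤ_[p]) i j).2
  · rintro ⟨h1, h2⟩
    let A : M4 ℤ_[p] := Matrix.of fun i j => ⟨(X : M4 ℚ_[p]) i j, h1 i j⟩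
    let B : M4 ℤ_[p] := Matrix.of fun i j => ⟨((X⁻¹ : G ℚ_[p]) : M4 ℚ_[p]) i j, h2 i j⟩
    have inj : Function.Injective
        ((PadicInt.Coe.ringHom (p := p)).mapMatrix : M4 ℤ_[p] →+* M4 ℚ_[p]) := by
      intro M N h
      ext i j
      exact Subtype.ext (congrFun (congrFun h i) j)
    have hA : (PadicInt.Coe.ringHom (p := p)).mapMatrix A = (X : M4 ℚ_[p]) := by
      ext i j; rfl
    have hB : (PadicInt.Coe.ringHom (p := p)).mapMatrix B = ((X⁻¹ : G ℚ_[p]) : M4 ℚ_[p]) := by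
      ext i j; rfl
    refine ⟨⟨A, B, inj ?_, inj ?_⟩, ?_⟩
    · rw [map_mul, hA, hB, map_one, Units.mul_inv]
    · rw [map_mul, hA, hB, map_one, Units.inv_mul]
    · ext i j; rfl

theorem mem_GInfKf {g : G Adele} :
    g ∈ GInfKf ↔ ∀ p : Nat.Primes, atPrime p g ∈ (padicIntToG (p : ℕ)).range := by
  simp only [GInfKf, Subgroup.mem_iInf, Subgroup.mem_comap]

theorem mem_GInfKf_iff {g : G Adele} :
    g ∈ GInfKf ↔ ∀ p : Nat.Primes, (∀ i j, ‖((g : M4 Adele) i j).2 p‖ ≤ 1) ∧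
      ∀ i j, ‖(((g⁻¹ : G Adele) : M4 Adele) i j).2 p‖ ≤ 1 := by
  rw [mem_GInfKf]
  refine forall_congr' fun p => ?_
  rw [mem_range_padicIntToG, ← map_inv]
  rfl

/-- A rational number of `p`-adic norm at most one has denominator prime to `p`, so no prime can
divide the denominator. -/
theorem exists_int_of_padicNorm_le_one {q : ℚ} (h : ∀ p : Nat.Primes, ‖(q : ℚ_[(p : ℕ)])‖ ≤ 1) :
    ∃ m : ℤ, q = m := by
  have hd : q.den = 1 := by
    by_contra hne
    obtain ⟨p, hp, hpd⟩ := Nat.exists_prime_and_dvd hne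
    have : Fact p.Prime := ⟨hp⟩
    have h1 := PadicInt.isUnit_den (p := p) q (h ⟨p, hp⟩)
    rw [PadicInt.isUnit_iff, PadicInt.norm_natCast_eq_one_iff] at h1
    exact hp.one_lt.ne' (by rw [Nat.Coprime, Nat.gcd_eq_left hpd] at h1; exact h1)
  exact ⟨q.num, (Rat.coe_int_num_of_den_eq_one hd).symm⟩

theorem norm_intCast_padic_le_one (p : Nat.Primes) (m : ℤ) : ‖(m : ℚ_[(p : ℕ)])‖ ≤ 1 :=
  Padic.norm_int_le_one m

/-- Integrality of a rational matrix and its inverse at all primes is integrality over `ℤ`. This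
intersection is the source of `GL_4(ℤ)`-classes and of the stabilizers counted by `ε`. -/
theorem ratToG_mem_GInfKf_iff {γ : G ℚ} : ratToG γ ∈ GInfKf ↔ γ ∈ intToG.range := by
  constructor
  · intro h
    rw [mem_GInfKf_iff] at h
    have h1 : ∀ i j, ∃ m : ℤ, (γ : M4 ℚ) i j = m := fun i j =>
      exists_int_of_padicNorm_le_one fun p => (h p).1 i j
    have h2 : ∀ i j, ∃ m : ℤ, ((γ⁻¹ : G ℚ) : M4 ℚ) i j = m := fun i j =>
      exists_int_of_padicNorm_le_one fun p => by
        have := (h p).2 i j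
        rwa [← map_inv] at this
    choose A hA using h1
    choose B hB using h2
    have inj : Function.Injective
        ((Int.castRingHom ℚ).mapMatrix : M4 ℤ →+* M4 ℚ) := by
      intro M N h
      ext i j
      exact Int.cast_injective (α := ℚ) (congrFun (congrFun h i) j)
    have hA' : (Int.castRingHom ℚ).mapMatrix (Matrix.of A) = (γ : M4 ℚ) := by
      ext i j; exact (hA i j).symm
    have hB' : (Int.castRingHom ℚ).mapMatrix (Matrix.of B) = ((γ⁻¹ : G ℚ) : M4 ℚ) := by
      ext i j; exact (hB i j).symm
    refine ⟨⟨Matrix.of A, Matrix.of B, inj ?_, inj ?_⟩, ?_⟩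
    · rw [map_mul, hA', hB', map_one, Units.mul_inv]
    · rw [map_mul, hA', hB', map_one, Units.inv_mul]
    · ext i j; exact (hA i j).symm
  · rintro ⟨u, rfl⟩
    rw [mem_GInfKf_iff]
    intro p
    refine ⟨fun i j => ?_, fun i j => ?_⟩
    · have : (((ratToG (intToG u) : G Adele) : M4 Adele) i j).2 p
          = (((u : M4 ℤ) i j : ℤ) : ℚ_[(p : ℕ)]) := by
        simp only [Matrix.GeneralLinearGroup.map_apply, ratToAdele_snd]
        simp
      rw [this]
      exact norm_intCast_padic_le_one p _
    · have : (((ratToG (intToG u)⁻¹ : G Adele) : M4 Adele) i j).2 p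
          = ((((u⁻¹ : G ℤ) : M4 ℤ) i j : ℤ) : ℚ_[(p : ℕ)]) := by
        rw [← map_inv]
        simp only [Matrix.GeneralLinearGroup.map_apply, ratToAdele_snd]
        simp
      rw [← map_inv, this]
      exact norm_intCast_padic_le_one p _

/-- Polar part of a `p`-adic number: it is approximated by a rational number that is integral away
from `p`. -/
theorem exists_rat_polar_part (p : Nat.Primes) (a : ℚ_[(p : ℕ)]) :
    ∃ q : ℚ, ‖a - q‖ ≤ 1 ∧ ∀ l : Nat.Primes, l ≠ p → ‖(q : ℚ_[(l : ℕ)])‖ ≤ 1 := by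
  have hp1 : (1 : ℝ) < (p : ℕ) := by exact_mod_cast p.2.one_lt
  obtain ⟨k, hk⟩ := pow_unbounded_of_one_lt ‖a‖ hp1
  have hpk : (0 : ℝ) < ((p : ℕ) : ℝ) ^ k := by positivity
  have hz : ‖((p : ℕ) : ℚ_[(p : ℕ)]) ^ k * a‖ ≤ 1 := by
    rw [norm_mul, norm_pow, Padic.norm_p, inv_pow, inv_mul_le_iff₀ hpk, mul_one]
    exact hk.le
  set z : ℤ_[(p : ℕ)] := ⟨_, hz⟩ with hzdef
  have hspec := PadicInt.appr_spec k z
  rw [← PadicInt.norm_le_pow_iff_mem_span_pow] at hspec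
  have hp0 : ((p : ℕ) : ℚ_[(p : ℕ)]) ^ k ≠ 0 := by
    have : ((p : ℕ) : ℚ_[(p : ℕ)]) ≠ 0 := by exact_mod_cast p.2.ne_zero
    exact pow_ne_zero _ this
  -- The element `z = p ^ k a` is integral and congruent to a natural number modulo `p ^ k`;
  -- division by `p ^ k` yields the fractional part of `a`.
  refine ⟨(z.appr k : ℚ) / ((p : ℕ) : ℚ) ^ k, ?_, fun l hl => ?_⟩
  · have h1 : a - (((z.appr k : ℚ) / ((p : ℕ) : ℚ) ^ k : ℚ) : ℚ_[(p : ℕ)])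
        = ((z - (z.appr k : ℤ_[(p : ℕ)]) : ℤ_[(p : ℕ)]) : ℚ_[(p : ℕ)])
          / ((p : ℕ) : ℚ_[(p : ℕ)]) ^ k := by
      rw [PadicInt.coe_sub, PadicInt.coe_natCast, hzdef]
      push_cast
      field_simp
    rw [h1, norm_div, norm_pow, Padic.norm_p, ← PadicInt.norm_def, div_le_one (by positivity)]
    simpa [_root_.zpow_neg, inv_pow] using hspec
  · have h1 : ‖(((p : ℕ) : ℕ) : ℚ_[(l : ℕ)])‖ = 1 := by
      rw [Padic.norm_natCast_eq_one_iff]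
      exact (Nat.coprime_primes l.2 p.2).2 fun h => hl (Subtype.ext h)
    push_cast
    rw [norm_div, norm_pow, h1, one_pow, div_one]
    exact_mod_cast norm_intCast_padic_le_one l (z.appr k)

/-- `𝔸_f = ℚ + ∏_p ℤ_p`. -/
theorem exists_rat_sub_integral (a : FinAdele) :
    ∃ q : ℚ, ∀ p : Nat.Primes, ‖a p - (q : ℚ_[(p : ℕ)])‖ ≤ 1 := by
  classical
  have hfin : {p : Nat.Primes | ¬ ‖a p‖ ≤ 1}.Finite := a.2
  choose q hq hq' using fun p : Nat.Primes => exists_rat_polar_part p (a p)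
  -- Each polar part is integral at all other primes, so the sum over the finitely many bad primes
  -- has the right polar part at each of them.
  refine ⟨∑ p ∈ hfin.toFinset, q p, fun p => ?_⟩
  push_cast
  rw [← PadicInt.mem_subring_iff]
  by_cases hp : p ∈ hfin.toFinset
  · rw [← Finset.add_sum_erase _ _ hp, ← sub_sub]
    exact sub_mem (hq p) (sum_mem fun l hl => hq' l p (Finset.ne_of_mem_erase hl).symm)
  · refine sub_mem ?_ (sum_mem fun l hl => hq' l p fun h => hp (h ▸ hl))
    simpa using hp

/-- Strong approximation: `𝔸_f = ℚ + D ∏_p ℤ_p`. -/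
theorem exists_rat_approx (a : FinAdele) {D : ℕ} (hD : D ≠ 0) :
    ∃ q : ℚ, ∀ p : Nat.Primes, ‖a p - (q : ℚ_[(p : ℕ)])‖ ≤ ‖(D : ℚ_[(p : ℕ)])‖ := by
  obtain ⟨q, hq⟩ := exists_rat_sub_integral (ratToFinAdele ((D : ℚ)⁻¹) * a)
  refine ⟨D * q, fun p => ?_⟩
  have hDp : (D : ℚ_[(p : ℕ)]) ≠ 0 := by exact_mod_cast hD
  have h1 : a p - ((D * q : ℚ) : ℚ_[(p : ℕ)])
      = (D : ℚ_[(p : ℕ)]) * ((ratToFinAdele ((D : ℚ)⁻¹) * a) p - (q : ℚ_[(p : ℕ)])) := by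
    rw [RestrictedProduct.mul_apply, ratToFinAdele_apply]
    push_cast
    field_simp
  rw [h1, norm_mul]
  exact mul_le_of_le_one_right (norm_nonneg _) (hq p)

/-- The denominator of a rational number congruent to `a` modulo `∏_p ℤ_p` works. -/
theorem exists_denominator (a : FinAdele) :
    ∃ D : ℕ, D ≠ 0 ∧ ∀ p : Nat.Primes, ‖(D : ℚ_[(p : ℕ)]) * a p‖ ≤ 1 := by
  obtain ⟨q, hq⟩ := exists_rat_sub_integral a
  refine ⟨q.den, q.den_nz, fun p => ?_⟩
  have h1 : (q.den : ℚ_[(p : ℕ)]) * a p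
      = (q.den : ℚ_[(p : ℕ)]) * (a p - q) + ((q.num : ℤ) : ℚ_[(p : ℕ)]) := by
    have h := congrArg (Rat.cast (K := ℚ_[(p : ℕ)])) (Rat.den_mul_eq_num q)
    push_cast at h
    rw [← h]; ring
  rw [h1, ← PadicInt.mem_subring_iff]
  refine add_mem (mul_mem ?_ (hq p)) (norm_intCast_padic_le_one p _)
  exact_mod_cast norm_intCast_padic_le_one p q.den

theorem exists_common_denominator {ι : Type*} [Finite ι] (a : ι → FinAdele) :
    ∃ D : ℕ, D ≠ 0 ∧ ∀ i, ∀ p : Nat.Primes, ‖(D : ℚ_[(p : ℕ)]) * a i p‖ ≤ 1 := by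
  classical
  cases nonempty_fintype ι
  choose D hD hD' using fun i => exists_denominator (a i)
  refine ⟨∏ i, D i, Finset.prod_ne_zero_iff.2 fun i _ => hD i, fun i p => ?_⟩
  rw [← Finset.mul_prod_erase _ _ (Finset.mem_univ i), Nat.cast_mul, mul_right_comm, norm_mul]
  refine mul_le_one₀ (hD' i p) (norm_nonneg _) ?_
  exact_mod_cast norm_intCast_padic_le_one p _

/-- The map `M_4(𝔸) → M_4(ℚ_p)`. -/
abbrev matAtPrime (p : Nat.Primes) : M4 Adele →+* M4 ℚ_[(p : ℕ)] := (adeleToPadic p).mapMatrix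

/-- A matrix over `ℤ_p` with `X C ≡ 1 mod p` is invertible. -/
theorem isUnit_of_mul_congr_one {p : ℕ} [Fact p.Prime] {X C : M4 ℤ_[p]}
    (h : ∀ i j, ‖(X * C - 1) i j‖ < 1) : IsUnit X := by
  have h1 : (PadicInt.toZMod (p := p)).mapMatrix (X * C) = 1 := by
    rw [← sub_eq_zero, ← map_one (PadicInt.toZMod (p := p)).mapMatrix, ← map_sub]
    ext i j
    have : (X * C - 1) i j ∈ RingHom.ker (PadicInt.toZMod (p := p)) := by
      rw [PadicInt.ker_toZMod]
      exact PadicInt.mem_nonunits.2 (h i j)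
    exact this
  have h2 : PadicInt.toZMod (X * C).det = 1 := by
    rw [RingHom.map_det, h1, det_one]
  have h3 : IsUnit (X * C).det := by
    by_contra hne
    have : (X * C).det ∈ RingHom.ker (PadicInt.toZMod (p := p)) := by
      rw [PadicInt.ker_toZMod]
      exact hne
    rw [RingHom.mem_ker, h2] at this
    exact one_ne_zero this
  rw [Matrix.isUnit_iff_isUnit_det]
  rw [det_mul] at h3
  exact isUnit_of_mul_isUnit_left h3

/-- The integral vectors `w` with `h w ∈ D ∏_p ℤ_p^4`. -/
def scaledLattice (h : M4 Adele) (D : ℕ) : Submodule ℤ (Fin 4 → ℤ) where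
  carrier := {w | ∀ p : Nat.Primes, ∀ i,
    ‖(matAtPrime p h *ᵥ fun j => ((w j : ℤ) : ℚ_[(p : ℕ)])) i‖ ≤ ‖(D : ℚ_[(p : ℕ)])‖}
  zero_mem' := by
    intro p i
    simp [Matrix.mulVec, dotProduct]
  add_mem' := by
    intro v w hv hw p i
    have : (fun j => (((v + w) j : ℤ) : ℚ_[(p : ℕ)]))
        = (fun j => ((v j : ℤ) : ℚ_[(p : ℕ)])) + fun j => ((w j : ℤ) : ℚ_[(p : ℕ)]) := by
      ext j; simp
    rw [this, Matrix.mulVec_add]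
    exact (Padic.nonarchimedean _ _).trans (max_le (hv p i) (hw p i))
  smul_mem' := by
    intro c w hw p i
    have : (fun j => (((c • w) j : ℤ) : ℚ_[(p : ℕ)]))
        = (c : ℚ_[(p : ℕ)]) • fun j => ((w j : ℤ) : ℚ_[(p : ℕ)]) := by
      ext j; simp
    rw [this, Matrix.mulVec_smul, Pi.smul_apply, smul_eq_mul, norm_mul]
    exact (mul_le_of_le_one_left (norm_nonneg _) (norm_intCast_padic_le_one p c)).trans (hw p i)

theorem norm_sum_padic_le {p : ℕ} [Fact p.Prime] {ι : Type*} (s : Finset ι) (f : ι → ℚ_[p]) {C : ℝ}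
    (hC : 0 ≤ C) (h : ∀ i ∈ s, ‖f i‖ ≤ C) : ‖∑ i ∈ s, f i‖ ≤ C := by
  classical
  induction s using Finset.induction_on with
  | empty => simpa using hC
  | insert a s ha ih =>
    rw [Finset.sum_insert ha]
    exact (Padic.nonarchimedean _ _).trans (max_le (h a (Finset.mem_insert_self _ _))
      (ih fun i hi => h i (Finset.mem_insert_of_mem hi)))

/-- `GL_4` has class number one over `ℚ`. -/
theorem exists_rat_mul_GInfKf (g : G Adele) :
    ∃ γ : G ℚ, ∃ k ∈ GInfKf, g = ratToG γ * k := by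
  classical
  obtain ⟨D1, hD1, hg⟩ := exists_common_denominator
    (fun ij : Fin 4 × Fin 4 => ((g : M4 Adele) ij.1 ij.2).2)
  obtain ⟨D2, hD2, hgi⟩ := exists_common_denominator
    (fun ij : Fin 4 × Fin 4 => (((g⁻¹ : G Adele) : M4 Adele) ij.1 ij.2).2)
  have hnat : ∀ (n : ℕ) (p : Nat.Primes), ‖(n : ℚ_[(p : ℕ)])‖ ≤ 1 := fun n p => by
    exact_mod_cast norm_intCast_padic_le_one p n
  set D := D1 * D2 with hDdef
  have hD : D ≠ 0 := mul_ne_zero hD1 hD2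
  have hDp : ∀ p : Nat.Primes, (D : ℚ_[(p : ℕ)]) ≠ 0 := fun p => by exact_mod_cast hD
  have hg' : ∀ (p : Nat.Primes) i j,
      ‖(D : ℚ_[(p : ℕ)]) * matAtPrime p (g : M4 Adele) i j‖ ≤ 1 := by
    intro p i j
    rw [hDdef, Nat.cast_mul, mul_right_comm, norm_mul]
    exact mul_le_one₀ (hg (i, j) p) (norm_nonneg _) (hnat _ p)
  have hgi' : ∀ (p : Nat.Primes) i j,
      ‖(D : ℚ_[(p : ℕ)]) * matAtPrime p ((g⁻¹ : G Adele) : M4 Adele) i j‖ ≤ 1 := by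
    intro p i j
    rw [hDdef, Nat.cast_mul, mul_assoc, norm_mul]
    exact mul_le_one₀ (hnat _ p) (norm_nonneg _) (hgi (i, j) p)
  clear_value D
  -- Since `D` clears the denominators of `g` and `g⁻¹`, `L` is `D` times the lattice `ℚ⁴ ∩ g ∏_p
  -- ℤ_p⁴`. If the columns of `B` form a basis of `L`, then `γ = D⁻¹ B` is the candidate for which
  -- `g⁻¹ γ` is invertible over every `ℤ_p`.
  set L := scaledLattice ((g⁻¹ : G Adele) : M4 Adele) D with hL
  -- the lattice contains `D² ℤ⁴`
  have hDD : ∀ k : Fin 4, (Pi.single k ((D : ℤ) ^ 2) : Fin 4 → ℤ) ∈ L := by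
    intro k p i
    have : (fun j => (((Pi.single k ((D : ℤ) ^ 2) : Fin 4 → ℤ) j : ℤ) : ℚ_[(p : ℕ)]))
        = Pi.single k ((D : ℚ_[(p : ℕ)]) ^ 2) := by
      ext j
      by_cases h : j = k
      · subst h; simp
      · simp [h]
    rw [this, Matrix.mulVec_single]
    have h2 : (MulOpposite.op ((D : ℚ_[(p : ℕ)]) ^ 2) •
        (matAtPrime p ((g⁻¹ : G Adele) : M4 Adele)).col k) i
        = (D : ℚ_[(p : ℕ)]) * (D * matAtPrime p ((g⁻¹ : G Adele) : M4 Adele) i k) := by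
      simp [Matrix.col]; ring
    rw [h2, norm_mul]
    exact mul_le_of_le_one_right (norm_nonneg _) (hgi' p i k)
  have hrank : Module.finrank ℤ L = 4 := by
    apply le_antisymm
    · simpa using Submodule.finrank_le L
    · have hli : LinearIndependent ℤ (fun k : Fin 4 => (⟨_, hDD k⟩ : L)) := by
        apply LinearIndependent.of_comp L.subtype
        rw [Fintype.linearIndependent_iff]
        intro c hc k
        have := congrFun hc k
        simp only [Function.comp, Submodule.subtype_apply, Finset.sum_apply, Pi.smul_apply,
          smul_eq_mul, Pi.zero_apply] at this
        rw [Finset.sum_eq_single k] at this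
        · simpa [hD] using this
        · intro b _ hb
          simp [Pi.single_eq_of_ne hb.symm]
        · simp
      simpa using hli.fintype_card_le_finrank
  let b : Module.Basis (Fin 4) ℤ L := Module.finBasisOfFinrankEq ℤ L hrank
  let B : M4 ℤ := Matrix.of fun i k => (b k : Fin 4 → ℤ) i
  have hspan : ∀ w ∈ L, ∃ c : Fin 4 → ℤ, w = B *ᵥ c := by
    intro w hw
    refine ⟨b.repr ⟨w, hw⟩, ?_⟩
    have := congrArg Subtype.val (b.sum_repr ⟨w, hw⟩)
    ext i
    refine (congrFun this i).symm.trans ?_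
    simp only [Submodule.coe_sum, Finset.sum_apply, Submodule.coe_smul, Pi.smul_apply, smul_eq_mul,
      Matrix.mulVec, dotProduct, B, Matrix.of_apply, mul_comm]
  have hspan' : ∀ W : M4 ℤ, (∀ k, (fun i => W i k) ∈ L) → ∃ C : M4 ℤ, W = B * C := by
    intro W hW
    choose c hc using fun k => hspan _ (hW k)
    refine ⟨Matrix.of fun i k => c k i, ?_⟩
    ext i k
    exact congrFun (hc k) i
  -- The inclusion `D² ℤ⁴ ⊆ L` factors the scalar matrix `D²` through `B`.
  have hdet : B.det ≠ 0 := by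
    obtain ⟨C, hC⟩ := hspan' (Matrix.diagonal fun _ => (D : ℤ) ^ 2) (by
      intro k
      convert hDD k using 1
      ext i
      simp only [Matrix.diagonal_apply, Pi.single_apply])
    intro h0
    have := congrArg Matrix.det hC
    rw [det_mul, h0, zero_mul, det_diagonal] at this
    simp [hD] at this
  have hdetQ : ((D : ℚ)⁻¹ • (Int.castRingHom ℚ).mapMatrix B).det ≠ 0 := by
    rw [det_smul, ← RingHom.map_det]
    simp [hD, hdet]
  let γ : G ℚ := Matrix.GeneralLinearGroup.mkOfDetNeZero _ hdetQ
  have hγ : ∀ p : Nat.Primes, matAtPrime p ((ratToG γ : G Adele) : M4 Adele)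
      = (D : ℚ_[(p : ℕ)])⁻¹ • (Int.castRingHom ℚ_[(p : ℕ)]).mapMatrix B := by
    intro p
    ext i j
    change (((((D : ℚ)⁻¹ • (Int.castRingHom ℚ).mapMatrix B) i j : ℚ)) : ℚ_[(p : ℕ)]) = _
    simp
  refine ⟨γ, (ratToG γ)⁻¹ * g, ?_, by group⟩
  rw [← Subgroup.inv_mem_iff, mem_GInfKf]
  intro p
  have hX0 : matAtPrime p (((((ratToG γ)⁻¹ * g)⁻¹ : G Adele)) : M4 Adele)
      = (D : ℚ_[(p : ℕ)])⁻¹ • (matAtPrime p ((g⁻¹ : G Adele) : M4 Adele) *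
        (Int.castRingHom ℚ_[(p : ℕ)]).mapMatrix B) := by
    rw [_root_.mul_inv_rev, inv_inv, Units.val_mul, map_mul, hγ, Matrix.mul_smul]
  -- the entries of `g⁻¹ γ` are integral
  have hX : ∀ i j, ‖matAtPrime p (((((ratToG γ)⁻¹ * g)⁻¹ : G Adele)) : M4 Adele) i j‖ ≤ 1 := by
    intro i j
    rw [hX0, Matrix.smul_apply, smul_eq_mul, norm_mul, norm_inv,
      inv_mul_le_iff₀ (norm_pos_iff.2 (hDp p)), mul_one]
    exact (b j).2 p i
  let X : M4 ℤ_[(p : ℕ)] := Matrix.of fun i j => ⟨_, hX i j⟩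
  have hXX : (PadicInt.Coe.ringHom (p := (p : ℕ))).mapMatrix X
      = matAtPrime p (((((ratToG γ)⁻¹ * g)⁻¹ : G Adele)) : M4 Adele) := by
    ext i j; rfl
  -- approximate the columns of `g` by elements of the lattice
  have happ : ∀ i j, ∃ q : ℚ, ∀ l : Nat.Primes,
      ‖(D : ℚ_[(l : ℕ)]) * matAtPrime l (g : M4 Adele) i j - q‖
        ≤ ‖((D ^ 2 * (p : ℕ) : ℕ) : ℚ_[(l : ℕ)])‖ := by
    intro i j
    -- One factor `D` of the modulus is spent on the denominators of `g⁻¹`. The rest gives `g⁻¹ W ≡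
    -- D` modulo `D p`: hence the columns of `W` lie in `L`, and division by `D` leaves a congruence
    -- to `1` modulo `p`.
    obtain ⟨q, hq⟩ := exists_rat_approx (ratToFinAdele D * ((g : M4 Adele) i j).2)
      (D := D ^ 2 * (p : ℕ)) (mul_ne_zero (pow_ne_zero _ hD) p.2.ne_zero)
    refine ⟨q, fun l => ?_⟩
    have := hq l
    rw [RestrictedProduct.mul_apply, ratToFinAdele_apply] at this
    push_cast at this ⊢
    exact this
  choose q hq using happ
  have hqint : ∀ i j, ∃ m : ℤ, q i j = m := by
    intro i j
    refine exists_int_of_padicNorm_le_one fun l => ?_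
    have : (q i j : ℚ_[(l : ℕ)]) = (D : ℚ_[(l : ℕ)]) * matAtPrime l (g : M4 Adele) i j
        - ((D : ℚ_[(l : ℕ)]) * matAtPrime l (g : M4 Adele) i j - q i j) := by ring
    rw [this, ← PadicInt.mem_subring_iff]
    exact sub_mem (hg' l i j) ((hq i j l).trans (hnat _ l))
  choose W hW using hqint
  have hWapprox : ∀ (l : Nat.Primes) (i j : Fin 4),
      ‖(matAtPrime l ((g⁻¹ : G Adele) : M4 Adele) *
        (Int.castRingHom ℚ_[(l : ℕ)]).mapMatrix (Matrix.of W) - (D : ℚ_[(l : ℕ)]) • 1) i j‖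
        ≤ ‖(D : ℚ_[(l : ℕ)])‖ * ‖((p : ℕ) : ℚ_[(l : ℕ)])‖ := by
    intro l i j
    have h1 : matAtPrime l ((g⁻¹ : G Adele) : M4 Adele) *
        (Int.castRingHom ℚ_[(l : ℕ)]).mapMatrix (Matrix.of W) - (D : ℚ_[(l : ℕ)]) • 1
        = matAtPrime l ((g⁻¹ : G Adele) : M4 Adele) *
          ((Int.castRingHom ℚ_[(l : ℕ)]).mapMatrix (Matrix.of W) -
            (D : ℚ_[(l : ℕ)]) • matAtPrime l (g : M4 Adele)) := by
      rw [mul_sub, Matrix.mul_smul, ← map_mul, Units.inv_mul, map_one]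
    rw [h1, Matrix.mul_apply]
    refine norm_sum_padic_le _ _ (by positivity) fun k _ => ?_
    have h2 := hq k j l
    rw [norm_sub_rev, hW] at h2
    have h3 : ((Int.castRingHom ℚ_[(l : ℕ)]).mapMatrix (Matrix.of W) -
            (D : ℚ_[(l : ℕ)]) • matAtPrime l (g : M4 Adele)) k j
        = (((W k j : ℤ) : ℚ) : ℚ_[(l : ℕ)]) - D * matAtPrime l (g : M4 Adele) k j := by
      simp
    rw [h3, norm_mul]
    have h4 := hgi' l i k
    rw [norm_mul] at h4
    have hpos := norm_pos_iff.2 (hDp l)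
    rw [Nat.cast_mul, norm_mul, Nat.cast_pow, norm_pow] at h2
    calc _ ≤ ‖matAtPrime l ((g⁻¹ : G Adele) : M4 Adele) i k‖ *
          (‖(D : ℚ_[(l : ℕ)])‖ ^ 2 * ‖((p : ℕ) : ℚ_[(l : ℕ)])‖) := by gcongr
      _ = (‖(D : ℚ_[(l : ℕ)])‖ * ‖matAtPrime l ((g⁻¹ : G Adele) : M4 Adele) i k‖) *
          (‖(D : ℚ_[(l : ℕ)])‖ * ‖((p : ℕ) : ℚ_[(l : ℕ)])‖) := by ring
      _ ≤ _ := mul_le_of_le_one_left (by positivity) h4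
  obtain ⟨C, hC⟩ := hspan' (Matrix.of W) (by
    intro k l i
    have h1 := hWapprox l i k
    rw [Matrix.sub_apply] at h1
    have h2 : (matAtPrime l ((g⁻¹ : G Adele) : M4 Adele) *ᵥ
        fun j => (((Matrix.of W) j k : ℤ) : ℚ_[(l : ℕ)])) i
        = ((matAtPrime l ((g⁻¹ : G Adele) : M4 Adele) *
          (Int.castRingHom ℚ_[(l : ℕ)]).mapMatrix (Matrix.of W)) i k -
          ((D : ℚ_[(l : ℕ)]) • (1 : M4 ℚ_[(l : ℕ)])) i k) +
          ((D : ℚ_[(l : ℕ)]) • (1 : M4 ℚ_[(l : ℕ)])) i k := by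
      rw [sub_add_cancel]; rfl
    rw [h2]
    refine (Padic.nonarchimedean _ _).trans (max_le (h1.trans ?_) ?_)
    · exact mul_le_of_le_one_right (norm_nonneg _) (hnat _ l)
    · rw [Matrix.smul_apply, smul_eq_mul, norm_mul]
      refine mul_le_of_le_one_right (norm_nonneg _) ?_
      rw [Matrix.one_apply]
      split_ifs <;> simp)
  -- With `W = B C` the congruence reads `X C ≡ 1` modulo `p`, where `X` is `g⁻¹ γ` at `p`.
  have hunit : IsUnit X := by
    refine isUnit_of_mul_congr_one (C := (Int.castRingHom _).mapMatrix C) fun i j => ?_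
    rw [PadicInt.norm_def]
    have h1 : (((X * (Int.castRingHom ℤ_[(p : ℕ)]).mapMatrix C - 1) i j : ℤ_[(p : ℕ)]) :
        ℚ_[(p : ℕ)]) = (matAtPrime p (((((ratToG γ)⁻¹ * g)⁻¹ : G Adele)) : M4 Adele) *
          (Int.castRingHom ℚ_[(p : ℕ)]).mapMatrix C - 1) i j := by
      rw [← hXX]
      have : (Int.castRingHom ℚ_[(p : ℕ)]).mapMatrix C
          = (PadicInt.Coe.ringHom (p := (p : ℕ))).mapMatrix
            ((Int.castRingHom ℤ_[(p : ℕ)]).mapMatrix C) := by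
        ext i j; simp
      rw [this, ← map_mul, ← map_one (PadicInt.Coe.ringHom (p := (p : ℕ))).mapMatrix, ← map_sub]
      rfl
    have h2 := hWapprox p i j
    rw [hC, map_mul, ← mul_assoc] at h2
    have h3 : matAtPrime p ((g⁻¹ : G Adele) : M4 Adele) *
        (Int.castRingHom ℚ_[(p : ℕ)]).mapMatrix B * (Int.castRingHom ℚ_[(p : ℕ)]).mapMatrix C -
          (D : ℚ_[(p : ℕ)]) • 1 = (D : ℚ_[(p : ℕ)]) •
        (matAtPrime p (((((ratToG γ)⁻¹ * g)⁻¹ : G Adele)) : M4 Adele) *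
          (Int.castRingHom ℚ_[(p : ℕ)]).mapMatrix C - 1) := by
      rw [hX0, smul_sub, Matrix.smul_mul, smul_inv_smul₀ (hDp p)]
    rw [h3, Matrix.smul_apply, smul_eq_mul, norm_mul,
      mul_le_mul_iff_right₀ (norm_pos_iff.2 (hDp p)), ← h1] at h2
    refine h2.trans_lt ?_
    rw [Padic.norm_p]
    exact inv_lt_one_of_one_lt₀ (by exact_mod_cast p.2.one_lt)
  refine ⟨hunit.unit, ?_⟩
  ext i j
  rfl

end

section


/-! ### Metabolic diagonal forms and the Witt group -/

section Metabolic

variable {K : Type} [Field K] {ι κ : Type} [Fintype ι] [Fintype κ]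

/-- The diagonal symmetric bilinear form `∑ a_i v_i w_i` vanishes on a subspace of at least half
the dimension. -/
def Metabolic (a : ι → K) : Prop :=
  ∃ W : Submodule K (ι → K), (∀ v ∈ W, ∀ w ∈ W, ∑ i, a i * v i * w i = 0) ∧
    Fintype.card ι ≤ 2 * Module.finrank K W

/-- The diagonal bilinear form. -/
def diagForm (a : ι → K) : LinearMap.BilinForm K (ι → K) := by
  classical exact Matrix.toBilin' (Matrix.diagonal a)

theorem diagForm_apply (a v w : ι → K) : diagForm a v w = ∑ i, a i * v i * w i := by
  classical
  simp only [diagForm, Matrix.toBilin'_apply', dotProduct, Matrix.mulVec_diagonal]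
  exact Finset.sum_congr rfl fun i _ => by ring

theorem finrank_orthogonal_diagForm {a : ι → K} (ha : ∀ i, a i ≠ 0) (W : Submodule K (ι → K)) :
    Module.finrank K ((diagForm a).orthogonal W) + Module.finrank K W = Fintype.card ι := by
  classical
  have hnd : (diagForm a).Nondegenerate := by
    rw [diagForm, LinearMap.BilinForm.nondegenerate_toBilin'_iff_det_ne_zero, Matrix.det_diagonal]
    exact Finset.prod_ne_zero_iff.2 fun i _ => ha i
  rw [LinearMap.BilinForm.finrank_orthogonal hnd, Module.finrank_fintype_fun_eq_card]
  have := Submodule.finrank_le W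
  rw [Module.finrank_fintype_fun_eq_card] at this
  omega

theorem le_orthogonal_diagForm {a : ι → K} {W W' : Submodule K (ι → K)}
    (h : ∀ v ∈ W, ∀ w ∈ W', ∑ i, a i * v i * w i = 0) : W' ≤ (diagForm a).orthogonal W := by
  intro w hw
  rw [LinearMap.BilinForm.mem_orthogonal_iff]
  intro v hv
  rw [diagForm_apply]
  exact h v hv w hw

/-- An isotropic subspace lies in its orthogonal complement, whose dimension is complementary. The
inequality in `Metabolic` is therefore an equality for nondegenerate forms. -/
theorem two_finrank_le_of_isotropic {a : ι → K} (ha : ∀ i, a i ≠ 0) {W : Submodule K (ι → K)}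
    (h : ∀ v ∈ W, ∀ w ∈ W, ∑ i, a i * v i * w i = 0) :
    2 * Module.finrank K W ≤ Fintype.card ι := by
  have h1 := finrank_orthogonal_diagForm ha W
  have h2 := Submodule.finrank_mono (le_orthogonal_diagForm h)
  omega

theorem Metabolic.reindex {a : ι → K} (h : Metabolic a) (e : κ ≃ ι) : Metabolic (a ∘ e) := by
  obtain ⟨W, hW, hd⟩ := h
  refine ⟨W.map (LinearEquiv.funCongrLeft K K e : (ι → K) →ₗ[K] (κ → K)), ?_, ?_⟩
  · rintro _ ⟨v, hv, rfl⟩ _ ⟨w, hw, rfl⟩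
    rw [← hW v hv w hw]
    exact Fintype.sum_equiv e _ _ fun i => rfl
  · rw [LinearEquiv.finrank_map_eq, Fintype.card_congr e]
    exact hd

theorem Metabolic.neg {a : ι → K} (h : Metabolic a) : Metabolic (-a) := by
  obtain ⟨W, hW, hd⟩ := h
  refine ⟨W, fun v hv w hw => ?_, hd⟩
  simpa using hW v hv w hw

/-- Restriction of a family on a disjoint union to the first summand. -/
abbrev restrictLeft (K ι κ : Type) [Field K] : (ι ⊕ κ → K) →ₗ[K] (ι → K) :=
  LinearMap.funLeft K K Sum.inl

/-- Restriction of a family on a disjoint union to the second summand. -/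
abbrev restrictRight (K ι κ : Type) [Field K] : (ι ⊕ κ → K) →ₗ[K] (κ → K) :=
  LinearMap.funLeft K K Sum.inr

/-- Extension by zero from the second summand of a disjoint union. -/
def extendRight (K ι κ : Type) [Field K] : (κ → K) →ₗ[K] (ι ⊕ κ → K) where
  toFun v := Sum.elim 0 v
  map_add' v w := by ext (i | i) <;> simp
  map_smul' c v := by ext (i | i) <;> simp

theorem extendRight_injective {K ι κ : Type} [Field K] : Function.Injective (extendRight K ι κ) := by
  intro v w h
  ext i
  exact congrFun h (Sum.inr i)

theorem finrank_submodule_prod {V V' : Type} [AddCommGroup V] [Module K V] [AddCommGroup V']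
    [Module K V'] [FiniteDimensional K V] [FiniteDimensional K V'] (W : Submodule K V)
    (W' : Submodule K V') :
    Module.finrank K (W.prod W') = Module.finrank K W + Module.finrank K W' := by
  rw [← Module.finrank_prod]
  exact LinearEquiv.finrank_eq
    { toFun := fun x => (⟨x.1.1, x.2.1⟩, ⟨x.1.2, x.2.2⟩)
      invFun := fun x => ⟨(x.1, x.2), x.1.2, x.2.2⟩
      map_add' := fun _ _ => rfl
      map_smul' := fun _ _ => rfl
      left_inv := fun _ => rfl
      right_inv := fun _ => rfl }

theorem Metabolic.sum {a : ι → K} {b : κ → K} (ha : Metabolic a) (hb : Metabolic b) :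
    Metabolic (Sum.elim a b) := by
  obtain ⟨W, hW, hd⟩ := ha
  obtain ⟨W', hW', hd'⟩ := hb
  refine ⟨(W.prod W').map
    ((LinearEquiv.sumArrowLequivProdArrow ι κ K K).symm : _ →ₗ[K] (ι ⊕ κ → K)), ?_, ?_⟩
  · rintro _ ⟨v, hv, rfl⟩ _ ⟨w, hw, rfl⟩
    have h1 := hW _ hv.1 _ hw.1
    have h2 := hW' _ hv.2 _ hw.2
    rw [Fintype.sum_sum_type]
    simp only [Sum.elim_inl, Sum.elim_inr]
    exact (congrArg₂ (· + ·) h1 h2).trans (add_zero 0)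
  · rw [LinearEquiv.finrank_map_eq, finrank_submodule_prod, Fintype.card_sum]
    omega

/-- Rank–nullity for the projection to the first summand; its kernel on `W` consists of the vectors
of `W` supported on the second. -/
theorem finrank_map_restrictLeft_add (W : Submodule K (ι ⊕ κ → K)) :
    Module.finrank K (W.map (restrictLeft K ι κ)) +
      Module.finrank K (W.comap (extendRight K ι κ)) = Module.finrank K W := by
  have hrn := LinearMap.finrank_range_add_finrank_ker ((restrictLeft K ι κ).domRestrict W)
  rw [LinearMap.range_domRestrict] at hrn
  rw [← hrn, add_right_inj]
  have hmap : (W.comap (extendRight K ι κ)).map (extendRight K ι κ)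
      = (LinearMap.ker ((restrictLeft K ι κ).domRestrict W)).map W.subtype := by
    ext v
    constructor
    · rintro ⟨n, hn, rfl⟩
      exact ⟨⟨_, hn⟩, rfl, rfl⟩
    · rintro ⟨⟨w, hw⟩, hk, rfl⟩
      have hw0 : ∀ i, w (Sum.inl i) = 0 := fun i => congrFun hk i
      have hwe : extendRight K ι κ (restrictRight K ι κ w) = w := by
        ext (i | i)
        · simp [extendRight, hw0]
        · rfl
      refine ⟨restrictRight K ι κ w, ?_, hwe⟩
      change extendRight K ι κ (restrictRight K ι κ w) ∈ W
      rwa [hwe]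
  rw [(Submodule.equivMapOfInjective _ extendRight_injective _).finrank_eq, hmap,
    Submodule.finrank_map_subtype_eq]

/-- Witt cancellation. Let `W` and `N` be the isotropic subspaces for `a ⊥ b` and `b`. The vectors
of `W` whose second component lies in `N` project to an isotropic subspace for `a`. The kernel of
this projection is `N ∩ W`, which is orthogonal to both `W` and `K^ι ⊕ N`; this bounds their sum
from above, hence their intersection from below, by exactly the required amount. -/
theorem Metabolic.of_sum {a : ι → K} {b : κ → K} (ha : ∀ i, a i ≠ 0) (hb0 : ∀ i, b i ≠ 0)
    (hab : Metabolic (Sum.elim a b)) (hb : Metabolic b) : Metabolic a := by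
  classical
  obtain ⟨W, hW, hd⟩ := hab
  obtain ⟨N, hN, hdN⟩ := hb
  have hnz : ∀ i, Sum.elim a b i ≠ 0 := by rintro (i | i) <;> simp [ha, hb0]
  set A : Submodule K (ι ⊕ κ → K) := N.comap (restrictRight K ι κ) with hA
  set N0 : Submodule K (κ → K) := N ⊓ W.comap (extendRight K ι κ) with hN0
  set W1 := W ⊓ A with hW1
  -- the supremum is orthogonal to `N0`
  have horth : W ⊔ A ≤ (diagForm (Sum.elim a b)).orthogonal (N0.map (extendRight K ι κ)) := by
    apply sup_le
    · apply le_orthogonal_diagForm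
      rintro _ ⟨n, hn, rfl⟩ w hw
      exact hW _ hn.2 w hw
    · apply le_orthogonal_diagForm
      rintro _ ⟨n, hn, rfl⟩ w hw
      rw [Fintype.sum_sum_type]
      simpa [extendRight] using hN _ hn.1 _ hw
  have h1 := finrank_orthogonal_diagForm hnz (N0.map (extendRight K ι κ))
  have h2 := Submodule.finrank_mono horth
  have h3 := Submodule.finrank_sup_add_finrank_inf_eq W A
  rw [← hW1] at h3
  have h4 : Module.finrank K (N0.map (extendRight K ι κ)) = Module.finrank K N0 :=
    (Submodule.equivMapOfInjective _ extendRight_injective N0).finrank_eq.symm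
  have h5 : Module.finrank K A = Fintype.card ι + Module.finrank K N := by
    have e : A = ((⊤ : Submodule K (ι → K)).prod N).map
        ((LinearEquiv.sumArrowLequivProdArrow ι κ K K).symm : _ →ₗ[K] (ι ⊕ κ → K)) := by
      ext v
      constructor
      · intro hv
        exact ⟨(LinearEquiv.sumArrowLequivProdArrow ι κ K K) v, ⟨trivial, hv⟩,
          LinearEquiv.symm_apply_apply _ _⟩
      · rintro ⟨w, hw, rfl⟩
        exact hw.2
    rw [e, LinearEquiv.finrank_map_eq, finrank_submodule_prod]
    simp
  have h6 := finrank_map_restrictLeft_add W1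
  have h7 : W1.comap (extendRight K ι κ) = N0 := by
    ext v
    exact and_comm
  rw [h7] at h6
  refine ⟨W1.map (restrictLeft K ι κ), ?_, ?_⟩
  · rintro _ ⟨v, hv, rfl⟩ _ ⟨w, hw, rfl⟩
    have e1 := hW v hv.1 w hw.1
    have e2 := hN _ hv.2 _ hw.2
    rw [Fintype.sum_sum_type] at e1
    simp only [Sum.elim_inl, Sum.elim_inr] at e1
    have e3 : ∑ i, b i * v (Sum.inr i) * w (Sum.inr i) = 0 := e2
    rw [e3, add_zero] at e1
    exact e1
  · rw [Fintype.card_sum] at hd h1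
    omega

/-- Isotropy and independence of a basis `B` are the matrix identities `Bᵀ diag(a) B = 0` and `A B =
1`, which any field homomorphism preserves. -/
theorem Metabolic.map {L : Type} [Field L] (f : K →+* L) {a : ι → K} (h : Metabolic a) :
    Metabolic (f ∘ a) := by
  classical
  obtain ⟨W, hW, hd⟩ := h
  let b := Module.finBasis K W
  set d := Module.finrank K W
  obtain ⟨g, hg⟩ := LinearMap.exists_leftInverse_of_injective
    (W.subtype ∘ₗ (b.equivFun.symm : (Fin d → K) →ₗ[K] W)) (by
      rw [LinearMap.ker_eq_bot]
      exact W.injective_subtype.comp b.equivFun.symm.injective)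
  let B : Matrix ι (Fin d) K := LinearMap.toMatrix'
    (W.subtype ∘ₗ (b.equivFun.symm : (Fin d → K) →ₗ[K] W))
  have hAB : LinearMap.toMatrix' g * B = 1 := by
    rw [← LinearMap.toMatrix'_comp, hg, LinearMap.toMatrix'_id]
  have hBW : B.transpose * Matrix.diagonal a * B = 0 := by
    ext i j
    have hcol : ∀ j : Fin d, (fun i => B i j) ∈ W := fun j => by
      have : (fun i => B i j) = (b.equivFun.symm (Pi.single j 1) : W) := by
        ext i
        simp [B, LinearMap.toMatrix'_apply]
      rw [this]
      exact Subtype.property _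
    have := hW _ (hcol i) _ (hcol j)
    rw [Matrix.mul_apply]
    simp only [Matrix.mul_diagonal, Matrix.transpose_apply, Matrix.zero_apply]
    rw [← this]
    exact Finset.sum_congr rfl fun k _ => by ring
  have hinj : Function.Injective (B.map f).mulVecLin := by
    apply Function.LeftInverse.injective (g := ((LinearMap.toMatrix' g).map f).mulVecLin)
    intro v
    simp only [Matrix.mulVecLin_apply, Matrix.mulVec_mulVec]
    rw [← Matrix.map_mul, hAB, Matrix.map_one f f.map_zero f.map_one, Matrix.one_mulVec]
  refine ⟨LinearMap.range (B.map f).mulVecLin, ?_, ?_⟩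
  · rintro _ ⟨v, rfl⟩ _ ⟨w, rfl⟩
    have h1 : (B.map f).transpose * Matrix.diagonal (f ∘ a) * B.map f = 0 := by
      have := congrArg (fun M => Matrix.map M f) hBW
      simpa [Matrix.map_mul, Matrix.diagonal_map, Matrix.transpose_map, Function.comp_def] using this
    have h2 : ∑ i, (f ∘ a) i * (B.map f).mulVecLin v i * (B.map f).mulVecLin w i
        = dotProduct ((B.map f).mulVec v) ((Matrix.diagonal (f ∘ a)).mulVec ((B.map f).mulVec w)) := by
      simp only [dotProduct, Matrix.mulVec_diagonal, Matrix.mulVecLin_apply]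
      exact Finset.sum_congr rfl fun k _ => by ring
    rw [h2, Matrix.mulVec_mulVec, Matrix.dotProduct_mulVec, Matrix.vecMul_mulVec,
      ← Matrix.mul_assoc, h1]
    simp
  · rw [LinearMap.finrank_range_of_inj hinj]
    simpa using hd

/-- A multiset of coefficients is metabolic if the corresponding diagonal form is. -/
def IsMetabolic (s : Multiset K) : Prop :=
  ∃ (n : ℕ) (a : Fin n → K), Finset.univ.val.map a = s ∧ Metabolic a

theorem exists_equiv_of_map_univ_eq {α : Type*} {a : ι → α} {b : κ → α}
    (h : Finset.univ.val.map a = Finset.univ.val.map b) : ∃ e : κ ≃ ι, b = a ∘ e := by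
  classical
  have hc : ∀ x, Nonempty ({j // b j = x} ≃ {i // a i = x}) := by
    intro x
    have := congrArg (Multiset.count x) h
    rw [Multiset.count_map, Multiset.count_map] at this
    refine ⟨Fintype.equivOfCardEq ?_⟩
    rw [Fintype.card_subtype, Fintype.card_subtype, Finset.card_def, Finset.card_def,
      Finset.filter_val, Finset.filter_val]
    simpa [eq_comm] using this.symm
  refine ⟨Equiv.ofFiberEquiv fun x => (hc x).some, ?_⟩
  ext i
  exact (Equiv.ofFiberEquiv_map _ i).symm

theorem isMetabolic_map_univ {a : ι → K} :
    IsMetabolic (Finset.univ.val.map a) ↔ Metabolic a := by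
  constructor
  · rintro ⟨n, b, hb, hm⟩
    obtain ⟨e, rfl⟩ := exists_equiv_of_map_univ_eq hb
    exact hm.reindex e
  · intro h
    refine ⟨Fintype.card ι, a ∘ (Fintype.equivFin ι).symm, ?_, h.reindex _⟩
    rw [← Multiset.map_map]
    congr 1
    exact Multiset.map_univ_val_equiv _

theorem exists_map_univ_eq {α : Type} (s : Multiset α) :
    ∃ (n : ℕ) (a : Fin n → α), Finset.univ.val.map a = s := by
  induction s using Quotient.inductionOn with
  | _ l => exact ⟨l.length, l.get, by simp⟩

theorem map_univ_sum_elim {α : Type*} (a : ι → α) (b : κ → α) :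
    Finset.univ.val.map (Sum.elim a b) = Finset.univ.val.map a + Finset.univ.val.map b := by
  rw [← Finset.univ_disjSum_univ, Finset.val_disjSum, Multiset.disjSum, Multiset.map_add,
    Multiset.map_map, Multiset.map_map]
  rfl

theorem IsMetabolic.add {s t : Multiset K} (hs : IsMetabolic s) (ht : IsMetabolic t) :
    IsMetabolic (s + t) := by
  obtain ⟨n, a, rfl, ha⟩ := hs
  obtain ⟨m, b, rfl, hb⟩ := ht
  rw [← map_univ_sum_elim, isMetabolic_map_univ]
  exact ha.sum hb

theorem IsMetabolic.of_add {s t : Multiset K} (hs0 : ∀ a ∈ s, a ≠ 0) (ht0 : ∀ a ∈ t, a ≠ 0)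
    (hs : IsMetabolic (s + t)) (ht : IsMetabolic t) : IsMetabolic s := by
  obtain ⟨n, a, rfl⟩ := exists_map_univ_eq s
  obtain ⟨m, b, rfl⟩ := exists_map_univ_eq t
  rw [← map_univ_sum_elim, isMetabolic_map_univ] at hs
  rw [isMetabolic_map_univ] at ht ⊢
  exact hs.of_sum (fun i => hs0 _ (Multiset.mem_map_of_mem _ (Finset.mem_univ i)))
    (fun i => ht0 _ (Multiset.mem_map_of_mem _ (Finset.mem_univ i))) ht

theorem IsMetabolic.neg {s : Multiset K} (hs : IsMetabolic s) :
    IsMetabolic (s.map Neg.neg) := by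
  obtain ⟨n, a, rfl, ha⟩ := hs
  rw [Multiset.map_map, isMetabolic_map_univ]
  exact ha.neg

theorem IsMetabolic.map {L : Type} [Field L] (f : K →+* L) {s : Multiset K} (hs : IsMetabolic s) :
    IsMetabolic (s.map f) := by
  obtain ⟨n, a, rfl, ha⟩ := hs
  rw [Multiset.map_map, isMetabolic_map_univ]
  exact ha.map f

theorem isMetabolic_zero : IsMetabolic (0 : Multiset K) :=
  ⟨0, Fin.elim0, by simp, ⊥, by simp, by simp⟩

theorem isMetabolic_pair (a c : K) : IsMetabolic {a, -(a * c ^ 2)} := by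
  refine ⟨2, ![a, -(a * c ^ 2)], by simp [Fin.univ_val_map]; rfl,
    Submodule.span K {![c, 1]}, ?_, ?_⟩
  · intro v hv w hw
    obtain ⟨x, rfl⟩ := Submodule.mem_span_singleton.1 hv
    obtain ⟨y, rfl⟩ := Submodule.mem_span_singleton.1 hw
    simp [Fin.sum_univ_two]
    ring
  · rw [finrank_span_singleton]
    · simp
    · intro h
      simpa using congrFun h 1

/-- This encodes the relation `⟨a⟩ + ⟨b⟩ = ⟨a + b⟩ + ⟨a b (a + b)⟩`; the isotropic plane is spanned
by `(1, 1, 1, 0)` and `(b, -a, 0, 1)`. -/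
theorem isMetabolic_quadruple (a b : K) :
    IsMetabolic {a, b, -(a + b), -(a * b * (a + b))} := by
  refine ⟨4, ![a, b, -(a + b), -(a * b * (a + b))], by simp [Fin.univ_val_map]; rfl,
    Submodule.span K (Set.range ![![1, 1, 1, 0], ![b, -a, 0, 1]]), ?_, ?_⟩
  · intro v hv w hw
    simp only [Matrix.range_cons, Matrix.range_empty, Set.union_empty, Set.singleton_union,
      Submodule.mem_span_pair] at hv hw
    obtain ⟨x, x', rfl⟩ := hv
    obtain ⟨y, y', rfl⟩ := hw
    simp [Fin.sum_univ_four]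
    ring
  · rw [finrank_span_eq_card]
    · simp
    · rw [LinearIndependent.pair_iff]
      intro s t h
      have h2 := congrFun h 2
      have h3 := congrFun h 3
      simp at h2 h3
      exact ⟨h2, h3⟩

end Metabolic

end

section


/-! ### The Witt group of a field and the relations between one-dimensional forms -/

section WittGroup

variable (K : Type) [Field K]

/-- Witt equivalence of diagonal forms with nonzero coefficients. -/
def wittCon : AddCon (Multiset Kˣ) where
  r s t := IsMetabolic (s.map Units.val + (t.map Units.val).map Neg.neg)
  iseqv := by
    have hrefl : ∀ s : Multiset Kˣ,
        IsMetabolic (s.map Units.val + (s.map Units.val).map Neg.neg) := by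
      intro s
      induction s using Multiset.induction_on with
      | empty => simpa using isMetabolic_zero
      | cons a s ih =>
        have h := (isMetabolic_pair (a : K) 1).add ih
        simp only [one_pow, mul_one] at h
        convert h using 1
        simp only [Multiset.map_cons, Multiset.insert_eq_cons]
        simp only [← Multiset.singleton_add]
        abel
    refine ⟨hrefl, fun {s t} h => ?_, fun {s t u} h1 h2 => ?_⟩
    · have := h.neg
      rw [Multiset.map_add, Multiset.map_map, Multiset.map_map, Multiset.map_map] at this
      rw [add_comm, Multiset.map_map]
      simpa using this
    -- Transitivity: the metabolic form `t ⊥ -t` is cancelled from `s ⊥ -t ⊥ t ⊥ -u`.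
    · have h3 := (h1.add h2)
      have h4 := hrefl t
      refine IsMetabolic.of_add (t := t.map Units.val + (t.map Units.val).map Neg.neg) ?_ ?_ ?_ h4
      · simp only [Multiset.mem_add, Multiset.mem_map]
        rintro _ (⟨a, -, rfl⟩ | ⟨_, ⟨a, -, rfl⟩, rfl⟩) <;> simp
      · simp only [Multiset.mem_add, Multiset.mem_map]
        rintro _ (⟨a, -, rfl⟩ | ⟨_, ⟨a, -, rfl⟩, rfl⟩) <;> simp
      · convert h3 using 1
        abel
  add' {w x y z} h1 h2 := by
    have := h1.add h2
    simp only [Multiset.map_add] at this ⊢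
    convert this using 1
    abel

/-- The Witt group of nondegenerate symmetric bilinear forms over a field. -/
def WittGroup : Type := (wittCon K).Quotient

instance : AddCommMonoid (WittGroup K) := inferInstanceAs (AddCommMonoid (wittCon K).Quotient)

/-- The Witt class of a diagonal form. -/
def wittMk : Multiset Kˣ →+ WittGroup K := (wittCon K).mk'

theorem wittMk_eq_iff {s t : Multiset Kˣ} : wittMk K s = wittMk K t ↔
    IsMetabolic (s.map Units.val + (t.map Units.val).map Neg.neg) :=
  AddCon.eq (wittCon K)

instance : Neg (WittGroup K) where
  neg := AddCon.lift (wittCon K) ((wittMk K).comp (Multiset.mapAddMonoidHom Neg.neg)) (by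
      intro s t h
      refine (wittMk_eq_iff K).2 ?_
      have h' := IsMetabolic.neg h
      simp only [Multiset.coe_mapAddMonoidHom, Multiset.map_map, Multiset.map_add] at h' ⊢
      convert h' using 2 <;> simp)

instance : AddCommGroup (WittGroup K) :=
  { (inferInstance : AddCommMonoid (WittGroup K)), (inferInstance : Neg (WittGroup K)) with
    zsmul := zsmulRec
    neg_add_cancel := by
      intro x
      induction x using AddCon.induction_on with
      | _ s =>
        have h := (wittMk_eq_iff K).1 (rfl : wittMk K (s.map Neg.neg) = wittMk K (s.map Neg.neg))
        refine (wittMk_eq_iff K (s := s.map Neg.neg + s) (t := 0)).2 ?_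
        convert h using 1
        simp only [Multiset.map_map, Multiset.map_add]
        simp }

variable {K}

open Classical in
/-- The Witt class of the one-dimensional form `⟨a⟩`. -/
def wittClass (a : K) : WittGroup K :=
  if h : a ≠ 0 then wittMk K {Units.mk0 a h} else 0

theorem sum_wittClass_eq_mk (s : Multiset Kˣ) :
    ((s.map Units.val).map wittClass).sum = wittMk K s := by
  induction s using Multiset.induction_on with
  | empty => simp
  | cons a s ih =>
    rw [Multiset.map_cons, Multiset.map_cons, Multiset.sum_cons, ih, ← Multiset.singleton_add]
    have : wittClass (a : K) = wittMk K {a} := by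
      rw [wittClass, dif_pos a.ne_zero, Units.mk0_val]
    rw [this]
    exact (map_add (wittMk K) _ _).symm

theorem exists_units_multiset {s : Multiset K} (hs : ∀ a ∈ s, a ≠ 0) :
    ∃ t : Multiset Kˣ, t.map Units.val = s := by
  refine ⟨s.pmap (fun a h => Units.mk0 a h) hs, ?_⟩
  rw [Multiset.map_pmap]
  simp only [Units.val_mk0]
  exact (Multiset.pmap_eq_map _ _ _ hs).trans (Multiset.map_id s)

theorem sum_wittClass_eq_iff {s t : Multiset K} (hs : ∀ a ∈ s, a ≠ 0) (ht : ∀ a ∈ t, a ≠ 0) :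
    (s.map wittClass).sum = (t.map wittClass).sum ↔ IsMetabolic (s + t.map Neg.neg) := by
  obtain ⟨s, rfl⟩ := exists_units_multiset hs
  obtain ⟨t, rfl⟩ := exists_units_multiset ht
  rw [sum_wittClass_eq_mk, sum_wittClass_eq_mk]
  exact wittMk_eq_iff K

theorem sum_wittClass_eq_zero_iff {s : Multiset K} (hs : ∀ a ∈ s, a ≠ 0) :
    (s.map wittClass).sum = 0 ↔ IsMetabolic s := by
  have := sum_wittClass_eq_iff (t := 0) hs (by simp)
  simpa using this

/-- Functoriality of the Witt group in the field. It lets one multiset replace another of the same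
rational class in every completion. -/
theorem sum_wittClass_map_eq {L : Type} [Field L] (f : K →+* L) {s t : Multiset K}
    (hs : ∀ a ∈ s, a ≠ 0) (ht : ∀ a ∈ t, a ≠ 0)
    (h : (s.map wittClass).sum = (t.map wittClass).sum) :
    ((s.map f).map wittClass).sum = ((t.map f).map wittClass).sum := by
  have hne : ∀ {s : Multiset K}, (∀ a ∈ s, a ≠ 0) → ∀ a ∈ s.map f, a ≠ 0 := by
    intro s hs a ha
    obtain ⟨b, hb, rfl⟩ := Multiset.mem_map.1 ha
    simpa using hs b hb
  rw [sum_wittClass_eq_iff hs ht] at h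
  rw [sum_wittClass_eq_iff (hne hs) (hne ht)]
  have := h.map f
  rw [Multiset.map_add, Multiset.map_map] at this
  rw [Multiset.map_map]
  convert this using 2
  exact Multiset.map_congr rfl fun a _ => by simp

/-- The relations between the classes of one-dimensional forms. -/
structure IsWittFun {A : Type} [AddCommGroup A] (f : K → A) : Prop where
  sq : ∀ a c : K, a ≠ 0 → c ≠ 0 → f (a * c ^ 2) = f a
  neg : ∀ a : K, a ≠ 0 → f (-a) = -f a
  add : ∀ a b : K, a ≠ 0 → b ≠ 0 → a + b ≠ 0 → f a + f b = f (a + b) + f (a * b * (a + b))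

theorem isWittFun_wittClass : IsWittFun (wittClass (K := K)) where
  sq a c ha hc := by
    have h := (sum_wittClass_eq_iff (s := {a}) (t := {a * c ^ 2}) (by simpa using ha)
      (by simp [ha, hc])).2 (by simpa using isMetabolic_pair a c)
    simpa using h.symm
  neg a ha := by
    have h := (sum_wittClass_eq_zero_iff (s := {a, -(a * 1 ^ 2)}) (by simp [ha])).2
      (isMetabolic_pair a 1)
    simp only [one_pow, mul_one, Multiset.insert_eq_cons, Multiset.map_cons,
      Multiset.map_singleton, Multiset.sum_cons, Multiset.sum_singleton] at h
    exact (neg_eq_of_add_eq_zero_right h).symm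
  add a b ha hb hab := by
    have h := (sum_wittClass_eq_iff (s := {a, b}) (t := {a + b, a * b * (a + b)})
      (by simp [ha, hb]) (by simp [ha, hb, hab])).2 (by
        convert isMetabolic_quadruple a b using 1
        simp [← Multiset.singleton_add]
        abel)
    simpa using h

/-- As `a x² + b y²` takes the value `-c`, the relation `add` rewrites `⟨a, b⟩` as `⟨-c, -a b c⟩`,
and `⟨-c⟩` cancels `⟨c⟩`. Vanishing `x` or `y` is treated apart since `add` needs nonzero terms. -/
theorem IsWittFun.three {A : Type} [AddCommGroup A] {f : K → A} (hf : IsWittFun f) {a b c : K}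
    (ha : a ≠ 0) (hb : b ≠ 0) (hc : c ≠ 0) {x y : K} (h : a * x ^ 2 + b * y ^ 2 = -c) :
    f a + f b + f c = f (-(a * b * c)) := by
  by_cases hx : x = 0
  · have hy : y ≠ 0 := by
      rintro rfl
      apply hc
      simpa [hx] using h.symm
    have h1 : b * y ^ 2 = -c := by simpa [hx] using h
    have h2 : f b = -f c := by rw [← hf.sq b y hb hy, h1, hf.neg c hc]
    have h3 : f (-(a * b * c)) = f a := by
      rw [← hf.sq a (b * y) ha (mul_ne_zero hb hy)]
      congr 1
      linear_combination (-(a * b)) * h1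
    rw [h2, h3]; abel
  by_cases hy : y = 0
  · have h1 : a * x ^ 2 = -c := by simpa [hy] using h
    have h2 : f a = -f c := by rw [← hf.sq a x ha hx, h1, hf.neg c hc]
    have h3 : f (-(a * b * c)) = f b := by
      rw [← hf.sq b (a * x) hb (mul_ne_zero ha hx)]
      congr 1
      linear_combination (-(a * b)) * h1
    rw [h2, h3]; abel
  have hax : a * x ^ 2 ≠ 0 := mul_ne_zero ha (pow_ne_zero _ hx)
  have hby : b * y ^ 2 ≠ 0 := mul_ne_zero hb (pow_ne_zero _ hy)
  have h1 := hf.add _ _ hax hby (by rw [h]; exact neg_ne_zero.2 hc)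
  rw [h, hf.neg c hc, hf.sq a x ha hx, hf.sq b y hb hy] at h1
  have h2 : f (a * x ^ 2 * (b * y ^ 2) * -c) = f (-(a * b * c)) := by
    rw [← hf.sq (-(a * b * c)) (x * y) (by simp [ha, hb, hc]) (mul_ne_zero hx hy)]
    congr 1; ring
  rw [h1, h2]; abel

theorem not_isMetabolic_singleton {a : K} (ha : a ≠ 0) : ¬ IsMetabolic {a} := by
  intro h
  have h' : IsMetabolic (Finset.univ.val.map fun _ : Unit => a) := by simpa using h
  obtain ⟨W, hW, hd⟩ := isMetabolic_map_univ.1 h'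
  have := two_finrank_le_of_isotropic (fun _ => ha) hW
  simp at this hd
  omega

theorem exists_sq_of_isMetabolic_pair {a b : K} (ha : a ≠ 0) (hb : b ≠ 0)
    (h : IsMetabolic {a, b}) : ∃ c : K, c ≠ 0 ∧ b = -(a * c ^ 2) := by
  have h' : IsMetabolic (Finset.univ.val.map ![a, b]) := by
    convert h using 1
    simp [Fin.univ_val_map]; rfl
  obtain ⟨W, hW, hd⟩ := isMetabolic_map_univ.1 h'
  have hW0 : W ≠ ⊥ := by
    rintro rfl
    simp at hd
  obtain ⟨v, hv, hv0⟩ := W.exists_mem_ne_zero_of_ne_bot hW0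
  have h1 := hW v hv v hv
  simp only [Fin.sum_univ_two, Matrix.cons_val_zero, Matrix.cons_val_one] at h1
  have hv1 : v 1 ≠ 0 := by
    intro h0
    apply hv0
    simp only [h0, mul_zero, add_zero, mul_eq_zero, ha, false_or, or_self] at h1
    ext i
    fin_cases i <;> assumption
  have hv00 : v 0 ≠ 0 := by
    intro h0
    simp [h0, hb, hv1] at h1
  refine ⟨v 0 / v 1, div_ne_zero hv00 hv1, ?_⟩
  field_simp
  linear_combination h1

/-- Over a finite field of odd characteristic, the Witt group is presented by the relations of
`IsWittFun`. -/
theorem IsWittFun.sum_eq_zero {p : ℕ} [Fact p.Prime] (hp : p ≠ 2) {A : Type} [AddCommGroup A]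
    {f : ZMod p → A} (hf : IsWittFun f) (s : Multiset (ZMod p)) (hs : ∀ a ∈ s, a ≠ 0)
    (h : IsMetabolic s) : (s.map f).sum = 0 := by
  induction hn : s.card using Nat.strong_induction_on generalizing s with
  | _ n ih =>
  have hcases : ∀ s : Multiset (ZMod p), s = 0 ∨ ∃ a t, s = a ::ₘ t := fun s =>
    s.induction_on (Or.inl rfl) fun a t _ => Or.inr ⟨a, t, rfl⟩
  obtain rfl | ⟨a, s, rfl⟩ : s = 0 ∨ ∃ a t, s = a ::ₘ t := hcases s
  · simp
  obtain rfl | ⟨b, s, rfl⟩ : s = 0 ∨ ∃ a t, s = a ::ₘ t := hcases s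
  · exact absurd h (not_isMetabolic_singleton (hs a (by simp)))
  have ha : a ≠ 0 := hs a (by simp)
  have hb : b ≠ 0 := hs b (by simp)
  obtain rfl | ⟨c, s, rfl⟩ : s = 0 ∨ ∃ a t, s = a ::ₘ t := hcases s
  · obtain ⟨c, hc, rfl⟩ := exists_sq_of_isMetabolic_pair ha hb h
    simp only [Multiset.map_cons, Multiset.sum_cons, Multiset.map_zero, Multiset.sum_zero, add_zero]
    rw [hf.neg _ (mul_ne_zero ha (pow_ne_zero _ hc)), hf.sq a c ha hc, add_neg_cancel]
  have hc : c ≠ 0 := hs c (by simp)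
  -- Binary forms over a finite field of odd order are universal, so three terms merge into one and
  -- the length drops by two.
  obtain ⟨x, y, hxy⟩ : ∃ x y, a * x ^ 2 + b * y ^ 2 = -c := by
    obtain ⟨x, y, h⟩ := FiniteField.exists_root_sum_quadratic
      (f := Polynomial.C a * Polynomial.X ^ 2)
      (g := Polynomial.C b * Polynomial.X ^ 2 + Polynomial.C c)
      (Polynomial.degree_C_mul_X_pow 2 ha)
      (by
        rw [Polynomial.degree_add_C (by rw [Polynomial.degree_C_mul_X_pow 2 hb]; norm_num),
          Polynomial.degree_C_mul_X_pow 2 hb]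
        norm_num)
      (by
        rw [ZMod.card]
        exact Nat.odd_iff.1 ((Fact.out : p.Prime).odd_of_ne_two hp))
    refine ⟨x, y, ?_⟩
    simp at h
    linear_combination h
  -- Needed for two Witt functions: for `f` it shortens the sum, for `wittClass` it shows that the
  -- shorter multiset is still metabolic.
  have key : ∀ {B : Type} [AddCommGroup B] {g : ZMod p → B}, IsWittFun g →
      ((a ::ₘ b ::ₘ c ::ₘ s).map g).sum = ((-(a * b * c) ::ₘ s).map g).sum := by
    intro B _ g hg
    simp only [Multiset.map_cons, Multiset.sum_cons]
    rw [← hg.three ha hb hc hxy]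
    abel
  have hs' : ∀ d ∈ (-(a * b * c) ::ₘ s), d ≠ 0 := by
    intro d hd
    rw [Multiset.mem_cons] at hd
    rcases hd with rfl | hd
    · simp [ha, hb, hc]
    · exact hs d (by simp [hd])
  rw [key hf]
  refine ih _ ?_ _ hs' ?_ rfl
  · simp [← hn]
  · rw [← sum_wittClass_eq_zero_iff hs', ← key isWittFun_wittClass, sum_wittClass_eq_zero_iff hs]
    exact h

end WittGroup

end

section


/-! ### Reduction modulo `p` and the second residue form -/

section Residue

variable {p : ℕ} [Fact p.Prime] {ι κ : Type} [Fintype ι] [Fintype κ]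

/-- The integral points of a subspace of `ℚ_p^ι`. -/
def integralPoints (W : Submodule ℚ_[p] (ι → ℚ_[p])) : Submodule ℤ_[p] (ι → ℤ_[p]) where
  carrier := {x | (fun i => (x i : ℚ_[p])) ∈ W}
  zero_mem' := by
    have : (fun i : ι => (((0 : ι → ℤ_[p]) i : ℤ_[p]) : ℚ_[p])) = 0 := by ext; simp
    change _ ∈ W
    rw [this]
    exact W.zero_mem
  add_mem' {x y} hx hy := by
    have : (fun i : ι => (((x + y) i : ℤ_[p]) : ℚ_[p]))
        = (fun i => (x i : ℚ_[p])) + fun i => (y i : ℚ_[p]) := by ext; simp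
    change _ ∈ W
    rw [this]
    exact W.add_mem hx hy
  smul_mem' c x hx := by
    have : (fun i : ι => (((c • x) i : ℤ_[p]) : ℚ_[p]))
        = (c : ℚ_[p]) • (fun i => (x i : ℚ_[p])) := by ext; simp
    change _ ∈ W
    rw [this]
    exact W.smul_mem _ hx

/-- The reduction modulo `p` of the integral points of a subspace of `ℚ_p^ι`. -/
def reduction (W : Submodule ℚ_[p] (ι → ℚ_[p])) : Submodule (ZMod p) (ι → ZMod p) where
  carrier := {y | ∃ x ∈ integralPoints W, (fun i => PadicInt.toZMod (x i)) = y}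
  zero_mem' := ⟨0, zero_mem _, by ext; simp⟩
  add_mem' := by
    rintro _ _ ⟨x, hx, rfl⟩ ⟨y, hy, rfl⟩
    exact ⟨x + y, add_mem hx hy, by ext; simp⟩
  smul_mem' := by
    rintro c _ ⟨x, hx, rfl⟩
    obtain ⟨c, rfl⟩ := ZMod.ringHom_surjective PadicInt.toZMod c
    exact ⟨c • x, Submodule.smul_mem _ c hx, by ext; simp⟩

theorem exists_eq_mul_of_toZMod_eq_zero {x : ℤ_[p]} (h : PadicInt.toZMod x = 0) :
    ∃ y, x = p * y := by
  have h1 : x ∈ RingHom.ker (PadicInt.toZMod (p := p)) := h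
  rw [PadicInt.ker_toZMod, PadicInt.maximalIdeal_eq_span_p, Ideal.mem_span_singleton] at h1
  exact h1

theorem mem_integralPoints_of_smul {p : ℕ} [Fact p.Prime] {ι : Type}
    {W : Submodule ℚ_[p] (ι → ℚ_[p])} {x : ι → ℤ_[p]}
    (h : (p : ℤ_[p]) • x ∈ integralPoints W) : x ∈ integralPoints W := by
  have hp : (p : ℚ_[p]) ≠ 0 := by exact_mod_cast (Fact.out : p.Prime).ne_zero
  have h1 := W.smul_mem (p : ℚ_[p])⁻¹ h
  change (fun i => (x i : ℚ_[p])) ∈ W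
  convert h1 using 1
  ext i
  simp [hp]

/-- The integral points of `W` are saturated: one that reduces to zero is `p` times another. By
Nakayama, lifts of a basis of the reduction generate all integral points, and these span `W` over
`ℚ_p`. -/
theorem finrank_le_finrank_reduction (W : Submodule ℚ_[p] (ι → ℚ_[p])) :
    Module.finrank ℚ_[p] W ≤ Module.finrank (ZMod p) (reduction W) := by
  let e := Module.finBasis (ZMod p) (reduction W)
  choose x hx hxe using fun k => (e k).2
  let N : Submodule ℤ_[p] (ι → ℤ_[p]) := Submodule.span ℤ_[p] (Set.range x)
  have hN : N ≤ integralPoints W := Submodule.span_le.2 (by rintro _ ⟨k, rfl⟩; exact hx k)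
  have hle : integralPoints W ≤ N := by
    refine Submodule.le_of_le_smul_of_le_jacobson_bot (I := IsLocalRing.maximalIdeal ℤ_[p])
      (IsNoetherian.noetherian _) (IsLocalRing.maximalIdeal_le_jacobson _) ?_
    intro z hz
    choose c hc using fun k => ZMod.ringHom_surjective (PadicInt.toZMod (p := p))
      (e.repr ⟨_, z, hz, rfl⟩ k)
    have hmem : ∑ k, c k • x k ∈ N :=
      Submodule.sum_mem _ fun k _ => Submodule.smul_mem _ _ (Submodule.subset_span ⟨k, rfl⟩)
    have hred : ∀ i, PadicInt.toZMod ((z - ∑ k, c k • x k) i) = 0 := by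
      intro i
      have h1 := congrFun (congrArg Subtype.val (e.sum_repr ⟨_, z, hz, rfl⟩)) i
      simp only [Submodule.coe_sum, Submodule.coe_smul, Finset.sum_apply, Pi.smul_apply,
        smul_eq_mul] at h1
      simp only [Pi.sub_apply, Finset.sum_apply, Pi.smul_apply, smul_eq_mul, map_sub, map_sum,
        map_mul, hc]
      rw [← h1, sub_eq_zero]
      refine Finset.sum_congr rfl fun k _ => ?_
      rw [← hxe k]
    choose y hy using fun i => exists_eq_mul_of_toZMod_eq_zero (hred i)
    have hy' : z - ∑ k, c k • x k = (p : ℤ_[p]) • y := by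
      ext1 i
      exact hy i
    have hyM : y ∈ integralPoints W := by
      apply mem_integralPoints_of_smul
      rw [← hy']
      exact sub_mem hz (hN hmem)
    rw [← sub_add_cancel z (∑ k, c k • x k), hy', add_comm]
    refine Submodule.add_mem_sup hmem (Submodule.smul_mem_smul ?_ hyM)
    rw [PadicInt.maximalIdeal_eq_span_p]
    exact Ideal.mem_span_singleton_self _
  let X : Fin (Module.finrank (ZMod p) (reduction W)) → ι → ℚ_[p] := fun k i => (x k i : ℚ_[p])
  have hspan : ∀ z ∈ N, (fun i => (z i : ℚ_[p])) ∈ Submodule.span ℚ_[p] (Set.range X) := by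
    intro z hz
    induction hz using Submodule.span_induction with
    | mem z h =>
      obtain ⟨k, rfl⟩ := h
      exact Submodule.subset_span ⟨k, rfl⟩
    | zero =>
      convert Submodule.zero_mem _
      simp
    | add z w _ _ h1 h2 =>
      convert Submodule.add_mem _ h1 h2 using 1
      ext; simp
    | smul c z _ h =>
      convert Submodule.smul_mem _ (c : ℚ_[p]) h using 1
      ext; simp
  have hW : W ≤ Submodule.span ℚ_[p] (Set.range X) := by
    intro w hw
    have hp1 : (1 : ℝ) < p := by exact_mod_cast (Fact.out : p.Prime).one_lt
    obtain ⟨k, hk⟩ := pow_unbounded_of_one_lt ‖w‖ hp1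
    have hp0 : ((p : ℚ_[p]) ^ k) ≠ 0 :=
      pow_ne_zero _ (by exact_mod_cast (Fact.out : p.Prime).ne_zero)
    have hint : ∀ i, ‖(p : ℚ_[p]) ^ k * w i‖ ≤ 1 := by
      intro i
      rw [norm_mul, norm_pow, Padic.norm_p, inv_pow, inv_mul_le_iff₀ (by positivity), mul_one]
      exact (norm_le_pi_norm w i).trans hk.le
    have h1 := hspan (fun i => ⟨_, hint i⟩) (hle (W.smul_mem ((p : ℚ_[p]) ^ k) hw))
    have h2 := Submodule.smul_mem _ ((p : ℚ_[p]) ^ k)⁻¹ h1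
    convert h2 using 1
    ext i
    simp [hp0]
  calc _ ≤ _ := Submodule.finrank_mono hW
    _ ≤ _ := finrank_range_le_card X
    _ = _ := Fintype.card_fin _

/-- The second residue form of a metabolic form over `ℚ_p` is metabolic over `𝔽_p`. -/
theorem Metabolic.residue {u : ι → ℤ} {v : κ → ℤ} (hu : ∀ i, ¬ (p : ℤ) ∣ u i)
    (h : Metabolic (Sum.elim (fun i => (u i : ℚ_[p])) fun j => (p : ℚ_[p]) * v j)) :
    Metabolic (fun j => (v j : ZMod p)) := by
  obtain ⟨W, hW, hd⟩ := h
  have hp : (p : ℤ_[p]) ≠ 0 := by exact_mod_cast (Fact.out : p.Prime).ne_zero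
  have hform : ∀ x ∈ integralPoints W, ∀ y ∈ integralPoints W,
      ∑ i, (u i : ℤ_[p]) * x (Sum.inl i) * y (Sum.inl i)
        + p * ∑ j, (v j : ℤ_[p]) * x (Sum.inr j) * y (Sum.inr j) = 0 := by
    intro x hx y hy
    have h1 := hW _ hx _ hy
    rw [Fintype.sum_sum_type] at h1
    simp only [Sum.elim_inl, Sum.elim_inr] at h1
    have hinj : Function.Injective (PadicInt.Coe.ringHom (p := p)) := Subtype.val_injective
    apply hinj
    have hcoe : ∀ z : ℤ_[p], PadicInt.Coe.ringHom z = (z : ℚ_[p]) := fun _ => rfl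
    rw [map_zero, ← h1, map_add, map_mul, map_sum, map_sum, Finset.mul_sum]
    simp only [hcoe, PadicInt.coe_mul, PadicInt.coe_intCast, PadicInt.coe_natCast, mul_assoc]
  have hle := finrank_le_finrank_reduction W
  have hsum := finrank_map_restrictLeft_add (reduction W)
  -- Modulo `p` only the `u`-part of the form survives, so the projection of the reduction to `ι` is
  -- isotropic and at most half-dimensional. The kernel of that projection then has at least half
  -- the dimension of the `κ`-part.
  have hleft : 2 * Module.finrank (ZMod p) ((reduction W).map (restrictLeft (ZMod p) ι κ))
      ≤ Fintype.card ι := by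
    apply two_finrank_le_of_isotropic (a := fun i => (u i : ZMod p))
    · intro i h0
      exact hu i ((ZMod.intCast_zmod_eq_zero_iff_dvd _ _).1 h0)
    · rintro _ ⟨_, ⟨x, hx, rfl⟩, rfl⟩ _ ⟨_, ⟨y, hy, rfl⟩, rfl⟩
      have h1 := congrArg PadicInt.toZMod (hform x hx y hy)
      simpa using h1
  refine ⟨(reduction W).comap (extendRight (ZMod p) ι κ), ?_, ?_⟩
  · rintro a ⟨x, hx, hxa⟩ b ⟨y, hy, hyb⟩
    -- Vectors whose `ι`-component vanishes modulo `p` contribute a multiple of `p²` through `u`;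
    -- after division by `p`, reduction leaves only the `v`-part.
    choose x' hx' using fun i => exists_eq_mul_of_toZMod_eq_zero (congrFun hxa (Sum.inl i))
    choose y' hy' using fun i => exists_eq_mul_of_toZMod_eq_zero (congrFun hyb (Sum.inl i))
    have h1 := hform x hx y hy
    simp only [hx', hy'] at h1
    have h2 : p * ∑ i, (u i : ℤ_[p]) * x' i * y' i
        + ∑ j, (v j : ℤ_[p]) * x (Sum.inr j) * y (Sum.inr j) = 0 := by
      apply mul_left_cancel₀ hp
      rw [mul_zero, ← h1, mul_add, Finset.mul_sum, Finset.mul_sum]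
      congr 1
      exact Finset.sum_congr rfl fun j _ => by ring
    have h3 := congrArg PadicInt.toZMod h2
    simp only [map_add, map_mul, map_natCast, CharP.cast_eq_zero, zero_mul, zero_add, map_sum,
      map_intCast, map_zero] at h3
    rw [← h3]
    refine Finset.sum_congr rfl fun j _ => ?_
    have ha : a j = PadicInt.toZMod (x (Sum.inr j)) := (congrFun hxa (Sum.inr j)).symm
    have hb : b j = PadicInt.toZMod (y (Sum.inr j)) := (congrFun hyb (Sum.inr j)).symm
    rw [ha, hb]
  · rw [Fintype.card_sum] at hd
    omega

theorem IsMetabolic.residue {s t : Multiset ℤ} (hs : ∀ n ∈ s, ¬ (p : ℤ) ∣ n)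
    (h : IsMetabolic (s.map (fun n : ℤ => (n : ℚ_[p])) + t.map fun n : ℤ => (p : ℚ_[p]) * n)) :
    IsMetabolic (t.map fun n : ℤ => (n : ZMod p)) := by
  obtain ⟨n, u, rfl⟩ := exists_map_univ_eq s
  obtain ⟨m, v, rfl⟩ := exists_map_univ_eq t
  rw [Multiset.map_map, Multiset.map_map, ← map_univ_sum_elim, isMetabolic_map_univ] at h
  rw [Multiset.map_map, isMetabolic_map_univ]
  exact Metabolic.residue (fun i => hs _ (Multiset.mem_map_of_mem _ (Finset.mem_univ i))) h

end Residue

end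

section


/-! ### Elimination of primes in the Witt group of `ℚ` -/

/-- The monoid generated by the nonzero integers of absolute value less than `k`. -/
def smoothInts (k : ℕ) : Submonoid ℤ := Submonoid.closure {n : ℤ | n ≠ 0 ∧ |n| < k}

theorem mem_smoothInts {k : ℕ} {n : ℤ} (h0 : n ≠ 0) (h : |n| < k) : n ∈ smoothInts k :=
  Submonoid.subset_closure ⟨h0, h⟩

theorem ne_zero_of_mem_smoothInts {k : ℕ} {n : ℤ} (h : n ∈ smoothInts k) : n ≠ 0 := by
  induction h using Submonoid.closure_induction with
  | mem x h => exact h.1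
  | one => exact one_ne_zero
  | mul x y _ _ hx hy => exact mul_ne_zero hx hy

theorem not_dvd_of_mem_smoothInts {p : ℕ} (hp : p.Prime) {n : ℤ} (h : n ∈ smoothInts p) :
    ¬ (p : ℤ) ∣ n := by
  induction h using Submonoid.closure_induction with
  | mem x h =>
    intro hd
    have := Int.eq_zero_of_abs_lt_dvd hd h.2
    exact h.1 this
  | one =>
    intro hd
    exact hp.one_lt.ne' (by exact_mod_cast Int.eq_one_of_dvd_one (by positivity) hd)
  | mul x y _ _ hx hy =>
    intro hd
    exact ((Nat.prime_iff_prime_int.1 hp).dvd_or_dvd hd).elim hx hy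

/-- The subgroup of the Witt group of `ℚ` generated by the forms `⟨n⟩` with `n ∈ smoothInts k`. -/
def wittFiltration (k : ℕ) : AddSubgroup (WittGroup ℚ) :=
  AddSubgroup.closure {w | ∃ n ∈ smoothInts k, w = wittClass (n : ℚ)}

theorem wittClass_mem_wittFiltration {k : ℕ} {n : ℤ} (h : n ∈ smoothInts k) :
    wittClass (n : ℚ) ∈ wittFiltration k :=
  AddSubgroup.subset_closure ⟨n, h, rfl⟩

theorem neg_mem_smoothInts {k : ℕ} (hk : 2 ≤ k) {n : ℤ} (h : n ∈ smoothInts k) :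
    -n ∈ smoothInts k := by
  rw [← neg_one_mul]
  refine mul_mem (mem_smoothInts (by norm_num) ?_) h
  simp only [abs_neg, abs_one]
  exact_mod_cast hk

theorem exists_multiset_of_mem_wittFiltration {k : ℕ} (hk : 2 ≤ k) {w : WittGroup ℚ}
    (h : w ∈ wittFiltration k) : ∃ s : Multiset ℤ, (∀ n ∈ s, n ∈ smoothInts k) ∧
      w = (s.map fun n : ℤ => wittClass (n : ℚ)).sum := by
  induction h using AddSubgroup.closure_induction with
  | mem x h =>
    obtain ⟨n, hn, rfl⟩ := h
    exact ⟨{n}, by simpa using hn, by simp⟩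
  | zero => exact ⟨0, by simp, by simp⟩
  | add x y _ _ hx hy =>
    obtain ⟨s, hs, rfl⟩ := hx
    obtain ⟨t, ht, rfl⟩ := hy
    refine ⟨s + t, fun n hn => ?_, by simp⟩
    exact (Multiset.mem_add.1 hn).elim (hs n) (ht n)
  | neg x _ hx =>
    obtain ⟨s, hs, rfl⟩ := hx
    refine ⟨s.map Neg.neg, fun n hn => ?_, ?_⟩
    · obtain ⟨m, hm, rfl⟩ := Multiset.mem_map.1 hn
      exact neg_mem_smoothInts hk (hs m hm)
    · rw [Multiset.map_map, ← Multiset.sum_map_neg', Multiset.map_map]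
      congr 1
      refine Multiset.map_congr rfl fun n hn => ?_
      have : (n : ℚ) ≠ 0 := by exact_mod_cast ne_zero_of_mem_smoothInts (hs n hn)
      simp [isWittFun_wittClass.neg _ this]

section Tame

variable (p : ℕ)

/-- The class of `⟨n⟩` modulo the `p`-smooth part of the Witt group. -/
def tameClass (n : ℤ) : WittGroup ℚ ⧸ wittFiltration p :=
  QuotientAddGroup.mk (wittClass (n : ℚ))

variable {p}

theorem tameClass_eq_zero {n : ℤ} (h : n ∈ smoothInts p) : tameClass p n = 0 :=
  (QuotientAddGroup.eq_zero_iff _).2 (wittClass_mem_wittFiltration h)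

theorem tameClass_mul_sq {n c : ℤ} (hn : n ≠ 0) (hc : c ≠ 0) :
    tameClass p (n * c ^ 2) = tameClass p n := by
  rw [tameClass, tameClass]
  push_cast
  rw [isWittFun_wittClass.sq _ _ (by exact_mod_cast hn) (by exact_mod_cast hc)]

theorem tameClass_neg {n : ℤ} (hn : n ≠ 0) : tameClass p (-n) = -tameClass p n := by
  rw [tameClass, tameClass]
  push_cast
  rw [isWittFun_wittClass.neg _ (by exact_mod_cast hn)]
  rfl

theorem tameClass_add {a b : ℤ} (ha : a ≠ 0) (hb : b ≠ 0) (hab : a + b ≠ 0) :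
    tameClass p a + tameClass p b = tameClass p (a + b) + tameClass p (a * b * (a + b)) := by
  simp only [tameClass]
  rw [← QuotientAddGroup.mk_add, isWittFun_wittClass.add _ _ (by exact_mod_cast ha)
    (by exact_mod_cast hb) (by exact_mod_cast hab)]
  push_cast
  rfl

/-- Two integers define the same second residue class, universally for smooth multiples. -/
def TameEquiv (p : ℕ) (a b : ℤ) : Prop :=
  ∀ c ∈ smoothInts p, tameClass p (p * a * c) = tameClass p (p * b * c)

/-- This is the Witt relation for `p a c` and `p² q c`. The second term is smooth up to a square,
and the product of both terms with their sum is smooth up to the square of `p² c`, so modulo the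
smooth part only the two classes in question remain. -/
theorem tameEquiv_add_mul (hp : p ≠ 0) {a q : ℤ} (ha : a ∈ smoothInts p) (hq : q ∈ smoothInts p)
    (haq : a + p * q ∈ smoothInts p) : TameEquiv p a (a + p * q) := by
  intro c hc
  have ha0 := ne_zero_of_mem_smoothInts ha
  have hq0 := ne_zero_of_mem_smoothInts hq
  have haq0 := ne_zero_of_mem_smoothInts haq
  have hc0 := ne_zero_of_mem_smoothInts hc
  have hp0 : (p : ℤ) ≠ 0 := by exact_mod_cast hp
  have h := tameClass_add (p := p) (a := p * a * c) (b := q * c * p ^ 2)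
    (by positivity) (by positivity) (by
      have : (p : ℤ) * a * c + q * c * p ^ 2 = p * (a + p * q) * c := by ring
      rw [this]
      exact mul_ne_zero (mul_ne_zero hp0 haq0) hc0)
  have e1 : (p : ℤ) * a * c + q * c * p ^ 2 = p * (a + p * q) * c := by ring
  have e2 : (p : ℤ) * a * c * (q * c * p ^ 2) * (p * (a + p * q) * c)
      = (a * q * (a + p * q) * c) * (p ^ 2 * c) ^ 2 := by ring
  rw [tameClass_mul_sq (by positivity) hp0, tameClass_eq_zero (mul_mem hq hc), e1, e2,
    tameClass_mul_sq (mul_ne_zero (mul_ne_zero (by positivity) haq0) hc0) (by positivity),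
    tameClass_eq_zero (mul_mem (mul_mem (mul_mem ha hq) haq) hc), add_zero, add_zero] at h
  exact h

/-- A smooth integer is reduced modulo `p` factor by factor. The product `r s` of two residues has
quotient `r s / p < p`, so the remainder and any nonzero quotient are smooth and `tameEquiv_add_mul`
applies. Reducing a smooth integer in one step would fail, as its quotient by `p` need not be
smooth. -/
theorem exists_tameEquiv_nat (hp : p.Prime) {t : ℤ} (ht : t ∈ smoothInts p) :
    ∃ r : ℕ, 0 < r ∧ r < p ∧ (p : ℤ) ∣ t - r ∧ TameEquiv p t r := by
  have hnat : ∀ r : ℕ, 0 < r → r < p → (r : ℤ) ∈ smoothInts p := fun r h1 h2 =>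
    mem_smoothInts (by positivity) (by rw [abs_of_nonneg (by positivity)]; exact_mod_cast h2)
  have hp2 := hp.two_le
  induction ht using Submonoid.closure_induction with
  | mem x h =>
    obtain ⟨h0, h1⟩ := h
    rcases lt_or_gt_of_ne h0 with hneg | hpos
    · refine ⟨(p + x).toNat, ?_, ?_, ?_, ?_⟩
      · rw [abs_of_neg hneg] at h1; omega
      · omega
      · rw [abs_of_neg hneg] at h1
        refine ⟨-1, ?_⟩
        omega
      · rw [abs_of_neg hneg] at h1
        have e : (((p + x).toNat : ℕ) : ℤ) = x + p * 1 := by omega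
        rw [e]
        refine tameEquiv_add_mul hp.ne_zero
          (mem_smoothInts h0 (by rw [abs_of_neg hneg]; exact h1)) (one_mem _) ?_
        rw [← e]
        exact hnat _ (by omega) (by omega)
    · refine ⟨x.toNat, by omega, ?_, ?_, ?_⟩
      · rw [abs_of_pos hpos] at h1; omega
      · rw [Int.toNat_of_nonneg hpos.le, sub_self]
        exact dvd_zero _
      · rw [Int.toNat_of_nonneg hpos.le]
        exact fun c _ => rfl
  | one => exact ⟨1, one_pos, hp.one_lt, by simp, fun c _ => rfl⟩
  | mul x y hx hy ihx ihy =>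
    obtain ⟨r, hr0, hrp, hrd, hr⟩ := ihx
    obtain ⟨s, hs0, hsp, hsd, hs⟩ := ihy
    have hprod : TameEquiv p (x * y) (r * s) := by
      intro c hc
      have e1 := hr (y * c) (mul_mem hy hc)
      have e2 := hs (r * c) (mul_mem (hnat r hr0 hrp) hc)
      calc tameClass p (p * (x * y) * c) = tameClass p (p * x * (y * c)) := by congr 1; ring
        _ = tameClass p (p * y * (r * c)) := by rw [e1]; congr 1; ring
        _ = tameClass p (p * (r * s) * c) := by rw [e2]; congr 1; ring
    have hmod : (p : ℤ) ∣ x * y - r * s := by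
      have : x * y - r * s = (x - r) * y + r * (y - s) := by ring
      rw [this]
      exact dvd_add (hrd.mul_right _) (hsd.mul_left _)
    have hpd : ¬ p ∣ r * s := by
      intro hd
      rcases hp.dvd_mul.1 hd with h | h
      · exact absurd (Nat.le_of_dvd hr0 h) (by omega)
      · exact absurd (Nat.le_of_dvd hs0 h) (by omega)
    have hm0 : 0 < r * s % p := Nat.pos_of_ne_zero fun h => hpd (Nat.dvd_of_mod_eq_zero h)
    have hmp : r * s % p < p := Nat.mod_lt _ hp.pos
    have hdiv : ((r * s % p : ℕ) : ℤ) + p * ((r * s / p : ℕ) : ℤ) = r * s := by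
      exact_mod_cast Nat.mod_add_div (r * s) p
    refine ⟨r * s % p, hm0, hmp, ?_, fun c hc => (hprod c hc).trans ?_⟩
    · have : x * y - ((r * s % p : ℕ) : ℤ) = (x * y - r * s) + p * ((r * s / p : ℕ) : ℤ) := by
        rw [← hdiv]; ring
      rw [this]
      exact dvd_add hmod (dvd_mul_right _ _)
    · by_cases hq : r * s / p = 0
      · rw [hq] at hdiv
        rw [← hdiv]
        simp
      · have hqp : r * s / p < p := by
          rw [Nat.div_lt_iff_lt_mul hp.pos]
          exact Nat.mul_lt_mul'' hrp hsp
        have := tameEquiv_add_mul hp.ne_zero (hnat _ hm0 hmp)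
          (hnat _ (Nat.pos_of_ne_zero hq) hqp) (by
            rw [hdiv]; exact mul_mem (hnat r hr0 hrp) (hnat s hs0 hsp))
        rw [hdiv] at this
        exact (this c hc).symm

/-- The class of `⟨p r⟩` for a residue class `r` modulo `p`. -/
def residueClass (p : ℕ) (x : ZMod p) : WittGroup ℚ ⧸ wittFiltration p :=
  tameClass p (p * x.val)

theorem tameClass_mul_eq (hp : p.Prime) {t : ℤ} (ht : t ∈ smoothInts p) :
    tameClass p (p * t) = residueClass p t := by
  obtain ⟨r, hr0, hrp, hd, hr⟩ := exists_tameEquiv_nat hp ht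
  have h1 := hr 1 (one_mem _)
  rw [mul_one, mul_one] at h1
  have h2 : (t : ZMod p) = (r : ZMod p) := by
    have := (ZMod.intCast_eq_intCast_iff_dvd_sub r t p).2 hd
    simpa using this.symm
  rw [h1, residueClass, h2, ZMod.val_cast_of_lt hrp]

theorem isWittFun_residueClass [Fact p.Prime] : IsWittFun (residueClass p) := by
  have hp : p.Prime := Fact.out
  have hp0 : (p : ℤ) ≠ 0 := by exact_mod_cast hp.ne_zero
  have hval : ∀ x : ZMod p, x ≠ 0 → (x.val : ℤ) ∈ smoothInts p := fun x hx =>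
    mem_smoothInts (by exact_mod_cast (ZMod.val_ne_zero x).2 hx)
      (by rw [abs_of_nonneg (by positivity)]; exact_mod_cast ZMod.val_lt x)
  have hcast : ∀ x : ZMod p, (((x.val : ℕ) : ℤ) : ZMod p) = x := fun x => by simp
  refine ⟨fun a c ha hc => ?_, fun a ha => ?_, fun a b ha hb hab => ?_⟩
  · have h1 : (a.val : ℤ) * (c.val : ℤ) ^ 2 ∈ smoothInts p :=
      mul_mem (hval a ha) (pow_mem (hval c hc) 2)
    have h2 := tameClass_mul_eq hp h1
    rw [Int.cast_mul, Int.cast_pow, hcast, hcast] at h2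
    rw [← h2, ← mul_assoc, tameClass_mul_sq
      (mul_ne_zero hp0 (ne_zero_of_mem_smoothInts (hval a ha)))
      (ne_zero_of_mem_smoothInts (hval c hc))]
    rfl
  · have h2 := tameClass_mul_eq hp (neg_mem_smoothInts hp.two_le (hval a ha))
    rw [Int.cast_neg, hcast] at h2
    rw [← h2, mul_neg, tameClass_neg (mul_ne_zero hp0 (ne_zero_of_mem_smoothInts (hval a ha)))]
    rfl
  · have hbv := ZMod.val_lt b
    have hav := ZMod.val_lt a
    have ha0 : a.val ≠ 0 := (ZMod.val_ne_zero a).2 ha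
    have hb0 : b.val ≠ 0 := (ZMod.val_ne_zero b).2 hb
    set r : ℤ := ((a.val : ℕ) : ℤ) with hr
    -- Subtracting `p` from the representative of `b` keeps `|r + s| < p`, which makes `r + s`
    -- smooth.
    set s : ℤ := ((b.val : ℕ) : ℤ) - p with hs
    have hrc : ((r : ℤ) : ZMod p) = a := hcast a
    have hsc : ((s : ℤ) : ZMod p) = b := by simp [hs]
    have hrm : r ∈ smoothInts p := hval a ha
    have hsm : s ∈ smoothInts p := mem_smoothInts (by omega) (by rw [abs_lt]; omega)
    have hrs0 : r + s ≠ 0 := by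
      intro h
      apply hab
      rw [← hrc, ← hsc, ← Int.cast_add, h, Int.cast_zero]
    have hrsm : r + s ∈ smoothInts p := mem_smoothInts hrs0 (by rw [abs_lt]; omega)
    have e1 := tameClass_mul_eq hp hrm
    have e2 := tameClass_mul_eq hp hsm
    have e3 := tameClass_mul_eq hp hrsm
    have e4 := tameClass_mul_eq hp (mul_mem (mul_mem hrm hsm) hrsm)
    push_cast at e3 e4
    rw [hrc] at e1
    rw [hsc] at e2
    rw [hrc, hsc] at e3 e4
    have hr0 := ne_zero_of_mem_smoothInts hrm
    have hs0 := ne_zero_of_mem_smoothInts hsm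
    have h := tameClass_add (p := p) (a := p * r) (b := p * s) (mul_ne_zero hp0 hr0)
      (mul_ne_zero hp0 hs0) (by rw [← mul_add]; exact mul_ne_zero hp0 hrs0)
    have e5 : (p : ℤ) * r * (p * s) * (p * r + p * s) = p * (r * s * (r + s)) * p ^ 2 := by ring
    rw [e5, tameClass_mul_sq (mul_ne_zero hp0 (mul_ne_zero (mul_ne_zero hr0 hs0) hrs0)) hp0,
      ← mul_add, e1, e2, e3, e4] at h
    exact h

end Tame

theorem IsMetabolic.even_card {p : ℕ} [Fact p.Prime] {s : Multiset (ZMod p)}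
    (hs : ∀ a ∈ s, a ≠ 0) (h : IsMetabolic s) : Even s.card := by
  obtain ⟨n, a, rfl⟩ := exists_map_univ_eq s
  obtain ⟨W, hW, hd⟩ := isMetabolic_map_univ.1 h
  have := two_finrank_le_of_isotropic
    (fun i => hs _ (Multiset.mem_map_of_mem _ (Finset.mem_univ i))) hW
  simp only [Multiset.card_map, Finset.card_val, Finset.card_univ]
  exact ⟨Module.finrank (ZMod p) W, by omega⟩

theorem mem_smoothInts_two {n : ℤ} (h : n ∈ smoothInts 2) : n = 1 ∨ n = -1 := by
  induction h using Submonoid.closure_induction with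
  | mem x h =>
    obtain ⟨h0, h1⟩ := h
    rw [abs_lt] at h1
    push_cast at h1
    omega
  | one => exact Or.inl rfl
  | mul x y _ _ hx hy => rcases hx with rfl | rfl <;> rcases hy with rfl | rfl <;> simp

theorem eq_one_of_ne_zero_zmod_two : ∀ a : ZMod 2, a ≠ 0 → a = 1 := by decide

/-- Modulo the smooth part, `⟨p n⟩` depends only on `n` modulo `p` and obeys the relations of
`IsWittFun`. For odd `p` these relations suffice to annihilate every metabolic form over `𝔽_p`. This
is what removes `p` from a form. -/
theorem sum_wittClass_mul_mem_wittFiltration {p : ℕ} [Fact p.Prime] {s : Multiset ℤ}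
    (hs : ∀ n ∈ s, n ∈ smoothInts p) (h : IsMetabolic (s.map fun n : ℤ => (n : ZMod p))) :
    (s.map fun n : ℤ => wittClass ((p : ℚ) * n)).sum ∈ wittFiltration p := by
  have hp : p.Prime := Fact.out
  have hne : ∀ a ∈ s.map (fun n : ℤ => (n : ZMod p)), a ≠ 0 := by
    intro a ha
    obtain ⟨n, hn, rfl⟩ := Multiset.mem_map.1 ha
    intro h0
    exact not_dvd_of_mem_smoothInts hp (hs n hn) ((ZMod.intCast_zmod_eq_zero_iff_dvd _ _).1 h0)
  rw [← QuotientAddGroup.eq_zero_iff]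
  have h1 : (((s.map fun n : ℤ => wittClass ((p : ℚ) * n)).sum : WittGroup ℚ) :
      WittGroup ℚ ⧸ wittFiltration p) = ((s.map fun n : ℤ => (n : ZMod p)).map (residueClass p)).sum := by
    rw [← QuotientAddGroup.mk'_apply, map_multiset_sum, Multiset.map_map, Multiset.map_map]
    congr 1
    refine Multiset.map_congr rfl fun n hn => ?_
    rw [Function.comp_apply, Function.comp_apply, ← tameClass_mul_eq hp (hs n hn)]
    simp [tameClass]
  rw [h1]
  by_cases hp2 : p = 2
  -- At `p = 2` all terms have the class of `⟨2⟩`, their number is even, and `⟨2⟩ + ⟨2⟩ = ⟨1⟩ + ⟨1⟩`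
  -- is smooth.
  · subst hp2
    obtain ⟨m, hm⟩ := h.even_card hne
    have h2 : ∀ a ∈ s.map (fun n : ℤ => (n : ZMod 2)), residueClass 2 a = tameClass 2 2 := by
      intro a ha
      rw [eq_one_of_ne_zero_zmod_two a (hne a ha)]
      simp [residueClass, ZMod.val_one]
    have h3 : tameClass 2 2 + tameClass 2 2 = 0 := by
      have h := tameClass_add (p := 2) (a := 1) (b := 1) one_ne_zero one_ne_zero (by norm_num)
      rw [tameClass_eq_zero (one_mem _), add_zero] at h
      exact h.symm
    rw [Multiset.map_congr rfl h2, Multiset.map_const', Multiset.sum_replicate, hm, add_nsmul,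
      ← nsmul_add, h3, nsmul_zero]
  · exact isWittFun_residueClass.sum_eq_zero hp2 _ hne h

end

section


/-! ### The local-global principle for metabolic forms over `ℚ` -/

section Ordered

variable {K : Type} [Field K] [LinearOrder K] [IsStrictOrderedRing K] {ι κ : Type} [Fintype ι]
  [Fintype κ]

theorem eq_zero_of_restrictRight_eq_zero {a : ι → K} {b : κ → K} (ha : ∀ i, 0 < a i)
    {v : ι ⊕ κ → K} (hv : ∑ i, Sum.elim a (-b) i * v i * v i = 0)
    (h0 : restrictRight K ι κ v = 0) : v = 0 := by
  have h1 : ∀ j, v (Sum.inr j) = 0 := fun j => congrFun h0 j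
  rw [Fintype.sum_sum_type] at hv
  simp only [Sum.elim_inl, Sum.elim_inr, h1, mul_zero, Finset.sum_const_zero, add_zero] at hv
  rw [Finset.sum_eq_zero_iff_of_nonneg fun i _ => by
    rw [mul_assoc]
    exact mul_nonneg (ha i).le (mul_self_nonneg _)] at hv
  ext (i | i)
  · have := hv i (Finset.mem_univ i)
    simpa [(ha i).ne'] using this
  · exact h1 i

/-- A vector of `W` with vanishing second component is isotropic for the positive form `a`, hence
zero. -/
theorem finrank_le_of_isotropic {a : ι → K} {b : κ → K} (ha : ∀ i, 0 < a i)
    {W : Submodule K (ι ⊕ κ → K)}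
    (hW : ∀ v ∈ W, ∀ w ∈ W, ∑ i, Sum.elim a (-b) i * v i * w i = 0) :
    Function.Injective ((restrictRight K ι κ).domRestrict W) := by
  rw [← LinearMap.ker_eq_bot, LinearMap.ker_eq_bot']
  rintro ⟨v, hv⟩ h
  exact Subtype.ext (eq_zero_of_restrictRight_eq_zero ha (hW v hv v hv) h)

/-- Sylvester's inertia: the isotropic subspace embeds in either summand, so its dimension bounds
both sizes. -/
theorem Metabolic.card_eq {a : ι → K} {b : κ → K} (ha : ∀ i, 0 < a i) (hb : ∀ i, 0 < b i)
    (h : Metabolic (Sum.elim a (-b))) : Fintype.card ι = Fintype.card κ := by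
  have key : ∀ {ι κ : Type} [Fintype ι] [Fintype κ] {a : ι → K} {b : κ → K},
      (∀ i, 0 < a i) → Metabolic (Sum.elim a (-b)) → Fintype.card ι ≤ Fintype.card κ := by
    intro ι κ _ _ a b ha ⟨W, hW, hd⟩
    have h1 := LinearMap.finrank_le_finrank_of_injective (finrank_le_of_isotropic ha hW)
    rw [Module.finrank_fintype_fun_eq_card] at h1
    rw [Fintype.card_sum] at hd
    omega
  refine le_antisymm (key ha h) (key (a := b) (b := a) hb ?_)
  have h1 := h.neg.reindex (Equiv.sumComm κ ι)
  convert h1 using 1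
  ext (i | i) <;> simp

end Ordered

theorem exists_smooth_mul_sq {p : ℕ} (hp : p.Prime) {n : ℤ} (hn : n ∈ smoothInts (p + 1)) :
    ∃ t ∈ smoothInts p, ∃ c : ℤ, c ≠ 0 ∧ (n = t * c ^ 2 ∨ n = p * t * c ^ 2) := by
  have hp0 : (p : ℤ) ≠ 0 := by exact_mod_cast hp.ne_zero
  induction hn using Submonoid.closure_induction with
  | mem x h =>
    obtain ⟨h0, h1⟩ := h
    push_cast at h1
    rcases lt_or_eq_of_le (Int.lt_add_one_iff.1 h1) with h2 | h2
    · exact ⟨x, mem_smoothInts h0 h2, 1, one_ne_zero, Or.inl (by ring)⟩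
    · rcases (abs_eq (by positivity)).1 h2 with rfl | rfl
      · exact ⟨1, one_mem _, 1, one_ne_zero, Or.inr (by ring)⟩
      · exact ⟨-1, neg_mem_smoothInts hp.two_le (one_mem _), 1, one_ne_zero, Or.inr (by ring)⟩
  | one => exact ⟨1, one_mem _, 1, one_ne_zero, Or.inl (by ring)⟩
  | mul x y _ _ hx hy =>
    obtain ⟨t, ht, c, hc, h⟩ := hx
    obtain ⟨t', ht', c', hc', h'⟩ := hy
    rcases h with rfl | rfl <;> rcases h' with rfl | rfl
    · exact ⟨t * t', mul_mem ht ht', c * c', mul_ne_zero hc hc', Or.inl (by ring)⟩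
    · exact ⟨t * t', mul_mem ht ht', c * c', mul_ne_zero hc hc', Or.inr (by ring)⟩
    · exact ⟨t * t', mul_mem ht ht', c * c', mul_ne_zero hc hc', Or.inr (by ring)⟩
    · exact ⟨t * t', mul_mem ht ht', p * c * c', mul_ne_zero (mul_ne_zero hp0 hc) hc',
        Or.inl (by ring)⟩

/-- A composite `k` is a product of two smaller factors, so only primes enlarge the monoid. -/
theorem smoothInts_succ_le {k : ℕ} (hk : 2 ≤ k) (hp : ¬ k.Prime) :
    smoothInts (k + 1) ≤ smoothInts k := by
  refine (Submonoid.closure_le (S := smoothInts k)).2 ?_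
  rintro n ⟨h0, h1⟩
  push_cast at h1
  rcases lt_or_eq_of_le (Int.lt_add_one_iff.1 h1) with h2 | h2
  · exact mem_smoothInts h0 h2
  · obtain ⟨a, ⟨b, hab⟩, ha2, hak⟩ := Nat.exists_dvd_of_not_prime2 hk hp
    have hb : b < k := by
      by_contra hbk
      push Not at hbk
      nlinarith
    have hb0 : b ≠ 0 := by rintro rfl; omega
    have hkm : (k : ℤ) ∈ smoothInts k := by
      have : (k : ℤ) = (a : ℤ) * b := by exact_mod_cast hab
      nth_rw 1 [this]
      exact mul_mem (mem_smoothInts (by omega) (by rw [Nat.abs_cast]; exact_mod_cast hak))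
        (mem_smoothInts (by omega) (by rw [Nat.abs_cast]; exact_mod_cast hb))
    rcases (abs_eq (by positivity)).1 h2 with rfl | rfl
    · exact hkm
    · exact neg_mem_smoothInts hk hkm

theorem exists_residue_decomposition {p : ℕ} (hp : p.Prime) (s : Multiset ℤ)
    (hs : ∀ n ∈ s, n ∈ smoothInts (p + 1)) :
    ∃ s0 s1 : Multiset ℤ, (∀ n ∈ s0, n ∈ smoothInts p) ∧ (∀ n ∈ s1, n ∈ smoothInts p) ∧
      (s.map fun n : ℤ => wittClass (n : ℚ)).sum = (s0.map fun n : ℤ => wittClass (n : ℚ)).sum +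
        (s1.map fun n : ℤ => wittClass ((p : ℚ) * n)).sum := by
  have hp0 : (p : ℚ) ≠ 0 := by exact_mod_cast hp.ne_zero
  induction s using Multiset.induction_on with
  | empty => exact ⟨0, 0, by simp, by simp, by simp⟩
  | cons n s ih =>
    obtain ⟨s0, s1, h0, h1, h⟩ := ih fun m hm => hs m (Multiset.mem_cons_of_mem hm)
    obtain ⟨t, ht, c, hc, hn⟩ := exists_smooth_mul_sq hp (hs n (Multiset.mem_cons_self n s))
    have hcQ : (c : ℚ) ≠ 0 := by exact_mod_cast hc
    have htQ : (t : ℚ) ≠ 0 := by exact_mod_cast ne_zero_of_mem_smoothInts ht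
    rcases hn with rfl | rfl
    · refine ⟨t ::ₘ s0, s1, ?_, h1, ?_⟩
      · simpa [ht] using h0
      · simp only [Multiset.map_cons, Multiset.sum_cons, h]
        push_cast
        rw [isWittFun_wittClass.sq _ _ htQ hcQ, add_assoc]
    · refine ⟨s0, t ::ₘ s1, h0, ?_, ?_⟩
      · simpa [ht] using h1
      · simp only [Multiset.map_cons, Multiset.sum_cons, h]
        push_cast
        rw [isWittFun_wittClass.sq _ _ (mul_ne_zero hp0 htQ) hcQ]
        abel

theorem exists_eq_replicate_add_replicate (s : Multiset ℤ) (hs : ∀ n ∈ s, n = 1 ∨ n = -1) :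
    ∃ r q : ℕ, s = Multiset.replicate r 1 + Multiset.replicate q (-1) := by
  induction s using Multiset.induction_on with
  | empty => exact ⟨0, 0, by simp⟩
  | cons n s ih =>
    obtain ⟨r, q, rfl⟩ := ih fun m hm => hs m (Multiset.mem_cons_of_mem hm)
    rcases hs n (Multiset.mem_cons_self _ _) with rfl | rfl
    · exact ⟨r + 1, q, by rw [Multiset.replicate_succ, Multiset.cons_add]⟩
    · exact ⟨r, q + 1, by rw [Multiset.replicate_succ, Multiset.add_cons]⟩

/-- Induction on `k` removes the largest prime. The condition over `ℚ_k` makes the second residue at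
`k` metabolic, so the terms `⟨k n⟩` may be traded for smooth ones without changing the Witt class,
and all local hypotheses pass to the new multiset. At `k = 2` only `±1` remain, and the real place
forces equal multiplicities. -/
theorem isMetabolic_rat_of_local_of_smooth {k : ℕ} (hk : 2 ≤ k) :
    ∀ s : Multiset ℤ, (∀ n ∈ s, n ∈ smoothInts k) →
      (∀ (p : ℕ) [Fact p.Prime], IsMetabolic ((s.map (Int.cast : ℤ → ℚ)).map (Rat.castHom ℚ_[p]))) →
      IsMetabolic ((s.map (Int.cast : ℤ → ℚ)).map (Rat.castHom ℝ)) →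
      IsMetabolic (s.map (Int.cast : ℤ → ℚ)) := by
  have hne : ∀ {k : ℕ} {s : Multiset ℤ}, (∀ n ∈ s, n ∈ smoothInts k) →
      ∀ a ∈ s.map (Int.cast : ℤ → ℚ), a ≠ 0 := by
    intro k s hs a ha
    obtain ⟨n, hn, rfl⟩ := Multiset.mem_map.1 ha
    exact_mod_cast ne_zero_of_mem_smoothInts (hs n hn)
  induction k, hk using Nat.le_induction with
  | base =>
    intro s hs _ hR
    obtain ⟨r, q, rfl⟩ := exists_eq_replicate_add_replicate s
      fun n hn => mem_smoothInts_two (hs n hn)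
    have h1 : ((Multiset.replicate r (1 : ℤ) + Multiset.replicate q (-1)).map
        (Int.cast : ℤ → ℚ)).map (Rat.castHom ℝ)
        = Finset.univ.val.map (Sum.elim (fun _ : Fin r => (1 : ℝ)) (-fun _ : Fin q => (1 : ℝ))) := by
      rw [map_univ_sum_elim]
      simp [Multiset.map_const']
    rw [h1, isMetabolic_map_univ] at hR
    have h2 := hR.card_eq (fun _ => one_pos) (fun _ => one_pos)
    simp only [Fintype.card_fin] at h2
    subst h2
    rw [← sum_wittClass_eq_zero_iff (hne hs)]
    simp [isWittFun_wittClass.neg (1 : ℚ) one_ne_zero]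
  | succ k hk ih =>
    intro s hs hp hR
    by_cases hkp : k.Prime
    · have : Fact k.Prime := ⟨hkp⟩
      have hk0 : (k : ℚ) ≠ 0 := by exact_mod_cast hkp.ne_zero
      obtain ⟨s0, s1, h0, h1, h⟩ := exists_residue_decomposition hkp s hs
      have hT : ∀ a ∈ s0.map (Int.cast : ℤ → ℚ) + s1.map (fun n : ℤ => (k : ℚ) * n), a ≠ 0 := by
        intro a ha
        rcases Multiset.mem_add.1 ha with ha | ha
        · exact hne h0 a ha
        · obtain ⟨n, hn, rfl⟩ := Multiset.mem_map.1 ha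
          have : (n : ℚ) ≠ 0 := by exact_mod_cast ne_zero_of_mem_smoothInts (h1 n hn)
          exact mul_ne_zero hk0 this
      have hST : ((s.map (Int.cast : ℤ → ℚ)).map wittClass).sum
          = ((s0.map (Int.cast : ℤ → ℚ) + s1.map (fun n : ℤ => (k : ℚ) * n)).map wittClass).sum := by
        rw [Multiset.map_add, Multiset.sum_add, Multiset.map_map, Multiset.map_map,
          Multiset.map_map]
        exact h
      -- the second residue is metabolic
      have hloc : IsMetabolic ((s0.map (Int.cast : ℤ → ℚ) +
          s1.map (fun n : ℤ => (k : ℚ) * n)).map (Rat.castHom ℚ_[k])) := by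
        rw [← sum_wittClass_eq_zero_iff, ← sum_wittClass_map_eq _ (hne hs) hT hST,
          sum_wittClass_eq_zero_iff]
        · exact hp k
        · intro a ha
          obtain ⟨b, hb, rfl⟩ := Multiset.mem_map.1 ha
          simpa using hne hs b hb
        · intro a ha
          obtain ⟨b, hb, rfl⟩ := Multiset.mem_map.1 ha
          simpa using hT b hb
      have hres : IsMetabolic (s1.map fun n : ℤ => (n : ZMod k)) := by
        apply IsMetabolic.residue (s := s0) fun n hn => not_dvd_of_mem_smoothInts hkp (h0 n hn)
        convert hloc using 1
        rw [Multiset.map_add, Multiset.map_map, Multiset.map_map]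
        congr 1
      obtain ⟨s', hs', h'⟩ := exists_multiset_of_mem_wittFiltration hk
        (sum_wittClass_mul_mem_wittFiltration h1 hres)
      have hU : ∀ n ∈ s0 + s', n ∈ smoothInts k := fun n hn =>
        (Multiset.mem_add.1 hn).elim (h0 n) (hs' n)
      have hSU : ((s.map (Int.cast : ℤ → ℚ)).map wittClass).sum
          = (((s0 + s').map (Int.cast : ℤ → ℚ)).map wittClass).sum := by
        rw [Multiset.map_map, Multiset.map_map, Multiset.map_add, Multiset.sum_add]
        exact h.trans (by rw [h']; rfl)
      have htrans : ∀ {L : Type} [Field L] (f : ℚ →+* L),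
          IsMetabolic ((s.map (Int.cast : ℤ → ℚ)).map f) →
          IsMetabolic (((s0 + s').map (Int.cast : ℤ → ℚ)).map f) := by
        intro L _ f hf
        rw [← sum_wittClass_eq_zero_iff, ← sum_wittClass_map_eq f (hne hs) (hne hU) hSU,
          sum_wittClass_eq_zero_iff]
        · exact hf
        · intro a ha
          obtain ⟨b, hb, rfl⟩ := Multiset.mem_map.1 ha
          exact (map_ne_zero f).2 (hne hs b hb)
        · intro a ha
          obtain ⟨b, hb, rfl⟩ := Multiset.mem_map.1 ha
          exact (map_ne_zero f).2 (hne hU b hb)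
      have hfin := ih (s0 + s') hU (fun p _ => htrans _ (hp p)) (htrans _ hR)
      rw [← sum_wittClass_eq_zero_iff (hne hs), hSU, sum_wittClass_eq_zero_iff (hne hU)]
      exact hfin
    · exact ih s (fun n hn => smoothInts_succ_le hk hkp (hs n hn)) hp hR

/-- A rational form that is metabolic over `ℝ` and every `ℚ_p` is metabolic. -/
theorem isMetabolic_rat_of_local {s : Multiset ℚ} (h0 : ∀ a ∈ s, a ≠ 0)
    (hp : ∀ (p : ℕ) [Fact p.Prime], IsMetabolic (s.map (Rat.castHom ℚ_[p])))
    (hR : IsMetabolic (s.map (Rat.castHom ℝ))) : IsMetabolic s := by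
  have hbound : ∀ s : Multiset ℤ, ∃ k : ℕ, ∀ n ∈ s, |n| < k := by
    intro s
    induction s using Multiset.induction_on with
    | empty => exact ⟨0, by simp⟩
    | cons n s ih =>
      obtain ⟨k, hk⟩ := ih
      refine ⟨max k (n.natAbs + 1), fun m hm => ?_⟩
      push_cast
      rcases Multiset.mem_cons.1 hm with rfl | hm
      · exact lt_max_of_lt_right (by omega)
      · exact lt_max_of_lt_left (hk m hm)
  -- The integer `num * den` differs from `num / den` by the square of `den`.
  set t : Multiset ℤ := s.map fun a => a.num * a.den with ht
  have htne : ∀ n ∈ t, n ≠ 0 := by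
    intro n hn
    obtain ⟨a, ha, rfl⟩ := Multiset.mem_map.1 hn
    exact mul_ne_zero (Rat.num_ne_zero.2 (h0 a ha)) (by exact_mod_cast a.den_nz)
  have htne' : ∀ a ∈ t.map (Int.cast : ℤ → ℚ), a ≠ 0 := by
    intro a ha
    obtain ⟨n, hn, rfl⟩ := Multiset.mem_map.1 ha
    exact_mod_cast htne n hn
  have hst : (s.map wittClass).sum = ((t.map (Int.cast : ℤ → ℚ)).map wittClass).sum := by
    rw [ht, Multiset.map_map, Multiset.map_map]
    congr 1
    refine Multiset.map_congr rfl fun a ha => ?_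
    have hd : (a.den : ℚ) ≠ 0 := by exact_mod_cast a.den_nz
    rw [← isWittFun_wittClass.sq a a.den (h0 a ha) hd]
    simp only [Function.comp_apply]
    congr 1
    push_cast
    rw [pow_two, ← mul_assoc, Rat.mul_den_eq_num]
  obtain ⟨k, hk⟩ := hbound t
  have htrans : ∀ {L : Type} [Field L] (f : ℚ →+* L), IsMetabolic (s.map f) →
      IsMetabolic ((t.map (Int.cast : ℤ → ℚ)).map f) := by
    intro L _ f hf
    rw [← sum_wittClass_eq_zero_iff, ← sum_wittClass_map_eq f h0 htne' hst,
      sum_wittClass_eq_zero_iff]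
    · exact hf
    · intro a ha
      obtain ⟨b, hb, rfl⟩ := Multiset.mem_map.1 ha
      exact (map_ne_zero f).2 (h0 b hb)
    · intro a ha
      obtain ⟨b, hb, rfl⟩ := Multiset.mem_map.1 ha
      exact (map_ne_zero f).2 (htne' b hb)
  rw [← sum_wittClass_eq_zero_iff h0, hst, sum_wittClass_eq_zero_iff htne']
  exact isMetabolic_rat_of_local_of_smooth (k := max k 2) (le_max_right _ _) t
    (fun n hn => mem_smoothInts (htne n hn) ((hk n hn).trans_le (by exact_mod_cast le_max_left _ _)))
    (fun p _ => htrans _ (hp p)) (htrans _ hR)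

/-! ### The local-global principle for equivalence of definite forms -/

section Equivalence

open Matrix

variable {K : Type} [Field K] {ι : Type} [Fintype ι] [DecidableEq ι]

/-- The graph of an isometry is isotropic of half the dimension. -/
theorem metabolic_of_congruent {a b : ι → K} (P : Matrix ι ι K)
    (hP : P * diagonal a * Pᵀ = diagonal b) : Metabolic (Sum.elim a (-b)) := by
  let F : (ι → K) →ₗ[K] (ι ⊕ ι → K) :=
    { toFun := fun v => Sum.elim (v ᵥ* P) v
      map_add' := fun v w => by ext (i | i) <;> simp [add_vecMul]
      map_smul' := fun c v => by ext (i | i) <;> simp [smul_vecMul] }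
  have hF : Function.Injective F := fun v w h => by
    ext i
    exact congrFun h (Sum.inr i)
  refine ⟨LinearMap.range F, ?_, ?_⟩
  · rintro _ ⟨v, rfl⟩ _ ⟨w, rfl⟩
    rw [Fintype.sum_sum_type]
    have h1 : ∑ i, a i * (v ᵥ* P) i * (w ᵥ* P) i = ∑ i, b i * v i * w i := by
      have e1 : ∀ (a v w : ι → K), ∑ i, a i * v i * w i = (v ᵥ* diagonal a) ⬝ᵥ w := by
        intro a v w
        simp only [dotProduct, vecMul_diagonal]
        exact Finset.sum_congr rfl fun i _ => by ring
      rw [e1, e1, ← hP, ← mulVec_transpose P w, dotProduct_mulVec, vecMul_vecMul, vecMul_vecMul,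
        ← Matrix.mul_assoc]
    simp only [F, LinearMap.coe_mk, AddHom.coe_mk, Sum.elim_inl, Sum.elim_inr, Pi.neg_apply,
      neg_mul, Finset.sum_neg_distrib]
    rw [h1, add_neg_cancel]
  · rw [LinearMap.finrank_range_of_inj hF]
    simp; omega

/-- For positive `a` the isotropic subspace projects isomorphically to the second summand, so it is
the graph of a linear map, and isotropy says that the map is an isometry. -/
theorem exists_congruent_of_metabolic [LinearOrder K] [IsStrictOrderedRing K] {a b : ι → K}
    (ha : ∀ i, 0 < a i) (h : Metabolic (Sum.elim a (-b))) :
    ∃ P : Matrix ι ι K, P * diagonal a * Pᵀ = diagonal b := by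
  obtain ⟨W, hW, hd⟩ := h
  have hinj := finrank_le_of_isotropic ha hW
  have hfr : Module.finrank K W = Module.finrank K (ι → K) := by
    have h1 := LinearMap.finrank_le_finrank_of_injective hinj
    rw [Module.finrank_fintype_fun_eq_card] at h1 ⊢
    rw [Fintype.card_sum] at hd
    omega
  let e : W ≃ₗ[K] (ι → K) := LinearEquiv.ofInjectiveOfFinrankEq _ hinj hfr
  have he : ∀ v : ι → K, restrictRight K ι ι (e.symm v : W) = v := fun v => e.apply_symm_apply v
  refine ⟨Matrix.of fun i j => (e.symm (Pi.single i 1) : W).1 (Sum.inl j), ?_⟩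
  ext i j
  have h1 := hW _ (e.symm (Pi.single i 1)).2 _ (e.symm (Pi.single j 1)).2
  rw [Fintype.sum_sum_type] at h1
  have h2 : ∀ i k, (e.symm (Pi.single i 1) : W).1 (Sum.inr k) = (Pi.single i 1 : ι → K) k :=
    fun i k => congrFun (he (Pi.single i 1)) k
  simp only [Sum.elim_inl, Sum.elim_inr, h2, Pi.neg_apply, neg_mul, Finset.sum_neg_distrib] at h1
  rw [Matrix.mul_apply]
  simp only [mul_diagonal, transpose_apply, Matrix.of_apply]
  rw [diagonal_apply]
  have h3 : ∑ k, b k * (Pi.single i 1 : ι → K) k * (Pi.single j 1 : ι → K) k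
      = if i = j then b i else 0 := by
    rw [Finset.sum_eq_single i]
    · by_cases hij : i = j
      · subst hij; simp
      · simp [hij]
    · intro k _ hk
      simp [Pi.single_eq_of_ne hk]
    · simp
  rw [← h3, ← sub_eq_zero, ← h1, sub_eq_add_neg]
  congr 1
  exact Finset.sum_congr rfl fun k _ => by ring

end Equivalence

end

section


/-! ### Positive definite rational matrices and their genera -/

open Matrix

theorem act_map {R S : Type} [CommRing R] [CommRing S] (f : R →+* S) (g : G R) (x : M4 R) :
    act (Matrix.GeneralLinearGroup.map f g) (x.map f) = (act g x).map f := by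
  have h : ((Matrix.GeneralLinearGroup.map f g : G S) : M4 S) = (g : M4 R).map f := rfl
  rw [act, act, h, Matrix.map_mul, Matrix.map_mul, transpose_map]

theorem toAdeleMatrix_map_real (x : M4 ℚ) :
    (toAdeleMatrix x).map adeleToReal = x.map (Rat.castHom ℝ) := rfl

theorem toAdeleMatrix_map_padic (x : M4 ℚ) (p : Nat.Primes) :
    (toAdeleMatrix x).map (adeleToPadic p) = x.map (Rat.castHom ℚ_[(p : ℕ)]) := rfl

theorem act_toAdeleMatrix (γ : G ℚ) (x : M4 ℚ) :
    act (ratToG γ) (toAdeleMatrix x) = toAdeleMatrix (act γ x) := act_map _ _ _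

theorem toAdeleMatrix_injective : Function.Injective toAdeleMatrix := by
  intro x y h
  ext i j
  have h1 := congrArg Prod.fst (congrFun (congrFun h i) j)
  exact Rat.cast_injective (α := ℝ) h1

theorem act_real_of_act_adele {g : G Adele} {x y : M4 ℚ}
    (h : act g (toAdeleMatrix x) = toAdeleMatrix y) :
    act (atReal g) (x.map (Rat.castHom ℝ)) = y.map (Rat.castHom ℝ) := by
  rw [← toAdeleMatrix_map_real, ← toAdeleMatrix_map_real, ← h, act_map]

theorem act_padic_of_act_adele {g : G Adele} {x y : M4 ℚ}
    (h : act g (toAdeleMatrix x) = toAdeleMatrix y) (p : Nat.Primes) :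
    act (atPrime p g) (x.map (Rat.castHom ℚ_[(p : ℕ)])) = y.map (Rat.castHom ℚ_[(p : ℕ)]) := by
  rw [← toAdeleMatrix_map_padic, ← toAdeleMatrix_map_padic, ← h, act_map]

theorem vecMul_injective_of_unit {K : Type} [CommRing K] (g : G K) :
    Function.Injective fun v : Fin 4 → K => v ᵥ* (g : M4 K) := by
  apply Function.LeftInverse.injective (g := fun v => v ᵥ* ((g⁻¹ : G K) : M4 K))
  intro v
  simp only [vecMul_vecMul, Units.mul_inv, vecMul_one]

theorem posDef_act {g : G ℝ} {x : M4 ℝ} (hx : x.PosDef) : (act g x).PosDef := by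
  have := hx.mul_mul_conjTranspose_same (vecMul_injective_of_unit g)
  rwa [conjTranspose_eq_transpose_of_trivial] at this

theorem isSymm_of_posDef {x : M4 ℚ} (hx : (x.map (Rat.castHom ℝ)).PosDef) : x.IsSymm := by
  have h := hx.isHermitian
  ext i j
  have h1 := congrFun (congrFun h i) j
  simpa using h1

theorem dotProduct_mulVec_pos_rat {x : M4 ℚ} (hx : (x.map (Rat.castHom ℝ)).PosDef)
    {v : Fin 4 → ℚ} (hv : v ≠ 0) : 0 < v ⬝ᵥ (x *ᵥ v) := by
  have hv' : (fun i => (v i : ℝ)) ≠ 0 := by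
    intro h
    apply hv
    ext i
    have := congrFun h i
    simpa using this
  have h := hx.dotProduct_mulVec_pos hv'
  have e : star (fun i => (v i : ℝ)) ⬝ᵥ (x.map (Rat.castHom ℝ) *ᵥ fun i => (v i : ℝ))
      = ((v ⬝ᵥ (x *ᵥ v) : ℚ) : ℝ) := by
    simp [dotProduct, mulVec]
  rw [e] at h
  exact_mod_cast h

theorem det_act {R : Type} [CommRing R] (g : G R) (x : M4 R) :
    (act g x).det = (g : M4 R).det ^ 2 * x.det := by
  rw [act, det_mul, det_mul, det_transpose]; ring

theorem norm_det_le_one {p : ℕ} [Fact p.Prime] {ι : Type} [Fintype ι] [DecidableEq ι]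
    {X : Matrix ι ι ℚ_[p]} (h : ∀ i j, ‖X i j‖ ≤ 1) :
    ‖X.det‖ ≤ 1 := by
  rw [det_apply]
  refine norm_sum_padic_le _ _ zero_le_one fun σ _ => ?_
  rw [Units.smul_def, zsmul_eq_mul, norm_mul]
  refine mul_le_one₀ (Padic.norm_int_le_one _) (norm_nonneg _) ?_
  rw [norm_prod]
  exact Finset.prod_le_one (fun _ _ => norm_nonneg _) fun i _ => h _ _

theorem norm_det_eq_one {p : ℕ} [Fact p.Prime] {X : G ℚ_[p]} (h : X ∈ (padicIntToG p).range) :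
    ‖(X : M4 ℚ_[p]).det‖ = 1 := by
  rw [mem_range_padicIntToG] at h
  have h1 := norm_det_le_one h.1
  have h2 := norm_det_le_one h.2
  have h3 : ‖(X : M4 ℚ_[p]).det‖ * ‖((X⁻¹ : G ℚ_[p]) : M4 ℚ_[p]).det‖ = 1 := by
    rw [← norm_mul, ← det_mul, Units.mul_inv, det_one, norm_one]
  nlinarith [norm_nonneg (X : M4 ℚ_[p]).det, norm_nonneg ((X⁻¹ : G ℚ_[p]) : M4 ℚ_[p]).det]

theorem det_rat_pos {x : M4 ℚ} (hx : (x.map (Rat.castHom ℝ)).PosDef) : 0 < x.det := by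
  have h := hx.det_pos
  have : (x.map (Rat.castHom ℝ)).det = ((x.det : ℚ) : ℝ) :=
    ((Rat.castHom ℝ).map_det x).symm
  rw [this] at h
  exact_mod_cast h

/-- Matrices in the same genus have the same determinant. -/
theorem det_eq_of_act {g : G Adele} (hg : g ∈ GInfKf) {x y : M4 ℚ}
    (hx : (x.map (Rat.castHom ℝ)).PosDef) (hy : (y.map (Rat.castHom ℝ)).PosDef)
    (h : act g (toAdeleMatrix x) = toAdeleMatrix y) : y.det = x.det := by
  have hx0 := det_rat_pos hx
  have hy0 := det_rat_pos hy
  have key : ∀ p : Nat.Primes, ‖(y.det : ℚ_[(p : ℕ)])‖ = ‖(x.det : ℚ_[(p : ℕ)])‖ := by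
    intro p
    have h1 := congrArg det (act_padic_of_act_adele h p)
    have e : ∀ z : M4 ℚ, (z.map (Rat.castHom ℚ_[(p : ℕ)])).det = (z.det : ℚ_[(p : ℕ)]) :=
      fun z => ((Rat.castHom ℚ_[(p : ℕ)]).map_det z).symm
    rw [det_act, e, e] at h1
    rw [← h1, norm_mul, norm_pow, norm_det_eq_one (mem_GInfKf.1 hg p), one_pow, one_mul]
  -- The ratio of the determinants and its inverse are integral at every prime, so the ratio is a
  -- positive unit of `ℤ`.
  have hint : ∀ {a b : ℚ}, 0 < b → (∀ p : Nat.Primes, ‖(a : ℚ_[(p : ℕ)])‖ = ‖(b : ℚ_[(p : ℕ)])‖) →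
      ∃ m : ℤ, a / b = m := by
    intro a b hb hab
    refine exists_int_of_padicNorm_le_one fun p => ?_
    have hb' : (b : ℚ_[(p : ℕ)]) ≠ 0 := by exact_mod_cast hb.ne'
    rw [Rat.cast_div, norm_div, hab p, div_self (norm_ne_zero_iff.2 hb')]
  obtain ⟨m, hm⟩ := hint hx0 key
  obtain ⟨n, hn⟩ := hint hy0 fun p => (key p).symm
  have hmpos : 0 < m := by
    have : (0 : ℚ) < m := by rw [← hm]; positivity
    exact_mod_cast this
  have hmn : m * n = 1 := by
    have : (m : ℚ) * n = 1 := by rw [← hm, ← hn]; field_simp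
    exact_mod_cast this
  have hm1 : m = 1 := by
    rcases Int.eq_one_or_neg_one_of_mul_eq_one hmn with h | h <;> omega
  rw [hm1, Int.cast_one, div_eq_one_iff_eq hx0.ne'] at hm
  exact hm

/-- A bound on denominators is preserved in a genus. -/
theorem integral_of_act {g : G Adele} (hg : g ∈ GInfKf) {x y : M4 ℚ} {M : ℚ}
    (hx : ∀ i j, ∃ m : ℤ, M * x i j = m) (h : act g (toAdeleMatrix x) = toAdeleMatrix y)
    (i j : Fin 4) : ∃ m : ℤ, M * y i j = m := by
  refine exists_int_of_padicNorm_le_one fun p => ?_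
  have h1 := congrFun (congrFun (act_padic_of_act_adele h p) i) j
  rw [act, Matrix.mul_apply] at h1
  have hk := ((mem_range_padicIntToG _).1 (mem_GInfKf.1 hg p)).1
  have h2 : ((M * y i j : ℚ) : ℚ_[(p : ℕ)]) = ∑ b, ∑ a, (atPrime p g : M4 ℚ_[(p : ℕ)]) i a *
      ((M * x a b : ℚ) : ℚ_[(p : ℕ)]) * (atPrime p g : M4 ℚ_[(p : ℕ)]) j b := by
    rw [Rat.cast_mul]
    change (M : ℚ_[(p : ℕ)]) * (y.map (Rat.castHom ℚ_[(p : ℕ)])) i j = _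
    rw [← h1, Finset.mul_sum]
    refine Finset.sum_congr rfl fun b _ => ?_
    rw [Matrix.mul_apply, Finset.sum_mul, Finset.mul_sum]
    refine Finset.sum_congr rfl fun a _ => ?_
    rw [transpose_apply, Matrix.map_apply, Rat.cast_mul, Rat.coe_castHom]
    ring
  rw [h2]
  refine norm_sum_padic_le _ _ zero_le_one fun b _ => norm_sum_padic_le _ _ zero_le_one fun a _ => ?_
  rw [norm_mul, norm_mul]
  obtain ⟨m, hm⟩ := hx a b
  refine mul_le_one₀ (mul_le_one₀ (hk i a) (norm_nonneg _) ?_) (norm_nonneg _) (hk j b)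
  rw [hm]
  exact_mod_cast norm_intCast_padic_le_one p m

/-- A positive definite rational matrix is diagonalizable by congruence over `ℚ`. -/
theorem exists_act_eq_diagonal {x : M4 ℚ} (hx : (x.map (Rat.castHom ℝ)).PosDef) :
    ∃ (C : G ℚ) (a : Fin 4 → ℚ), (∀ i, 0 < a i) ∧ act C x = diagonal a := by
  have hsymm := isSymm_of_posDef hx
  have : Invertible (2 : ℚ) := invertibleOfNonzero two_ne_zero
  have hB : LinearMap.IsSymm (Matrix.toBilin' x) := by
    refine ⟨fun v w => ?_⟩
    rw [RingHom.id_apply, Matrix.toBilin'_apply', Matrix.toBilin'_apply', dotProduct_mulVec,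
      ← mulVec_transpose, hsymm.eq, dotProduct_comm]
  obtain ⟨b', hb'⟩ := LinearMap.BilinForm.exists_orthogonal_basis hB
  let e : Fin (Module.finrank ℚ (Fin 4 → ℚ)) ≃ Fin 4 := finCongr (by simp)
  let b : Module.Basis (Fin 4) ℚ (Fin 4 → ℚ) := b'.reindex e
  have hb : ∀ i j, i ≠ j → b i ⬝ᵥ (x *ᵥ b j) = 0 := by
    intro i j hij
    have := hb' (i := e.symm i) (j := e.symm j) (fun h => hij (e.symm.injective h))
    rw [Function.onFun_apply] at this
    change Matrix.toBilin' x (b' (e.symm i)) (b' (e.symm j)) = 0 at this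
    rw [Matrix.toBilin'_apply'] at this
    simpa [b] using this
  let C : M4 ℚ := Matrix.of fun i j => b i j
  have hC : C.det ≠ 0 := by
    have h1 : C = ((Pi.basisFun ℚ (Fin 4)).toMatrix b)ᵀ := by
      ext i j
      simp [C, Module.Basis.toMatrix_apply]
    rw [h1, det_transpose, ← Module.Basis.det_apply]
    exact ((Pi.basisFun ℚ (Fin 4)).isUnit_det b).ne_zero
  refine ⟨Matrix.GeneralLinearGroup.mkOfDetNeZero C hC, fun i => b i ⬝ᵥ (x *ᵥ b i),
    fun i => dotProduct_mulVec_pos_rat hx (b.ne_zero i), ?_⟩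
  have hentry : ∀ i j, act (Matrix.GeneralLinearGroup.mkOfDetNeZero C hC) x i j
      = b i ⬝ᵥ (x *ᵥ b j) := by
    intro i j
    change (C * x * Cᵀ) i j = _
    rw [Matrix.mul_assoc]
    rfl
  ext i j
  rw [hentry, diagonal_apply]
  split_ifs with hij
  · rw [hij]
  · exact hb i j hij

theorem exists_congruent_of_act_diagonal {K : Type} [Field K] (f : ℚ →+* K) {x y : M4 ℚ}
    {C D : G ℚ} {a b : Fin 4 → ℚ} (hC : act C x = diagonal a) (hD : act D y = diagonal b) {k : G K}
    (hk : act k (x.map f) = y.map f) :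
    IsMetabolic ((Finset.univ.val.map (Sum.elim a (-b))).map f) := by
  have h1 : act (Matrix.GeneralLinearGroup.map f D * k * (Matrix.GeneralLinearGroup.map f C)⁻¹)
      (diagonal fun i => f (a i)) = diagonal fun i => f (b i) := by
    have e : ∀ c : Fin 4 → ℚ, (diagonal fun i => f (c i)) = (diagonal c).map f := fun c =>
      (diagonal_map f.map_zero).symm
    rw [e, e, ← hC, ← hD, ← act_map, ← act_map, ← act_mul, inv_mul_cancel_right, act_mul, hk]
  have h2 := metabolic_of_congruent _ h1
  rw [Multiset.map_map, isMetabolic_map_univ]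
  convert h2 using 1
  ext (i | i) <;> simp

/-- The weak Hasse principle: positive definite matrices that are equivalent over the adeles are
equivalent over `ℚ`. -/
theorem exists_rat_act_eq {x y : M4 ℚ} (hx : (x.map (Rat.castHom ℝ)).PosDef)
    (hy : (y.map (Rat.castHom ℝ)).PosDef) {g : G Adele}
    (h : act g (toAdeleMatrix x) = toAdeleMatrix y) : ∃ γ : G ℚ, act γ x = y := by
  obtain ⟨C, a, ha, hC⟩ := exists_act_eq_diagonal hx
  obtain ⟨D, b, hb, hD⟩ := exists_act_eq_diagonal hy
  -- Equivalence at each place makes `a ⊥ -b` metabolic there; the local-global principle makes it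
  -- metabolic over `ℚ`, and definiteness of `a` turns this into a congruence.
  have hmet : IsMetabolic (Finset.univ.val.map (Sum.elim a (-b))) := by
    refine isMetabolic_rat_of_local ?_ (fun p hp => ?_) ?_
    · intro c hc
      obtain ⟨i | i, -, rfl⟩ := Multiset.mem_map.1 hc
      · simpa using (ha i).ne'
      · simpa using (hb i).ne'
    · exact exists_congruent_of_act_diagonal _ hC hD (act_padic_of_act_adele h ⟨p, hp.out⟩)
    · exact exists_congruent_of_act_diagonal _ hC hD (act_real_of_act_adele h)
  obtain ⟨P, hP⟩ := exists_congruent_of_metabolic ha (isMetabolic_map_univ.1 hmet)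
  have hdet : P.det ≠ 0 := by
    intro h0
    have := congrArg det hP
    rw [det_mul, det_mul, h0, zero_mul, zero_mul, det_diagonal] at this
    exact (Finset.prod_pos fun i _ => hb i).ne this
  refine ⟨D⁻¹ * Matrix.GeneralLinearGroup.mkOfDetNeZero P hdet * C, ?_⟩
  rw [act_mul, act_mul, hC]
  have : act (Matrix.GeneralLinearGroup.mkOfDetNeZero P hdet) (diagonal a) = diagonal b := hP
  rw [this, ← hD, ← act_mul, inv_mul_cancel, act_one]

end

section


/-! ### Hermite reduction and finiteness of the genus -/

open Matrix

theorem isUnit_det_of_basis {R : Type} [CommRing R] {n : ℕ} (b : Module.Basis (Fin n) R (Fin n → R)) :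
    IsUnit (Matrix.of fun i j => b i j : Matrix (Fin n) (Fin n) R).det := by
  have h1 : (Matrix.of fun i j => b i j : Matrix (Fin n) (Fin n) R)
      = ((Pi.basisFun R (Fin n)).toMatrix b)ᵀ := by
    ext i j
    simp [Module.Basis.toMatrix_apply]
  rw [h1, det_transpose, ← Module.Basis.det_apply]
  exact (Pi.basisFun R (Fin n)).isUnit_det b

/-- Every nonzero integral vector is a multiple of the first row of a unimodular matrix. -/
theorem exists_unimodular_row {n : ℕ} {u : Fin (n + 1) → ℤ} (hu : u ≠ 0) :
    ∃ g : Matrix (Fin (n + 1)) (Fin (n + 1)) ℤ, IsUnit g.det ∧ ∃ c : ℤ, c ≠ 0 ∧ u = c • g 0 := by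
  -- The Smith normal form of the line through `u` gives a basis with one member proportional to
  -- `u`; a swap puts that member into the first row.
  obtain ⟨k, snf⟩ := Submodule.smithNormalForm (Pi.basisFun ℤ (Fin (n + 1)))
    (Submodule.span ℤ {u})
  have hk1 : k ≤ 1 := by
    have h1 := finrank_span_le_card (R := ℤ) ({u} : Set (Fin (n + 1) → ℤ))
    rw [Module.finrank_eq_card_basis snf.bN] at h1
    simpa using h1
  have hrepr := snf.bN.sum_repr ⟨u, Submodule.mem_span_singleton_self u⟩
  have hk0 : k ≠ 0 := by
    rintro rfl
    apply hu
    have := congrArg Subtype.val hrepr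
    simpa using this.symm
  obtain rfl : k = 1 := by omega
  rw [Fin.sum_univ_one] at hrepr
  have h2 := congrArg Subtype.val hrepr
  rw [Submodule.coe_smul, snf.snf 0, smul_smul] at h2
  refine ⟨_, isUnit_det_of_basis (snf.bM.reindex (Equiv.swap (snf.f 0) 0)),
    snf.bN.repr ⟨u, Submodule.mem_span_singleton_self u⟩ 0 * snf.a 0, ?_, ?_⟩
  · intro h0
    rw [h0, zero_smul] at h2
    exact hu h2.symm
  · ext j
    have := congrFun h2 j
    simp only [Pi.smul_apply, Matrix.of_apply, Module.Basis.reindex_apply, Equiv.symm_swap,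
      Equiv.swap_apply_right]
    exact this.symm

/-- The value of the quadratic form with matrix `Y` at an integral vector. -/
def intForm {n : ℕ} (Y : Matrix (Fin n) (Fin n) ℝ) (v : Fin n → ℤ) : ℝ :=
  (fun i => (v i : ℝ)) ⬝ᵥ (Y *ᵥ fun i => (v i : ℝ))

theorem intForm_conj {n : ℕ} (Y : Matrix (Fin n) (Fin n) ℝ) (g : Matrix (Fin n) (Fin n) ℤ)
    (v : Fin n → ℤ) :
    intForm (g.map (Int.cast : ℤ → ℝ) * Y * (g.map (Int.cast : ℤ → ℝ))ᵀ) v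
      = intForm Y (v ᵥ* g) := by
  have h : (fun i => (((v ᵥ* g) i : ℤ) : ℝ)) = (fun i => (v i : ℝ)) ᵥ* g.map (Int.cast : ℤ → ℝ) := by
    ext i
    simp [vecMul, dotProduct]
  rw [intForm, intForm, h, ← mulVec_mulVec, ← mulVec_mulVec, mulVec_transpose, dotProduct_mulVec]

/-- The Schur complement of the upper left entry. -/
def schurComplement {n : ℕ} (Y : Matrix (Fin (n + 1)) (Fin (n + 1)) ℝ) : Matrix (Fin n) (Fin n) ℝ :=
  Matrix.of fun i j => Y i.succ j.succ - Y 0 i.succ * Y 0 j.succ / Y 0 0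

/-- Completion of the square in the first variable. -/
theorem bilin_eq_schurComplement {n : ℕ} {Y : Matrix (Fin (n + 1)) (Fin (n + 1)) ℝ}
    (hY : Y.IsSymm) (h0 : Y 0 0 ≠ 0) (s s' : ℝ) (w w' : Fin n → ℝ) :
    (Fin.cons s w : Fin (n + 1) → ℝ) ⬝ᵥ (Y *ᵥ (Fin.cons s' w' : Fin (n + 1) → ℝ))
      = w ⬝ᵥ (schurComplement Y *ᵥ w') + (Y 0 0 * s + ∑ j, Y 0 j.succ * w j) *
        (Y 0 0 * s' + ∑ j, Y 0 j.succ * w' j) / Y 0 0 := by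
  have hs : ∀ i : Fin n, Y i.succ 0 = Y 0 i.succ := fun i => hY.apply _ _
  have h1 : (Fin.cons s w : Fin (n + 1) → ℝ) ⬝ᵥ (Y *ᵥ (Fin.cons s' w' : Fin (n + 1) → ℝ))
      = s * (Y 0 0 * s' + ∑ j, Y 0 j.succ * w' j) + (∑ j, Y 0 j.succ * w j) * s'
        + ∑ i, ∑ j, w i * Y i.succ j.succ * w' j := by
    have e : ∑ i, w i * (Y 0 i.succ * s' + ∑ j, Y i.succ j.succ * w' j)
        = (∑ j, Y 0 j.succ * w j) * s' + ∑ i, ∑ j, w i * Y i.succ j.succ * w' j := by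
      rw [Finset.sum_mul, ← Finset.sum_add_distrib]
      refine Finset.sum_congr rfl fun i _ => ?_
      rw [mul_add, Finset.mul_sum]
      congr 1
      · ring
      · exact Finset.sum_congr rfl fun j _ => by ring
    simp only [dotProduct, mulVec, Fin.sum_univ_succ, Fin.cons_zero, Fin.cons_succ, hs]
    rw [e, add_assoc]
  have h2 : w ⬝ᵥ (schurComplement Y *ᵥ w')
      = ∑ i, ∑ j, w i * Y i.succ j.succ * w' j
        - (∑ j, Y 0 j.succ * w j) * (∑ j, Y 0 j.succ * w' j) / Y 0 0 := by
    rw [Finset.sum_mul_sum, Finset.sum_div, ← Finset.sum_sub_distrib, dotProduct]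
    refine Finset.sum_congr rfl fun i _ => ?_
    rw [Finset.sum_div, ← Finset.sum_sub_distrib, mulVec, dotProduct, Finset.mul_sum]
    refine Finset.sum_congr rfl fun j _ => ?_
    simp only [schurComplement, Matrix.of_apply]
    ring
  rw [h1, h2]
  field_simp
  ring

theorem det_eq_mul_det_schurComplement {n : ℕ} {Y : Matrix (Fin (n + 1)) (Fin (n + 1)) ℝ}
    (hY : Y.IsSymm) (h0 : Y 0 0 ≠ 0) : Y.det = Y 0 0 * (schurComplement Y).det := by
  let Z : Matrix (Fin (n + 1)) (Fin (n + 1)) ℝ := Matrix.of fun i j =>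
    Fin.cases (Y 0 j) (fun i => Y i.succ j - Y 0 i.succ / Y 0 0 * Y 0 j) i
  have h1 : Y.det = Z.det := by
    refine det_eq_of_forall_row_eq_smul_add_const
      (fun i => Fin.cases 0 (fun i => Y 0 i.succ / Y 0 0) i) 0 (by simp) fun i j => ?_
    refine Fin.cases ?_ (fun i => ?_) i <;> simp [Z]
  rw [h1, det_succ_column_zero, Fin.sum_univ_succ]
  have h2 : ∀ i : Fin n, Z i.succ 0 = 0 := fun i => by
    simp only [Z, Matrix.of_apply, Fin.cases_succ]
    rw [div_mul_cancel₀ _ h0, hY.apply, sub_self]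
  simp only [h2, mul_zero, zero_mul, Finset.sum_const_zero, add_zero, Fin.val_zero, pow_zero,
    one_mul]
  congr 2
  ext i j
  simp [Z, schurComplement]
  ring

/-- If the first diagonal entry `a` is within a factor `4 / 3` of every nonzero value, the Schur
complement has values at least `a / 2`. Its determinant is bounded as well, so the induction
hypothesis reduces it; its bounded diagonal then bounds `a`, and the lifted basis vectors can be
adjusted to bound the first row. -/
theorem exists_bound_of_reduced {n : ℕ}
    (ih : ∀ m D : ℝ, 0 < m → ∃ B : ℝ, ∀ Y : Matrix (Fin n) (Fin n) ℝ, Y.PosDef →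
      (∀ v : Fin n → ℤ, v ≠ 0 → m ≤ intForm Y v) → Y.det ≤ D →
      ∃ g : Matrix (Fin n) (Fin n) ℤ, IsUnit g.det ∧
        ∀ i j, |(g.map (Int.cast : ℤ → ℝ) * Y * (g.map (Int.cast : ℤ → ℝ))ᵀ) i j| ≤ B)
    {m D : ℝ} (hm : 0 < m) :
    ∃ B : ℝ, ∀ Y : Matrix (Fin (n + 1)) (Fin (n + 1)) ℝ, Y.PosDef →
      (∀ v : Fin (n + 1) → ℤ, v ≠ 0 → m ≤ intForm Y v) →
      (∀ v : Fin (n + 1) → ℤ, v ≠ 0 → 3 / 4 * Y 0 0 ≤ intForm Y v) → Y.det ≤ D →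
      ∃ g : Matrix (Fin (n + 1)) (Fin (n + 1)) ℤ, IsUnit g.det ∧
        ∀ i j, |(g.map (Int.cast : ℤ → ℝ) * Y * (g.map (Int.cast : ℤ → ℝ))ᵀ) i j| ≤ B := by
  obtain ⟨B', hB'⟩ := ih (m / 2) (D / m) (by positivity)
  -- The term `max (2 * B') D` bounds the first entry, with `D` serving the case `n = 0`; `|B'|`
  -- bounds the contribution of the Schur complement.
  refine ⟨|B'| + max (2 * B') D, fun Y hY hYm hred hdet => ?_⟩
  have hsymm : Y.IsSymm := by
    have := hY.isHermitian
    rwa [IsHermitian, conjTranspose_eq_transpose_of_trivial] at this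
  set a := Y 0 0 with ha
  have ha0 : 0 < a := hY.diag_pos
  have hform0 : intForm Y (Pi.single 0 1) = a := by
    have : (fun i => (((Pi.single 0 1 : Fin (n + 1) → ℤ) i : ℤ) : ℝ)) = Pi.single 0 1 := by
      ext i
      by_cases h : i = 0
      · subst h; simp
      · simp [h]
    rw [intForm, this]
    simp [ha]
  have ham : m ≤ a := by
    rw [← hform0]
    exact hYm _ (by simp)
  -- positivity of the Schur complement
  have hval : ∀ w : Fin n → ℝ, w ⬝ᵥ (schurComplement Y *ᵥ w)
      = (Fin.cons (-(∑ j, Y 0 j.succ * w j) / a) w : Fin (n + 1) → ℝ) ⬝ᵥ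
        (Y *ᵥ (Fin.cons (-(∑ j, Y 0 j.succ * w j) / a) w : Fin (n + 1) → ℝ)) := by
    intro w
    rw [bilin_eq_schurComplement hsymm ha0.ne', ← ha, mul_div_cancel₀ _ ha0.ne', neg_add_cancel]
    simp
  have hpos : (schurComplement Y).PosDef := by
    refine PosDef.of_dotProduct_mulVec_pos ?_ fun w hw => ?_
    · ext i j
      simp only [conjTranspose_apply, schurComplement, Matrix.of_apply, star_trivial]
      rw [hsymm.apply]
      ring
    · rw [star_trivial, hval]
      have := hY.dotProduct_mulVec_pos
        (x := (Fin.cons (-(∑ j, Y 0 j.succ * w j) / a) w : Fin (n + 1) → ℝ)) (by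
          intro h
          apply hw
          ext i
          have := congrFun h i.succ
          simpa using this)
      rwa [star_trivial] at this
  -- Rounding the first coordinate makes the completed square at most `a / 4`, which leaves `3 a / 4
  -- - a / 4` for the Schur complement.
  have hmin : ∀ w : Fin n → ℤ, w ≠ 0 → a / 2 ≤ intForm (schurComplement Y) w := by
    intro w hw
    set x : ℝ := ∑ j, Y 0 j.succ * (w j : ℝ) with hx
    have h1 := hred (Fin.cons (round (-x / a)) w) (by
      intro h
      apply hw
      ext i
      have := congrFun h i.succ
      simpa using this)
    have h2 : (fun i => (((Fin.cons (round (-x / a)) w : Fin (n + 1) → ℤ) i : ℤ) : ℝ))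
        = Fin.cons ((round (-x / a) : ℤ) : ℝ) (fun i => (w i : ℝ)) := by
      ext i
      refine Fin.cases ?_ (fun i => ?_) i <;> simp
    rw [intForm, h2, bilin_eq_schurComplement hsymm ha0.ne', ← ha, ← hx] at h1
    have h3 := abs_sub_round (-x / a)
    have h4 : |a * (round (-x / a) : ℤ) + x| ≤ a / 2 := by
      have : a * (round (-x / a) : ℤ) + x = -(a * (-x / a - (round (-x / a) : ℤ))) := by
        field_simp; ring
      rw [this, abs_neg, abs_mul, abs_of_pos ha0]
      nlinarith
    have h5 : (a * (round (-x / a) : ℤ) + x) * (a * (round (-x / a) : ℤ) + x) / a ≤ a / 4 := by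
      rw [div_le_iff₀ ha0, ← abs_mul_abs_self]
      nlinarith [abs_nonneg (a * (round (-x / a) : ℤ) + x)]
    change _ ≤ (fun i => (w i : ℝ)) ⬝ᵥ (schurComplement Y *ᵥ fun i => (w i : ℝ))
    linarith
  have hdet' : (schurComplement Y).det ≤ D / m := by
    have h1 := det_eq_mul_det_schurComplement hsymm ha0.ne'
    rw [le_div_iff₀ hm]
    have h2 := hpos.det_pos
    rw [← ha] at h1
    nlinarith
  obtain ⟨g, hg, hgB⟩ := hB' (schurComplement Y) hpos
    (fun v hv => (by linarith : m / 2 ≤ a / 2).trans (hmin v hv)) hdet'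
  -- bound for the first entry
  have haB : a ≤ max (2 * B') D := by
    rcases Nat.eq_zero_or_pos n with hn | hn
    · subst hn
      refine le_max_of_le_right ?_
      rwa [det_fin_one] at hdet
    · refine le_max_of_le_left ?_
      let i0 : Fin n := ⟨0, hn⟩
      have hrow : g i0 ≠ 0 := by
        intro h
        have : g.det = 0 := det_eq_zero_of_row_eq_zero i0 fun j => congrFun h j
        rw [this] at hg
        exact not_isUnit_zero hg
      have h1 := hmin _ hrow
      have h2 := (le_abs_self _).trans (hgB i0 i0)
      have h3 : (g.map (Int.cast : ℤ → ℝ) * schurComplement Y * (g.map (Int.cast : ℤ → ℝ))ᵀ) i0 i0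
          = intForm (schurComplement Y) (g i0) := by
        rw [Matrix.mul_assoc]
        rfl
      rw [h3] at h2
      linarith
  -- The first coordinates of the lifted vectors are rounded so that each product with the first
  -- basis vector is at most `a / 2` in absolute value.
  let t : Fin n → ℤ := fun i => round (-(∑ j, Y 0 j.succ * (g i j : ℝ)) / a)
  let G' : Matrix (Fin (n + 1)) (Fin (n + 1)) ℤ := Matrix.of
    (Fin.cons (Fin.cons 1 0) fun i => Fin.cons (t i) (g i))
  have hrow0 : (fun j => (G' 0 j : ℝ)) = (Fin.cons 1 0 : Fin (n + 1) → ℝ) := by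
    ext j
    refine Fin.cases ?_ (fun j => ?_) j <;> simp [G']
  have hrow1 : ∀ i : Fin n, (fun j => (G' i.succ j : ℝ))
      = (Fin.cons (t i : ℝ) (fun j => (g i j : ℝ)) : Fin (n + 1) → ℝ) := by
    intro i
    ext j
    refine Fin.cases ?_ (fun j => ?_) j <;> simp [G']
  have hentry : ∀ i j, (G'.map (Int.cast : ℤ → ℝ) * Y * (G'.map (Int.cast : ℤ → ℝ))ᵀ) i j
      = (fun k => (G' i k : ℝ)) ⬝ᵥ (Y *ᵥ fun k => (G' j k : ℝ)) := by
    intro i j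
    rw [Matrix.mul_assoc]
    rfl
  have hc : ∀ i, |a * t i + ∑ j, Y 0 j.succ * (g i j : ℝ)| ≤ a / 2 := by
    intro i
    set x : ℝ := ∑ j, Y 0 j.succ * (g i j : ℝ) with hx
    have h3 := abs_sub_round (-x / a)
    have : a * t i + x = -(a * (-x / a - (round (-x / a) : ℤ))) := by
      simp only [t, ← hx]
      field_simp; ring
    rw [this, abs_neg, abs_mul, abs_of_pos ha0]
    nlinarith
  have hB0 := le_abs_self B'
  refine ⟨G', ?_, fun i j => ?_⟩
  · have : G'.det = g.det := by
      rw [det_succ_row_zero, Fin.sum_univ_succ]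
      simp only [G', Matrix.of_apply, Fin.cons_zero, Fin.cons_succ, Pi.zero_apply, mul_zero,
        zero_mul, Finset.sum_const_zero, add_zero, Fin.val_zero, pow_zero, one_mul]
      congr 1
    rw [this]
    exact hg
  · rw [hentry]
    refine Fin.cases ?_ (fun i => ?_) i <;> refine Fin.cases ?_ (fun j => ?_) j
    · rw [hrow0, bilin_eq_schurComplement hsymm ha0.ne']
      simp only [zero_dotProduct, Pi.zero_apply, mul_zero, Finset.sum_const_zero, add_zero,
        mul_one, zero_add, ← ha]
      rw [mul_div_assoc, div_self ha0.ne', mul_one, abs_of_pos ha0]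
      linarith [abs_nonneg B']
    · rw [hrow0, hrow1, bilin_eq_schurComplement hsymm ha0.ne']
      simp only [zero_dotProduct, Pi.zero_apply, mul_zero, Finset.sum_const_zero, add_zero,
        mul_one, zero_add, ← ha]
      rw [mul_comm, mul_div_assoc, div_self ha0.ne', mul_one]
      linarith [abs_nonneg B', hc j]
    · rw [hrow0, hrow1, bilin_eq_schurComplement hsymm ha0.ne']
      simp only [mulVec_zero, dotProduct_zero, Pi.zero_apply, mul_zero, Finset.sum_const_zero,
        add_zero, mul_one, zero_add, ← ha]
      rw [mul_div_assoc, div_self ha0.ne', mul_one]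
      linarith [abs_nonneg B', hc i]
    · rw [hrow1, hrow1, bilin_eq_schurComplement hsymm ha0.ne', ← ha]
      have h1 := hgB i j
      have h2 : (g.map (Int.cast : ℤ → ℝ) * schurComplement Y * (g.map (Int.cast : ℤ → ℝ))ᵀ) i j
          = (fun k => (g i k : ℝ)) ⬝ᵥ (schurComplement Y *ᵥ fun k => (g j k : ℝ)) := by
        rw [Matrix.mul_assoc]
        rfl
      rw [h2] at h1
      refine (abs_add_le _ _).trans ?_
      rw [abs_div, abs_mul, abs_of_pos ha0]
      have h3 : |a * t i + ∑ j, Y 0 j.succ * (g i j : ℝ)| *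
          |a * t j + ∑ k, Y 0 k.succ * (g j k : ℝ)| / a ≤ a := by
        rw [div_le_iff₀ ha0]
        nlinarith [hc i, hc j, abs_nonneg (a * t i + ∑ j, Y 0 j.succ * (g i j : ℝ)),
          abs_nonneg (a * t j + ∑ k, Y 0 k.succ * (g j k : ℝ))]
      linarith

/-- Hermite reduction: a positive definite form of bounded determinant whose nonzero values at
integral vectors are bounded below is integrally equivalent to one with bounded coefficients. -/
theorem exists_hermite_bound (n : ℕ) : ∀ m D : ℝ, 0 < m → ∃ B : ℝ,
    ∀ Y : Matrix (Fin n) (Fin n) ℝ, Y.PosDef →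
      (∀ v : Fin n → ℤ, v ≠ 0 → m ≤ intForm Y v) → Y.det ≤ D →
      ∃ g : Matrix (Fin n) (Fin n) ℤ, IsUnit g.det ∧
        ∀ i j, |(g.map (Int.cast : ℤ → ℝ) * Y * (g.map (Int.cast : ℤ → ℝ))ᵀ) i j| ≤ B := by
  induction n with
  | zero => exact fun m D _ => ⟨0, fun Y _ _ _ => ⟨1, by simp, fun i => i.elim0⟩⟩
  | succ n ih =>
    intro m D hm
    obtain ⟨B, hB⟩ := exists_bound_of_reduced ih (D := D) hm
    refine ⟨B, fun Y hY hYm hdet => ?_⟩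
    have hrow : ∀ g : Matrix (Fin (n + 1)) (Fin (n + 1)) ℤ, IsUnit g.det → g 0 ≠ 0 := by
      intro g hg h
      have : g.det = 0 := det_eq_zero_of_row_eq_zero 0 fun j => congrFun h j
      rw [this] at hg
      exact not_isUnit_zero hg
    let S : Set ℝ := {r | ∃ g : Matrix (Fin (n + 1)) (Fin (n + 1)) ℤ, IsUnit g.det ∧
      r = intForm Y (g 0)}
    have hSne : S.Nonempty := ⟨_, 1, by simp, rfl⟩
    have hSm : ∀ r ∈ S, m ≤ r := by
      rintro _ ⟨g, hg, rfl⟩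
      exact hYm _ (hrow g hg)
    have hSb : BddBelow S := ⟨m, hSm⟩
    have hinf : m ≤ sInf S := le_csInf hSne hSm
    -- An approximate minimizer suffices, so attainment of the infimum is never needed; the factor
    -- `4 / 3` is the inverse of the `3 / 4` in `exists_bound_of_reduced`.
    obtain ⟨_, ⟨g, hg, rfl⟩, hlt⟩ := exists_lt_of_csInf_lt hSne
      (show sInf S < 4 / 3 * sInf S by linarith)
    -- A nonzero vector is a nonzero integral multiple of a first row, so the infimum over
    -- unimodular first rows bounds all nonzero values.
    have hSle : ∀ u : Fin (n + 1) → ℤ, u ≠ 0 → sInf S ≤ intForm Y u := by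
      intro u hu
      obtain ⟨h, hh, c, hc, rfl⟩ := exists_unimodular_row hu
      have h1 : intForm Y (c • h 0) = c ^ 2 * intForm Y (h 0) := by
        have : (fun i => (((c • h 0) i : ℤ) : ℝ)) = (c : ℝ) • fun i => ((h 0 i : ℤ) : ℝ) := by
          ext i; simp
        rw [intForm, this, mulVec_smul, smul_dotProduct, dotProduct_smul, smul_eq_mul, smul_eq_mul,
          intForm]
        ring
      have h2 : sInf S ≤ intForm Y (h 0) := csInf_le hSb ⟨h, hh, rfl⟩
      have h3 : (1 : ℝ) ≤ (c : ℝ) ^ 2 := by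
        have : 1 ≤ c ^ 2 := by
          have := sq_pos_of_ne_zero hc
          omega
        exact_mod_cast this
      rw [h1]
      nlinarith
    have hginj : Function.Injective fun v : Fin (n + 1) → ℤ => v ᵥ* g := by
      have : Invertible g := invertibleOfIsUnitDet g hg
      apply Function.LeftInverse.injective (g := fun v => v ᵥ* (⅟g))
      intro v
      simp
    have hginjR : Function.Injective fun v : Fin (n + 1) → ℝ => v ᵥ* g.map (Int.cast : ℤ → ℝ) := by
      have hu : IsUnit (g.map (Int.cast : ℤ → ℝ)).det := by
        have : (g.map (Int.cast : ℤ → ℝ)).det = ((g.det : ℤ) : ℝ) :=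
          ((Int.castRingHom ℝ).map_det g).symm
        rw [this]
        exact hg.map (Int.castRingHom ℝ)
      have : Invertible (g.map (Int.cast : ℤ → ℝ)) := invertibleOfIsUnitDet _ hu
      apply Function.LeftInverse.injective (g := fun v => v ᵥ* (⅟(g.map (Int.cast : ℤ → ℝ))))
      intro v
      simp
    set Y1 := g.map (Int.cast : ℤ → ℝ) * Y * (g.map (Int.cast : ℤ → ℝ))ᵀ with hY1
    have hne : ∀ v : Fin (n + 1) → ℤ, v ≠ 0 → v ᵥ* g ≠ 0 := by
      intro v hv h
      exact hv (hginj (by simpa using h))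
    have hY1pos : Y1.PosDef := by
      have := hY.mul_mul_conjTranspose_same hginjR
      rwa [conjTranspose_eq_transpose_of_trivial] at this
    have hY100 : Y1 0 0 = intForm Y (g 0) := by
      rw [hY1, Matrix.mul_assoc]
      rfl
    have hdet1 : Y1.det ≤ D := by
      have h1 : (g.map (Int.cast : ℤ → ℝ)).det = ((g.det : ℤ) : ℝ) :=
        ((Int.castRingHom ℝ).map_det g).symm
      rw [hY1, det_mul, det_mul, det_transpose, h1]
      rcases Int.isUnit_iff.1 hg with h | h <;> rw [h] <;> simpa using hdet
    obtain ⟨g', hg', hB'⟩ := hB Y1 hY1pos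
      (fun v hv => by rw [hY1, intForm_conj]; exact hYm _ (hne v hv))
      (fun v hv => by
        have h1 := hSle _ (hne v hv)
        rw [hY100, hY1, intForm_conj]
        linarith) hdet1
    refine ⟨g' * g, by rw [det_mul]; exact hg'.mul hg, fun i j => ?_⟩
    have := hB' i j
    rw [hY1] at this
    have e : (g' * g).map (Int.cast : ℤ → ℝ) = g'.map (Int.cast : ℤ → ℝ) * g.map (Int.cast : ℤ → ℝ) :=
      Matrix.map_mul (f := Int.castRingHom ℝ)
    rw [e, transpose_mul]
    simpa only [Matrix.mul_assoc] using this

end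

section


/-! ### Finiteness of the set of classes in a genus -/

open Matrix

theorem posDef_of_mem_genus {x y : M4 ℚ} (hx : (x.map (Rat.castHom ℝ)).PosDef)
    (hy : y ∈ genus x) : (y.map (Rat.castHom ℝ)).PosDef := by
  obtain ⟨-, -, g, -, h⟩ := hy
  rw [← act_real_of_act_adele h]
  exact posDef_act hx

theorem det_of_mem_genus {x y : M4 ℚ} (hx : (x.map (Rat.castHom ℝ)).PosDef)
    (hy : y ∈ genus x) : y.det = x.det := by
  obtain ⟨-, -, g, hg, h⟩ := id hy
  exact det_eq_of_act hg hx (posDef_of_mem_genus hx hy) h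

theorem integral_of_mem_genus {x y : M4 ℚ} {M : ℚ} (hM : ∀ i j, ∃ m : ℤ, M * x i j = m)
    (hy : y ∈ genus x) (i j : Fin 4) : ∃ m : ℤ, M * y i j = m := by
  obtain ⟨-, -, g, hg, h⟩ := hy
  exact integral_of_act hg hM h i j

/-- After multiplication by `M` the value is a positive integer. -/
theorem inv_le_intForm {y : M4 ℚ} (hy : (y.map (Rat.castHom ℝ)).PosDef) {M : ℕ} (hM0 : 0 < M)
    (hM : ∀ i j, ∃ m : ℤ, (M : ℚ) * y i j = m) {v : Fin 4 → ℤ} (hv : v ≠ 0) :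
    (M : ℝ)⁻¹ ≤ intForm (y.map (Rat.castHom ℝ)) v := by
  choose m hm using hM
  have h1 : (M : ℝ) * intForm (y.map (Rat.castHom ℝ)) v
      = ((∑ i, ∑ j, v i * (m i j * v j) : ℤ) : ℝ) := by
    have hm' : ∀ i j, (m i j : ℝ) = M * (y i j : ℝ) := fun i j => by
      have := congrArg (fun q : ℚ => (q : ℝ)) (hm i j)
      push_cast at this
      exact this.symm
    push_cast
    simp only [hm', intForm, dotProduct, mulVec, Finset.mul_sum, Matrix.map_apply]
    refine Finset.sum_congr rfl fun i _ => Finset.sum_congr rfl fun j _ => ?_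
    change (M : ℝ) * (v i * ((y i j : ℝ) * v j)) = _
    ring
  have h2 : 0 < intForm (y.map (Rat.castHom ℝ)) v := by
    have := hy.dotProduct_mulVec_pos (x := fun i => (v i : ℝ)) (by
      intro h
      apply hv
      ext i
      have := congrFun h i
      simpa using this)
    rwa [star_trivial] at this
  have hM' : (0 : ℝ) < M := by exact_mod_cast hM0
  have h3 : (0 : ℝ) < ((∑ i, ∑ j, v i * (m i j * v j) : ℤ) : ℝ) := by
    rw [← h1]; positivity
  have h4 : (1 : ℝ) ≤ ((∑ i, ∑ j, v i * (m i j * v j) : ℤ) : ℝ) := by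
    exact_mod_cast h3
  rw [← h1] at h4
  rwa [inv_le_iff_one_le_mul₀' hM']

theorem finite_matrices_of_bound (M : ℕ) (hM0 : 0 < M) (B : ℝ) :
    {z : M4 ℚ | (∀ i j, ∃ m : ℤ, (M : ℚ) * z i j = m) ∧ ∀ i j, |(z i j : ℝ)| ≤ B}.Finite := by
  let S : Set ℤ := Set.Icc (-⌈M * B⌉) ⌈M * B⌉
  have hS : (Set.univ.pi fun _ : Fin 4 => Set.univ.pi fun _ : Fin 4 => S).Finite :=
    Set.Finite.pi fun _ => Set.Finite.pi fun _ => Set.finite_Icc _ _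
  refine (hS.image fun m => (Matrix.of fun i j => (m i j : ℚ) / M : M4 ℚ)).subset ?_
  rintro z ⟨h1, h2⟩
  choose m hm using h1
  have hMq : (M : ℚ) ≠ 0 := by exact_mod_cast hM0.ne'
  refine ⟨m, fun i _ j _ => ?_, ?_⟩
  · have h3 : (m i j : ℝ) = M * (z i j : ℝ) := by
      have := congrArg (fun q : ℚ => (q : ℝ)) (hm i j)
      push_cast at this
      exact this.symm
    have h4 : |(m i j : ℝ)| ≤ M * B := by
      rw [h3, abs_mul, Nat.abs_cast]
      exact mul_le_mul_of_nonneg_left (h2 i j) (Nat.cast_nonneg _)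
    have h5 := abs_le.1 (h4.trans (Int.le_ceil _))
    exact ⟨by exact_mod_cast h5.1, by exact_mod_cast h5.2⟩
  · ext i j
    simp only [Matrix.of_apply]
    rw [← hm]
    field_simp

/-- The genus of a positive definite form with bounded denominators has finitely many classes. -/
theorem finite_genusClass {x : M4 ℚ} (hx : (x.map (Rat.castHom ℝ)).PosDef) {M : ℕ} (hM0 : 0 < M)
    (hM : ∀ i j, ∃ m : ℤ, (M : ℚ) * x i j = m) : Finite (GenusClass x) := by
  have hM' : (0 : ℝ) < M := by exact_mod_cast hM0
  -- The determinant and the denominator bound `M` are constant on the genus, so a single Hermite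
  -- bound places a representative of every class in one finite set.
  obtain ⟨B, hB⟩ := exists_hermite_bound 4 (M : ℝ)⁻¹ (x.det : ℝ) (by positivity)
  have hred : ∀ C : GenusClass x, ∃ z ∈ {z : M4 ℚ | (∀ i j, ∃ m : ℤ, (M : ℚ) * z i j = m) ∧
      ∀ i j, |(z i j : ℝ)| ≤ B}, classSetoid.r (classRep C) z := by
    intro C
    have hy : classRep C ∈ genus x := (Quotient.out C).2
    set y := classRep C
    have hpos := posDef_of_mem_genus hx hy
    have hint := integral_of_mem_genus hM hy
    obtain ⟨g, hg, hgB⟩ := hB (y.map (Rat.castHom ℝ)) hpos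
      (fun v hv => inv_le_intForm hpos hM0 hint hv) (by
        have : (y.map (Rat.castHom ℝ)).det = ((y.det : ℚ) : ℝ) :=
          ((Rat.castHom ℝ).map_det y).symm
        rw [this, det_of_mem_genus hx hy])
    let u : G ℤ := Matrix.GeneralLinearGroup.mk'' g hg
    refine ⟨act (intToG u) y, ⟨?_, ?_⟩, u, rfl⟩
    · have hz : act (ratToG (intToG u)) (toAdeleMatrix y) = toAdeleMatrix (act (intToG u) y) :=
        act_toAdeleMatrix _ _
      exact integral_of_act (ratToG_mem_GInfKf_iff.2 ⟨u, rfl⟩) hint hz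
    · intro i j
      have h1 : (act (intToG u) y).map (Rat.castHom ℝ)
          = g.map (Int.cast : ℤ → ℝ) * y.map (Rat.castHom ℝ) * (g.map (Int.cast : ℤ → ℝ))ᵀ := by
        rw [act, Matrix.map_mul, Matrix.map_mul, Matrix.transpose_map]
        congr 2
      have h2 := hgB i j
      rw [← h1] at h2
      exact h2
  choose z hz hzr using hred
  have : Finite {z : M4 ℚ | (∀ i j, ∃ m : ℤ, (M : ℚ) * z i j = m) ∧
      ∀ i j, |(z i j : ℝ)| ≤ B} := finite_matrices_of_bound M hM0 B
  refine Finite.of_injective (fun C => (⟨z C, hz C⟩ : {z : M4 ℚ | (∀ i j, ∃ m : ℤ,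
    (M : ℚ) * z i j = m) ∧ ∀ i j, |(z i j : ℝ)| ≤ B})) fun C D h => ?_
  have h1 : z C = z D := congrArg Subtype.val h
  rw [← Quotient.out_eq C, ← Quotient.out_eq D]
  apply Quotient.sound
  have h2 := hzr C
  rw [h1] at h2
  exact classSetoid.trans h2 (classSetoid.symm (hzr D))

end

section


/-! ### The spherical section -/

open Matrix

/-- At almost all primes `a` and `a⁻¹` are both integral, and their norms multiply to one. -/
theorem mulSupport_norm_finite (a : Adeleˣ) :
    (Function.mulSupport fun p : Nat.Primes => ‖(a : Adele).2 p‖).Finite := by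
  have h1 := (a : Adele).2.2
  have h2 := ((a⁻¹ : Adeleˣ) : Adele).2.2
  refine (eventually_cofinite.1 (h1.and h2)).subset fun p hp => ?_
  intro hh
  apply hp
  obtain ⟨h3, h4⟩ := hh
  have h5 : ‖(a : Adele).2 p‖ * ‖((a⁻¹ : Adeleˣ) : Adele).2 p‖ = 1 := by
    rw [← norm_mul]
    have := congrArg (adeleToPadic p) a.mul_inv
    rw [map_mul, map_one] at this
    change ‖adeleToPadic p _ * adeleToPadic p _‖ = 1
    rw [this, norm_one]
  have h6 : ‖(a : Adele).2 p‖ ≤ 1 := h3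
  have h7 : ‖((a⁻¹ : Adeleˣ) : Adele).2 p‖ ≤ 1 := h4
  refine le_antisymm h6 ?_
  nlinarith [norm_nonneg ((a : Adele).2 p)]

/-- The idelic absolute value as a homomorphism. -/
def ideleAbsHom : Adeleˣ →* ℝ where
  toFun a := ideleAbs a
  map_one' := by
    simp only [ideleAbs, Units.val_one, Prod.fst_one, Prod.snd_one, abs_one, one_mul]
    exact finprod_eq_one_of_forall_eq_one fun p => norm_one
  map_mul' a b := by
    simp only [ideleAbs, Units.val_mul, Prod.fst_mul, Prod.snd_mul, abs_mul]
    have : (fun p : Nat.Primes => ‖((a : Adele).2 * (b : Adele).2) p‖)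
        = fun p => ‖(a : Adele).2 p‖ * ‖(b : Adele).2 p‖ := by
      funext p
      exact norm_mul _ _
    rw [this, finprod_mul_distrib (mulSupport_norm_finite a) (mulSupport_norm_finite b)]
    ring

theorem ideleAbsHom_apply (a : Adeleˣ) : ideleAbsHom a = ideleAbs a := rfl

theorem ideleAbs_ratToAdele_mul {a b : ℚ} (ha : a ≠ 0) (hb : b ≠ 0) :
    ideleAbs (ratToAdele (a * b)) = ideleAbs (ratToAdele a) * ideleAbs (ratToAdele b) := by
  have := ideleAbsHom.map_mul (Units.map (ratToAdele : ℚ →* Adele) (Units.mk0 a ha))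
    (Units.map (ratToAdele : ℚ →* Adele) (Units.mk0 b hb))
  rw [← map_mul, ← Units.mk0_mul a b (mul_ne_zero ha hb)] at this
  exact this

/-- The product formula. -/
theorem ideleAbs_ratToAdele {q : ℚ} (hq : q ≠ 0) : ideleAbs (ratToAdele q) = 1 := by
  have hnat : ∀ n : ℕ, n ≠ 0 → ideleAbs (ratToAdele (n : ℚ)) = 1 := by
    intro n
    induction n using induction_on_primes with
    | zero => exact fun h => (h rfl).elim
    | one =>
      intro _
      rw [Nat.cast_one, map_one]
      exact ideleAbsHom.map_one
    | prime_mul p a hp ih =>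
      intro h
      have ha : a ≠ 0 := right_ne_zero_of_mul h
      have hp0 : (p : ℝ) ≠ 0 := by exact_mod_cast hp.ne_zero
      rw [Nat.cast_mul, ideleAbs_ratToAdele_mul (by exact_mod_cast hp.ne_zero)
        (by exact_mod_cast ha), ih ha, mul_one, ideleAbs]
      rw [finprod_eq_single (fun q : Nat.Primes => ‖(ratToAdele (p : ℚ)).2 q‖)
        (⟨p, hp⟩ : Nat.Primes)]
      · have : Fact p.Prime := ⟨hp⟩
        have h2 : ‖(((p : ℕ) : ℚ) : ℚ_[p])‖ = (p : ℝ)⁻¹ := by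
          rw [Rat.cast_natCast]; exact Padic.norm_p
        change |(((p : ℚ) : ℝ))| * ‖(((p : ℕ) : ℚ) : ℚ_[p])‖ = 1
        rw [h2, Rat.cast_natCast, Nat.abs_cast, mul_inv_cancel₀ hp0]
      · intro q hq
        rw [ratToAdele_snd, Rat.cast_natCast]
        refine (Padic.norm_natCast_eq_one_iff).2 ?_
        rw [Nat.coprime_primes q.2 hp]
        intro h3
        exact hq (Subtype.ext h3)
  have hint : ∀ n : ℤ, n ≠ 0 → ideleAbs (ratToAdele (n : ℚ)) = 1 := by
    intro n hn
    have h1 : ideleAbs (ratToAdele (n : ℚ)) = ideleAbs (ratToAdele ((n.natAbs : ℕ) : ℚ)) := by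
      rcases Int.natAbs_eq n with h | h
      · conv_lhs => rw [h]
        simp
      · conv_lhs => rw [h]
        simp [ideleAbs]
    rw [h1, hnat _ (Int.natAbs_ne_zero.2 hn)]
  have hd : (q.den : ℚ) ≠ 0 := by exact_mod_cast q.den_nz
  have h1 := ideleAbs_ratToAdele_mul hq hd
  rw [Rat.mul_den_eq_num, hint _ (Rat.num_ne_zero.2 hq), hnat _ q.den_nz, mul_one] at h1
  exact h1.symm

theorem blockUL_mul {R : Type} [CommRing R] {a b : M4 R} (hb : LowerLeftZero b) :
    blockUL (a * b) = blockUL a * blockUL b := by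
  ext i j
  have h0 : b 2 (Fin.castAdd 2 j) = 0 := hb 0 j
  have h1 : b 3 (Fin.castAdd 2 j) = 0 := hb 1 j
  simp only [blockUL, Matrix.submatrix_apply, Matrix.mul_apply, Fin.sum_univ_four,
    Fin.sum_univ_two, h0, h1, mul_zero, add_zero]
  rfl

theorem blockLR_mul {R : Type} [CommRing R] {a b : M4 R} (ha : LowerLeftZero a) :
    blockLR (a * b) = blockLR a * blockLR b := by
  ext i j
  have h0 : a (Fin.natAdd 2 i) 0 = 0 := ha i 0
  have h1 : a (Fin.natAdd 2 i) 1 = 0 := ha i 1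
  simp only [blockLR, Matrix.submatrix_apply, Matrix.mul_apply, Fin.sum_univ_four,
    Fin.sum_univ_two, h0, h1, zero_mul, zero_add]
  rfl

theorem blockUL_one {R : Type} [CommRing R] : blockUL (1 : M4 R) = 1 :=
  submatrix_one _ (Fin.castAdd_injective 2 2)

theorem blockLR_one {R : Type} [CommRing R] : blockLR (1 : M4 R) = 1 :=
  submatrix_one _ (Fin.natAdd_injective 2 2)

/-- The determinant of the upper left block, as a character of `P`. -/
def detUL (R : Type) [CommRing R] : parabolic R →* Rˣ :=
  MonoidHom.toHomUnits
    { toFun := fun p => (blockUL ((p : G R) : M4 R)).det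
      map_one' := by simp [blockUL_one]
      map_mul' := fun a b => by
        simp only [Subgroup.coe_mul, Units.val_mul]
        rw [blockUL_mul b.2, det_mul] }

/-- The determinant of the lower right block, as a character of `P`. -/
def detLR (R : Type) [CommRing R] : parabolic R →* Rˣ :=
  MonoidHom.toHomUnits
    { toFun := fun p => (blockLR ((p : G R) : M4 R)).det
      map_one' := by simp [blockLR_one]
      map_mul' := fun a b => by
        simp only [Subgroup.coe_mul, Units.val_mul]
        rw [blockLR_mul a.2, det_mul] }

theorem detUL_apply {R : Type} [CommRing R] (p : parabolic R) :
    (detUL R p : R) = (blockUL ((p : G R) : M4 R)).det := rfl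

theorem detLR_apply {R : Type} [CommRing R] (p : parabolic R) :
    (detLR R p : R) = (blockLR ((p : G R) : M4 R)).det := rfl

theorem map_mem_parabolic {R S : Type} [CommRing R] [CommRing S] (f : R →+* S) {g : G R}
    (hg : g ∈ parabolic R) : Matrix.GeneralLinearGroup.map f g ∈ parabolic S := by
  intro i j
  have h : (g : M4 R) (Fin.natAdd 2 i) (Fin.castAdd 2 j) = 0 := hg i j
  change f ((g : M4 R) _ _) = 0
  rw [h, map_zero]

theorem map_mem_parabolic_iff {R S : Type} [CommRing R] [CommRing S] {f : R →+* S}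
    (hf : Function.Injective f) {g : G R} :
    Matrix.GeneralLinearGroup.map f g ∈ parabolic S ↔ g ∈ parabolic R := by
  refine ⟨fun h i j => hf ?_, map_mem_parabolic f⟩
  rw [map_zero]
  exact h i j

theorem detUL_map {R S : Type} [CommRing R] [CommRing S] (f : R →+* S) (p : parabolic R) :
    (detUL S ⟨_, map_mem_parabolic f p.2⟩ : S) = f (detUL R p) := by
  rw [detUL_apply, detUL_apply, f.map_det]
  rfl

theorem detLR_map {R S : Type} [CommRing R] [CommRing S] (f : R →+* S) (p : parabolic R) :
    (detLR S ⟨_, map_mem_parabolic f p.2⟩ : S) = f (detLR R p) := by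
  rw [detLR_apply, detLR_apply, f.map_det]
  rfl

theorem mem_K {g : G Adele} : g ∈ K ↔ atReal g ∈ orthGroup ℝ 1 ∧ g ∈ GInfKf := Iff.rfl

theorem G_Adele_ext {g h : G Adele} (h1 : atReal g = atReal h)
    (h2 : ∀ p, atPrime p g = atPrime p h) : g = h := by
  apply Units.ext
  ext i j
  · exact congrArg (fun u : G ℝ => (u : M4 ℝ) i j) h1
  · rename_i p
    exact congrArg (fun u : G ℚ_[(p : ℕ)] => (u : M4 ℚ_[(p : ℕ)]) i j) (h2 p)

theorem atReal_realToG (θ : G ℝ) : atReal (realToG θ) = θ := by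
  apply Units.ext
  ext i j
  rfl

theorem atPrime_realToG (θ : G ℝ) (p : Nat.Primes) : atPrime p (realToG θ) = 1 := by
  apply Units.ext
  ext i j
  change ((1 : M4 FinAdele) i j) p = (1 : M4 ℚ_[(p : ℕ)]) i j
  by_cases h : i = j
  · subst h
    rw [one_apply_eq, one_apply_eq]
    rfl
  · rw [one_apply_ne h, one_apply_ne h]
    rfl

theorem realToG_mul (a b : G ℝ) : realToG (a * b) = realToG a * realToG b := by
  refine G_Adele_ext ?_ fun p => ?_
  · rw [map_mul, atReal_realToG, atReal_realToG, atReal_realToG]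
  · rw [map_mul, atPrime_realToG, atPrime_realToG, atPrime_realToG, mul_one]

theorem realToG_mem_GInfKf (θ : G ℝ) : realToG θ ∈ GInfKf := by
  rw [mem_GInfKf]
  intro p
  rw [atPrime_realToG]
  exact one_mem _

theorem realToG_inv_mul_mem_K {k : G Adele} (hk : k ∈ GInfKf) :
    (realToG (atReal k))⁻¹ * k ∈ K := by
  refine mem_K.2 ⟨?_, mul_mem (inv_mem (realToG_mem_GInfKf _)) hk⟩
  rw [map_mul, map_inv, atReal_realToG, inv_mul_cancel]
  exact one_mem _

theorem realToG_mem_parabolic {θ : G ℝ} (hθ : θ ∈ parabolic ℝ) :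
    realToG θ ∈ parabolic Adele := by
  intro i j
  have h : (θ : M4 ℝ) (Fin.natAdd 2 i) (Fin.castAdd 2 j) = 0 := hθ i j
  have h1 : (1 : M4 FinAdele) (Fin.natAdd 2 i) (Fin.castAdd 2 j) = 0 := one_apply_ne (by
    intro h
    have := congrArg Fin.val h
    simp at this
    omega)
  exact Prod.ext h h1

theorem realToG_mem_K {θ : G ℝ} (hθ : θ ∈ orthGroup ℝ 1) : realToG θ ∈ K := by
  refine mem_K.2 ⟨?_, realToG_mem_GInfKf θ⟩
  rwa [atReal_realToG]

theorem norm_eq_one_of_unit {p : Nat.Primes} (u : Adeleˣ) (h1 : ‖(u : Adele).2 p‖ ≤ 1)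
    (h2 : ‖((u⁻¹ : Adeleˣ) : Adele).2 p‖ ≤ 1) : ‖(u : Adele).2 p‖ = 1 := by
  have h5 : ‖(u : Adele).2 p‖ * ‖((u⁻¹ : Adeleˣ) : Adele).2 p‖ = 1 := by
    have := congrArg (adeleToPadic p) u.mul_inv
    rw [map_mul, map_one] at this
    rw [← norm_mul]
    change ‖adeleToPadic p _ * adeleToPadic p _‖ = 1
    rw [this, norm_one]
  refine le_antisymm h1 ?_
  nlinarith [norm_nonneg ((u : Adele).2 p)]

theorem val_inv_eq_transpose {k : G ℝ} (hk : k ∈ orthGroup ℝ 1) :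
    ((k⁻¹ : G ℝ) : M4 ℝ) = (k : M4 ℝ)ᵀ := by
  have h : (k : M4 ℝ) * 1 * (k : M4 ℝ)ᵀ = 1 := hk
  rw [Matrix.mul_one] at h
  calc ((k⁻¹ : G ℝ) : M4 ℝ) = ((k⁻¹ : G ℝ) : M4 ℝ) * ((k : M4 ℝ) * (k : M4 ℝ)ᵀ) := by
        rw [h, Matrix.mul_one]
    _ = _ := by rw [← Matrix.mul_assoc, Units.inv_mul, Matrix.one_mul]

theorem abs_eq_one_of_inv_eq {u : ℝˣ} (h : ((u⁻¹ : ℝˣ) : ℝ) = u) : |(u : ℝ)| = 1 := by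
  have h1 := u.mul_inv
  rw [h] at h1
  have h2 : |(u : ℝ)| * |(u : ℝ)| = 1 := by rw [abs_mul_abs_self, h1]
  nlinarith [abs_nonneg (u : ℝ)]

/-- At the real place inversion is transposition, so the block determinant is its own inverse; at
each prime it is integral together with its inverse. With the lower block this makes the section
independent of the Iwasawa decomposition. -/
theorem ideleAbs_detUL_of_mem_K {k : parabolic Adele} (hk : (k : G Adele) ∈ K) :
    ideleAbs (detUL Adele k) = 1 := by
  obtain ⟨h1, h2⟩ := mem_K.1 hk
  have hreal : |((detUL Adele k : Adeleˣ) : Adele).1| = 1 := by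
    let k' : parabolic ℝ := ⟨atReal k, map_mem_parabolic adeleToReal k.2⟩
    have hk' : (k' : G ℝ) ∈ orthGroup ℝ 1 := h1
    have h3 : ((detUL Adele k : Adeleˣ) : Adele).1 = detUL ℝ k' := (detUL_map adeleToReal k).symm
    rw [h3]
    apply abs_eq_one_of_inv_eq
    rw [← map_inv, detUL_apply, detUL_apply, Subgroup.coe_inv, val_inv_eq_transpose hk', blockUL,
      ← transpose_submatrix, det_transpose]
    rfl
  rw [ideleAbs, hreal, one_mul]
  rw [mem_GInfKf_iff] at h2
  have hint : ∀ (l : parabolic Adele) (p : Nat.Primes),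
      (∀ i j, ‖(((l : G Adele) : M4 Adele) i j).2 p‖ ≤ 1) →
      ‖((detUL Adele l : Adeleˣ) : Adele).2 p‖ ≤ 1 := by
    intro l p hl
    have h3 : ((detUL Adele l : Adeleˣ) : Adele).2 p
        = detUL ℚ_[(p : ℕ)] ⟨_, map_mem_parabolic (adeleToPadic p) l.2⟩ :=
      (detUL_map (adeleToPadic p) l).symm
    rw [h3, detUL_apply]
    exact norm_det_le_one fun i j => hl _ _
  refine finprod_eq_one_of_forall_eq_one fun p => ?_
  refine norm_eq_one_of_unit _ (hint k p (h2 p).1) ?_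
  rw [← map_inv]
  exact hint k⁻¹ p (h2 p).2

theorem ideleAbs_detLR_of_mem_K {k : parabolic Adele} (hk : (k : G Adele) ∈ K) :
    ideleAbs (detLR Adele k) = 1 := by
  obtain ⟨h1, h2⟩ := mem_K.1 hk
  have hreal : |((detLR Adele k : Adeleˣ) : Adele).1| = 1 := by
    let k' : parabolic ℝ := ⟨atReal k, map_mem_parabolic adeleToReal k.2⟩
    have hk' : (k' : G ℝ) ∈ orthGroup ℝ 1 := h1
    have h3 : ((detLR Adele k : Adeleˣ) : Adele).1 = detLR ℝ k' := (detLR_map adeleToReal k).symm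
    rw [h3]
    apply abs_eq_one_of_inv_eq
    rw [← map_inv, detLR_apply, detLR_apply, Subgroup.coe_inv, val_inv_eq_transpose hk', blockLR,
      ← transpose_submatrix, det_transpose]
    rfl
  rw [ideleAbs, hreal, one_mul]
  rw [mem_GInfKf_iff] at h2
  have hint : ∀ (l : parabolic Adele) (p : Nat.Primes),
      (∀ i j, ‖(((l : G Adele) : M4 Adele) i j).2 p‖ ≤ 1) →
      ‖((detLR Adele l : Adeleˣ) : Adele).2 p‖ ≤ 1 := by
    intro l p hl
    have h3 : ((detLR Adele l : Adeleˣ) : Adele).2 p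
        = detLR ℚ_[(p : ℕ)] ⟨_, map_mem_parabolic (adeleToPadic p) l.2⟩ :=
      (detLR_map (adeleToPadic p) l).symm
    rw [h3, detLR_apply]
    exact norm_det_le_one fun i j => hl _ _
  refine finprod_eq_one_of_forall_eq_one fun p => ?_
  refine norm_eq_one_of_unit _ (hint k p (h2 p).1) ?_
  rw [← map_inv]
  exact hint k⁻¹ p (h2 p).2

/-- The value of the spherical section, read off from any Iwasawa decomposition. -/
theorem sphericalSection_mul (μ : ℂ × ℂ) (p : parabolic Adele) {k : G Adele} (hk : k ∈ K) :
    sphericalSection μ ((p : G Adele) * k) =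
      (ideleAbs (detUL Adele p) : ℂ) ^ (μ.1 + 1) * (ideleAbs (detLR Adele p) : ℂ) ^ (μ.2 - 1) := by
  have h : ∃ q ∈ parabolic Adele, q⁻¹ * ((p : G Adele) * k) ∈ K :=
    ⟨p, p.2, by rwa [inv_mul_cancel_left]⟩
  rw [sphericalSection, dif_pos h]
  obtain ⟨h1, h2⟩ := h.choose_spec
  set q : parabolic Adele := ⟨h.choose, h1⟩
  have h3 : ((q⁻¹ * p : parabolic Adele) : G Adele) ∈ K := by
    have := mul_mem h2 (inv_mem hk)
    rw [← mul_assoc, mul_inv_cancel_right] at this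
    exact this
  have e1 : ideleAbs (detUL Adele p) = ideleAbs (detUL Adele q) := by
    have h4 := ideleAbsHom.map_mul (detUL Adele q) (detUL Adele (q⁻¹ * p))
    rw [← map_mul, mul_inv_cancel_left, ideleAbsHom_apply, ideleAbsHom_apply, ideleAbsHom_apply,
      ideleAbs_detUL_of_mem_K h3, mul_one] at h4
    exact h4
  have e2 : ideleAbs (detLR Adele p) = ideleAbs (detLR Adele q) := by
    have h4 := ideleAbsHom.map_mul (detLR Adele q) (detLR Adele (q⁻¹ * p))
    rw [← map_mul, mul_inv_cancel_left, ideleAbsHom_apply, ideleAbsHom_apply, ideleAbsHom_apply,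
      ideleAbs_detLR_of_mem_K h3, mul_one] at h4
    exact h4
  rw [e1, e2]
  rfl

/-- The Iwasawa decomposition of `GL_4(ℝ)`. -/
theorem exists_real_iwasawa (θ : G ℝ) :
    ∃ p ∈ parabolic ℝ, ∃ k ∈ orthGroup ℝ 1, θ = p * k := by
  have hcard : Module.finrank ℝ (EuclideanSpace ℝ (Fin 4)) = Fintype.card (Fin 4) := by simp
  -- Gram–Schmidt runs from the last row upwards, so that the triangular factor is upper triangular.
  let f : Fin 4 → EuclideanSpace ℝ (Fin 4) := fun i => WithLp.toLp 2 ((θ : M4 ℝ) i.rev)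
  let e := InnerProductSpace.gramSchmidtOrthonormalBasis hcard f
  let U : M4 ℝ := Matrix.of fun i j => e i.rev j
  have hU : U * Uᵀ = 1 := by
    ext i j
    have h1 := orthonormal_iff_ite.1 e.orthonormal i.rev j.rev
    rw [Matrix.mul_apply, Matrix.one_apply]
    rw [EuclideanSpace.inner_eq_star_dotProduct] at h1
    simp only [Fin.rev_inj] at h1
    rw [← h1, dotProduct]
    refine Finset.sum_congr rfl fun l _ => ?_
    simp [U, mul_comm]
  have hU' : Uᵀ * U = 1 := mul_eq_one_comm.1 hU
  let k : G ℝ := ⟨U, Uᵀ, hU, hU'⟩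
  have hk : k ∈ orthGroup ℝ 1 := by
    change U * 1 * Uᵀ = 1
    rw [Matrix.mul_one, hU]
  refine ⟨θ * k⁻¹, fun i j => ?_, k, hk, by rw [inv_mul_cancel_right]⟩
  have hlt : Fin.castAdd 2 j < Fin.natAdd 2 i := by
    rw [Fin.lt_def]
    simp
    omega
  have h1 := InnerProductSpace.gramSchmidtOrthonormalBasis_inv_triangular (h := hcard) (f := f)
    (Fin.rev_lt_rev.2 hlt)
  rw [EuclideanSpace.inner_eq_star_dotProduct] at h1
  rw [Units.val_mul, Matrix.mul_apply]
  rw [← h1, dotProduct]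
  refine Finset.sum_congr rfl fun l _ => ?_
  simp [f, k, U, e]

/-- The Iwasawa decomposition of `GL_4(𝔸)` on `G_∞ K_f`, at the real place only. -/
theorem exists_iwasawa_of_mem_GInfKf {g : G Adele} (hg : g ∈ GInfKf) :
    ∃ p ∈ parabolic ℝ, ∃ k ∈ K, g = realToG p * k ∧ ∃ k' ∈ orthGroup ℝ 1, atReal g = p * k' := by
  obtain ⟨p, hp, k, hk, h⟩ := exists_real_iwasawa (atReal g)
  refine ⟨p, hp, realToG k * ((realToG (atReal g))⁻¹ * g),
    mul_mem (realToG_mem_K hk) (realToG_inv_mul_mem_K hg), ?_, k, hk, h⟩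
  rw [← mul_assoc, ← realToG_mul, ← h, mul_inv_cancel_left]

end

section


/-! ### Integral representatives of rational flags -/

open Matrix

theorem exists_perm_of_ne : ∀ a b : Fin 4, a ≠ b → ∃ σ : Equiv.Perm (Fin 4), σ 2 = a ∧ σ 3 = b := by
  decide

/-- The integral vectors `v` such that `v r⁻¹` vanishes in the first two coordinates, i.e. the
integral points of the span of the two bottom rows of `r`. -/
def bottomLattice (r : G ℚ) : Submodule ℤ (Fin 4 → ℤ) :=
  LinearMap.ker (M₂ := Fin 2 → ℚ) (τ₁₂ := RingHom.id ℤ)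
    { toFun := fun (v : Fin 4 → ℤ) (j : Fin 2) =>
        ((fun i => (v i : ℚ)) ᵥ* ((r⁻¹ : G ℚ) : M4 ℚ)) (Fin.castAdd 2 j)
      map_add' := fun v w => by
        ext j
        simp [vecMul, dotProduct, add_mul, Finset.sum_add_distrib]
      map_smul' := fun c v => by
        ext j
        simp [vecMul, dotProduct, mul_assoc, Finset.mul_sum, zsmul_eq_mul] }

theorem mem_bottomLattice {r : G ℚ} {v : Fin 4 → ℤ} : v ∈ bottomLattice r ↔
    ∀ j : Fin 2, ((fun i => (v i : ℚ)) ᵥ* ((r⁻¹ : G ℚ) : M4 ℚ)) (Fin.castAdd 2 j) = 0 := by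
  rw [bottomLattice, LinearMap.mem_ker]
  exact funext_iff

theorem mem_bottomLattice_of_smul_mem {r : G ℚ} {a : ℤ} (ha : a ≠ 0) {v : Fin 4 → ℤ}
    (h : a • v ∈ bottomLattice r) : v ∈ bottomLattice r := by
  rw [bottomLattice, LinearMap.mem_ker, map_smul] at h
  exact (smul_eq_zero.1 h).resolve_left ha

/-- The two bottom rows of `r`, cleared of denominators, are independent members. -/
theorem two_le_finrank_bottomLattice (r : G ℚ) : 2 ≤ Module.finrank ℤ (bottomLattice r) := by
  obtain ⟨D, hD⟩ := IsLocalization.exist_integer_multiples_of_finite (nonZeroDivisors ℤ)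
    (fun ij : Fin 2 × Fin 4 => (r : M4 ℚ) (Fin.natAdd 2 ij.1) ij.2)
  choose m hm using hD
  have hm' : ∀ i j, (m (i, j) : ℚ) = (D : ℤ) * (r : M4 ℚ) (Fin.natAdd 2 i) j := fun i j => by
    have := hm (i, j)
    rw [zsmul_eq_mul] at this
    exact this
  have hD0 : ((D : ℤ) : ℚ) ≠ 0 := by
    exact_mod_cast nonZeroDivisors.ne_zero D.2
  have hrow : ∀ i : Fin 2, (fun j => (m (i, j) : ℚ))
      = ((D : ℤ) : ℚ) • ((r : M4 ℚ) (Fin.natAdd 2 i)) := fun i => funext fun j => hm' i j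
  have hone : ∀ i : Fin 4, ((r : M4 ℚ) i) ᵥ* ((r⁻¹ : G ℚ) : M4 ℚ) = (1 : M4 ℚ) i := by
    intro i
    rw [← Units.mul_inv r]
    rfl
  let w : Fin 2 → bottomLattice r := fun i => ⟨fun j => m (i, j), mem_bottomLattice.2 fun j => by
    rw [hrow, smul_vecMul, hone, Pi.smul_apply, one_apply_ne, smul_zero]
    intro h
    have := congrArg Fin.val h
    simp at this
    omega⟩
  have hw : LinearIndependent ℤ w := by
    rw [Fintype.linearIndependent_iff]
    intro c hc
    have h1 : ∀ j, ∑ i, (c i : ℚ) * m (i, j) = 0 := by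
      intro j
      have := congrFun (congrArg Subtype.val hc) j
      simp only [w, Submodule.coe_sum, Submodule.coe_smul, Finset.sum_apply, Pi.smul_apply,
        smul_eq_mul, Submodule.coe_zero, Pi.zero_apply] at this
      exact_mod_cast this
    have h2 : (∑ i, (c i : ℚ) • (fun j => (m (i, j) : ℚ))) ᵥ* ((r⁻¹ : G ℚ) : M4 ℚ) = 0 := by
      have : (∑ i, (c i : ℚ) • (fun j => (m (i, j) : ℚ))) = 0 := by
        ext j
        simpa [Finset.sum_apply] using h1 j
      rw [this, zero_vecMul]
    intro i
    have h3 := congrFun h2 (Fin.natAdd 2 i)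
    rw [Fin.sum_univ_two, hrow, hrow, add_vecMul, smul_vecMul, smul_vecMul, smul_vecMul,
      smul_vecMul, hone, hone] at h3
    fin_cases i <;> simpa [hD0, one_apply] using h3
  simpa using hw.fintype_card_le_finrank

/-- The integral points of the span of the two bottom rows form a saturated lattice, so the members
of a Smith basis of `ℤ⁴` that have multiples in it lie in it themselves. Two of them, permuted to
the bottom, give the rows of `δ`. -/
theorem exists_parabolic_mul_int (r : G ℚ) :
    ∃ b ∈ parabolic ℚ, ∃ δ : G ℤ, r = b * intToG δ := by
  obtain ⟨k, snf⟩ := Submodule.smithNormalForm (Pi.basisFun ℤ (Fin 4)) (bottomLattice r)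
  have hk : 2 ≤ k := by
    have h1 := two_le_finrank_bottomLattice r
    rw [Module.finrank_eq_card_basis snf.bN] at h1
    simpa using h1
  let i0 : Fin k := ⟨0, by omega⟩
  let i1 : Fin k := ⟨1, by omega⟩
  have hne : snf.f i0 ≠ snf.f i1 := by
    intro h
    have := congrArg Fin.val (snf.f.injective h)
    simp [i0, i1] at this
  obtain ⟨σ, h2, h3⟩ := exists_perm_of_ne _ _ hne
  have hmem : ∀ i, snf.bM (snf.f i) ∈ bottomLattice r := by
    intro i
    have h4 := (snf.bN i).2
    rw [snf.snf i] at h4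
    have ha : snf.a i ≠ 0 := by
      intro h0
      have h5 := snf.snf i
      rw [h0, zero_smul] at h5
      exact snf.bN.ne_zero i (Subtype.ext h5)
    exact mem_bottomLattice_of_smul_mem ha h4
  let b := snf.bM.reindex σ.symm
  let δ : G ℤ := Matrix.GeneralLinearGroup.mk'' _ (isUnit_det_of_basis b)
  have hδ : intToG δ * r⁻¹ ∈ parabolic ℚ := by
    intro i j
    have h4 : (δ : M4 ℤ) (Fin.natAdd 2 i) ∈ bottomLattice r := by
      fin_cases i
      · have : (δ : M4 ℤ) 2 = snf.bM (snf.f i0) := by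
          rw [← h2]
          ext l
          simp [δ, b]
        exact this ▸ hmem i0
      · have : (δ : M4 ℤ) 3 = snf.bM (snf.f i1) := by
          rw [← h3]
          ext l
          simp [δ, b]
        exact this ▸ hmem i1
    exact mem_bottomLattice.1 h4 j
  refine ⟨_, inv_mem hδ, δ, ?_⟩
  group

/-- The global Iwasawa decomposition, assembled from class number one, the integral representatives
of rational flags and the real decomposition. -/
theorem sphericalSection_exists (g : G Adele) :
    ∃ p : parabolic Adele, ∃ k ∈ K, g = p * k := by
  obtain ⟨γ, k, hk, rfl⟩ := exists_rat_mul_GInfKf g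
  obtain ⟨b, hb, δ, rfl⟩ := exists_parabolic_mul_int γ
  have h1 : ratToG (intToG δ) * k ∈ GInfKf := mul_mem (ratToG_mem_GInfKf_iff.2 ⟨δ, rfl⟩) hk
  obtain ⟨p, hp, k', hk', h2, -⟩ := exists_iwasawa_of_mem_GInfKf h1
  refine ⟨⟨_, mul_mem (map_mem_parabolic ratToAdele hb) (realToG_mem_parabolic hp)⟩, k', hk', ?_⟩
  rw [map_mul, mul_assoc, h2, ← mul_assoc]

/-- The block determinants of `γ` are nonzero rationals, of idelic absolute value one by the product
formula. -/
theorem sphericalSection_rat_mul (μ : ℂ × ℂ) {γ : G ℚ} (hγ : γ ∈ parabolic ℚ) (g : G Adele) :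
    sphericalSection μ (ratToG γ * g) = sphericalSection μ g := by
  obtain ⟨p, k, hk, rfl⟩ := sphericalSection_exists g
  let γ' : parabolic ℚ := ⟨γ, hγ⟩
  let γA : parabolic Adele := ⟨_, map_mem_parabolic ratToAdele hγ⟩
  have h1 : ratToG γ * ((p : G Adele) * k) = ((γA * p : parabolic Adele) : G Adele) * k := by
    rw [← mul_assoc]; rfl
  have e1 : ideleAbs (detUL Adele γA) = 1 := by
    rw [show ((detUL Adele γA : Adeleˣ) : Adele) = _ from detUL_map ratToAdele γ']
    exact ideleAbs_ratToAdele (detUL ℚ γ').ne_zero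
  have e2 : ideleAbs (detLR Adele γA) = 1 := by
    rw [show ((detLR Adele γA : Adeleˣ) : Adele) = _ from detLR_map ratToAdele γ']
    exact ideleAbs_ratToAdele (detLR ℚ γ').ne_zero
  rw [h1, sphericalSection_mul μ _ hk, sphericalSection_mul μ _ hk, map_mul, map_mul,
    ← ideleAbsHom_apply, ← ideleAbsHom_apply, map_mul, map_mul, ideleAbsHom_apply,
    ideleAbsHom_apply, ideleAbsHom_apply, ideleAbsHom_apply, e1, e2, one_mul, one_mul]

theorem eisensteinTerm_mk (g : G Adele) (μ : ℂ × ℂ) (r : G ℚ) :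
    eisensteinTerm g μ (Quotient.mk _ r) = sphericalSection μ (ratToG r * g) := by
  rw [eisensteinTerm]
  have h : (QuotientGroup.rightRel (parabolic ℚ)) (Quotient.out (Quotient.mk
      (QuotientGroup.rightRel (parabolic ℚ)) r)) r := Quotient.mk_out r
  rw [QuotientGroup.rightRel_apply] at h
  have h1 := sphericalSection_rat_mul μ h (ratToG (Quotient.out (Quotient.mk
      (QuotientGroup.rightRel (parabolic ℚ)) r)) * g)
  rw [← h1, ← mul_assoc, ← map_mul, inv_mul_cancel_right]

/-- Translation by `γ` of the map `P_ℤ \ G_ℤ → P_ℚ \ G_ℚ`. -/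
def flagMap (γ : G ℚ) (q : Flag ℤ) : Flag ℚ := Quotient.mk _ (intToG (Quotient.out q) * γ⁻¹)

/-- Surjectivity is `exists_parabolic_mul_int`, injectivity is `P_ℚ ∩ GL_4(ℤ) = P_ℤ`. The factor
`γ⁻¹` absorbs the rational part of a point `γ k` at which the series is evaluated. -/
theorem flagMap_bijective (γ : G ℚ) : Function.Bijective (flagMap γ) := by
  constructor
  · intro q q' h
    have h1 := Quotient.exact h
    change (QuotientGroup.rightRel (parabolic ℚ)) _ _ at h1
    rw [QuotientGroup.rightRel_apply, _root_.mul_inv_rev, inv_inv, mul_assoc, inv_mul_cancel_left,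
      ← map_inv, ← map_mul, map_mem_parabolic_iff Int.cast_injective] at h1
    rw [← Quotient.out_eq q, ← Quotient.out_eq q']
    apply Quotient.sound
    change (QuotientGroup.rightRel (parabolic ℤ)) _ _
    rwa [QuotientGroup.rightRel_apply]
  · intro q
    obtain ⟨r, rfl⟩ := Quotient.exists_rep q
    obtain ⟨b, hb, δ, h⟩ := exists_parabolic_mul_int (r * γ)
    refine ⟨Quotient.mk _ δ, ?_⟩
    apply Quotient.sound
    have h1 : (QuotientGroup.rightRel (parabolic ℤ)) (Quotient.out (Quotient.mk
      (QuotientGroup.rightRel (parabolic ℤ)) δ)) δ := Quotient.mk_out δ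
    rw [QuotientGroup.rightRel_apply] at h1
    change (QuotientGroup.rightRel (parabolic ℚ)) _ _
    rw [QuotientGroup.rightRel_apply]
    have h2 := mul_mem hb (map_mem_parabolic (Int.castRingHom ℚ) h1)
    convert h2 using 1
    rw [eq_mul_inv_of_mul_eq h, _root_.mul_inv_rev, inv_inv, map_mul, map_inv]
    group

/-- The parametrization of rational flags by integral ones. -/
def flagEquiv (γ : G ℚ) : Flag ℤ ≃ Flag ℚ := Equiv.ofBijective _ (flagMap_bijective γ)

end

section


/-! ### Plücker coordinates and the terms of the Eisenstein series -/

open Matrix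

theorem sum_pair {A : Type} [AddCommMonoid A] (f : Pair → A) :
    ∑ J, f J = f ⟨(0, 1), by decide⟩ + (f ⟨(0, 2), by decide⟩ + (f ⟨(0, 3), by decide⟩ +
      (f ⟨(1, 2), by decide⟩ + (f ⟨(1, 3), by decide⟩ + f ⟨(2, 3), by decide⟩)))) := by
  have : (Finset.univ : Finset Pair) = {⟨(0, 1), by decide⟩, ⟨(0, 2), by decide⟩,
    ⟨(0, 3), by decide⟩, ⟨(1, 2), by decide⟩, ⟨(1, 3), by decide⟩, ⟨(2, 3), by decide⟩} := by
    decide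
  rw [this]
  repeat rw [Finset.sum_insert (by decide)]
  rw [Finset.sum_singleton]

/-- Functoriality of the second exterior power. -/
theorem plucker_mul {R : Type} [CommRing R] (g h : M4 R) :
    plucker (g * h) = plucker g ᵥ* wedgeSq h := by
  ext J
  simp only [plucker, vecMul, dotProduct, sum_pair, wedgeSq, Matrix.of_apply, Matrix.mul_apply,
    Fin.sum_univ_four]
  ring

/-- The Cauchy–Binet formula for the Gram determinant of the two bottom rows. -/
theorem det_blockLR_conj {R : Type} [CommRing R] (g x : M4 R) :
    (blockLR (g * x * gᵀ)).det = QWedge x (plucker g) := by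
  have h1 : QWedge x (plucker g) = plucker (g * x) ⬝ᵥ plucker g := by
    rw [plucker_mul, QWedge, dotProduct_mulVec]
  have h2 : ∀ i j : Fin 2, blockLR (g * x * gᵀ) i j
      = ∑ l, (g * x) (Fin.natAdd 2 i) l * g (Fin.natAdd 2 j) l := fun i j => rfl
  rw [h1, det_fin_two, h2, h2, h2, h2]
  generalize g * x = y
  simp only [dotProduct, sum_pair, plucker, Fin.sum_univ_four]
  change (y 2 0 * g 2 0 + y 2 1 * g 2 1 + y 2 2 * g 2 2 + y 2 3 * g 2 3) *
      (y 3 0 * g 3 0 + y 3 1 * g 3 1 + y 3 2 * g 3 2 + y 3 3 * g 3 3) -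
    (y 2 0 * g 3 0 + y 2 1 * g 3 1 + y 2 2 * g 3 2 + y 2 3 * g 3 3) *
      (y 3 0 * g 2 0 + y 3 1 * g 2 1 + y 3 2 * g 2 2 + y 3 3 * g 2 3) = _
  ring

theorem wedgeSq_one {R : Type} [CommRing R] : wedgeSq (1 : M4 R) = 1 := by
  ext I J
  obtain ⟨⟨a, b⟩, hab⟩ := I
  obtain ⟨⟨c, d⟩, hcd⟩ := J
  simp only [wedgeSq, Matrix.of_apply, Matrix.one_apply, Subtype.mk.injEq, Prod.mk.injEq]
  simp only at hab hcd
  by_cases h1 : a = c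
  · by_cases h2 : b = d
    · subst h1 h2
      simp [hab.ne]
    · subst h1
      simp only [h2, if_false, mul_zero, and_false, if_true]
      rw [if_neg hab.ne']
      simp
  · simp only [h1, if_false, zero_mul, false_and, zero_sub]
    by_cases h2 : a = d
    · subst h2
      rw [if_neg (hcd.trans hab).ne']
      simp
    · simp [h2]

theorem det_of_lowerLeftZero {R : Type} [CommRing R] {p : M4 R} (hp : LowerLeftZero p) :
    p.det = (blockUL p).det * (blockLR p).det := by
  rw [← det_submatrix_equiv_self (finSumFinEquiv (m := 2) (n := 2)) p]
  have : p.submatrix (finSumFinEquiv (m := 2) (n := 2)) (finSumFinEquiv (m := 2) (n := 2))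
      = fromBlocks (blockUL p) (p.submatrix (Fin.castAdd 2) (Fin.natAdd 2)) 0 (blockLR p) := by
    ext i j
    rcases i with i | i <;> rcases j with j | j
    · rfl
    · rfl
    · exact hp i j
    · rfl
  rw [this, det_fromBlocks_zero₂₁]

theorem ideleAbs_realToG_detUL (p : parabolic ℝ) :
    ideleAbs (detUL Adele ⟨realToG p, realToG_mem_parabolic p.2⟩)
      = |(blockUL ((p : G ℝ) : M4 ℝ)).det| := by
  set P : parabolic Adele := ⟨realToG p, realToG_mem_parabolic p.2⟩
  rw [ideleAbs]
  have h1 : ((detUL Adele P : Adeleˣ) : Adele).1 = (blockUL ((p : G ℝ) : M4 ℝ)).det :=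
    (detUL_map adeleToReal P).symm
  have h2 : ∀ q : Nat.Primes, ‖((detUL Adele P : Adeleˣ) : Adele).2 q‖ = 1 := by
    intro q
    have h3 : ((detUL Adele P : Adeleˣ) : Adele).2 q
        = (blockUL ((atPrime q (realToG p) : G ℚ_[(q : ℕ)]) : M4 ℚ_[(q : ℕ)])).det :=
      (detUL_map (adeleToPadic q) P).symm
    rw [h3, atPrime_realToG, Units.val_one, blockUL_one, det_one, norm_one]
  rw [h1, finprod_eq_one_of_forall_eq_one h2, mul_one]

theorem ideleAbs_realToG_detLR (p : parabolic ℝ) :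
    ideleAbs (detLR Adele ⟨realToG p, realToG_mem_parabolic p.2⟩)
      = |(blockLR ((p : G ℝ) : M4 ℝ)).det| := by
  set P : parabolic Adele := ⟨realToG p, realToG_mem_parabolic p.2⟩
  rw [ideleAbs]
  have h1 : ((detLR Adele P : Adeleˣ) : Adele).1 = (blockLR ((p : G ℝ) : M4 ℝ)).det :=
    (detLR_map adeleToReal P).symm
  have h2 : ∀ q : Nat.Primes, ‖((detLR Adele P : Adeleˣ) : Adele).2 q‖ = 1 := by
    intro q
    have h3 : ((detLR Adele P : Adeleˣ) : Adele).2 q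
        = (blockLR ((atPrime q (realToG p) : G ℚ_[(q : ℕ)]) : M4 ℚ_[(q : ℕ)])).det :=
      (detLR_map (adeleToPadic q) P).symm
    rw [h3, atPrime_realToG, Units.val_one, blockLR_one, det_one, norm_one]
  rw [h1, finprod_eq_one_of_forall_eq_one h2, mul_one]

theorem act_one_eq (θ : G ℝ) : act θ 1 = (θ : M4 ℝ) * (θ : M4 ℝ)ᵀ := by
  rw [act, Matrix.mul_one]

theorem blockLR_det_pos {X : M4 ℝ} (hX : X.PosDef) : 0 < (blockLR X).det :=
  (hX.submatrix (Fin.natAdd_injective 2 2)).det_pos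

/-- The spherical section on `G_∞ K_f`. -/
theorem sphericalSection_of_mem_GInfKf {μ : ℂ × ℂ} (hμ : μ.1 + μ.2 = 0) {k : G Adele}
    (hk : k ∈ GInfKf) :
    sphericalSection μ k = ((|((atReal k : G ℝ) : M4 ℝ).det| : ℝ) : ℂ) ^ (μ.1 + 1) *
      (((blockLR (act (atReal k) 1)).det : ℝ) : ℂ) ^ (-(μ.1 + 1)) := by
  obtain ⟨p, hp, k', hk', h, k₀, hk₀, h₀⟩ := exists_iwasawa_of_mem_GInfKf hk
  rw [h, sphericalSection_mul μ ⟨_, realToG_mem_parabolic hp⟩ hk', ← h,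
    ideleAbs_realToG_detUL ⟨p, hp⟩, ideleAbs_realToG_detLR ⟨p, hp⟩, h₀, act_mul,
    show act k₀ 1 = 1 from hk₀, act_one_eq]
  set a := (blockUL (p : M4 ℝ)).det
  set d := (blockLR (p : M4 ℝ)).det with hd
  have hdet : (p : M4 ℝ).det = a * d := det_of_lowerLeftZero hp
  have hk1 : |((k₀ : G ℝ) : M4 ℝ).det| = 1 := by
    have h1 := congrArg det (show (k₀ : M4 ℝ) * 1 * (k₀ : M4 ℝ)ᵀ = 1 from hk₀)
    rw [Matrix.mul_one, det_mul, det_transpose, det_one] at h1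
    rw [← abs_mul_abs_self] at h1
    nlinarith [abs_nonneg (k₀ : M4 ℝ).det]
  have hd0 : |d| ≠ 0 := by
    rw [abs_ne_zero]
    exact (detLR ℝ ⟨p, hp⟩).ne_zero
  have hgram : (blockLR ((p : M4 ℝ) * (p : M4 ℝ)ᵀ)).det = |d| * |d| := by
    rw [blockLR_mul hp, det_mul, abs_mul_abs_self, hd]
    congr 1
    exact det_transpose _
  rw [Units.val_mul, det_mul, hdet, abs_mul, hk1, mul_one, abs_mul, hgram]
  push_cast
  -- Here `μ₁ + μ₂ = 0` enters: with `s = μ₁ + 1` the section is `|a|^s |d|^(-s)`, which equals `|a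
  -- d|^s (|d|²)^(-s)`.
  have e : μ.2 - 1 = -(μ.1 + 1) := by linear_combination hμ
  have hd0' : ((|d| : ℝ) : ℂ) ≠ 0 := by exact_mod_cast hd0
  rw [e, Complex.mul_cpow_ofReal_nonneg (abs_nonneg _) (abs_nonneg _),
    Complex.mul_cpow_ofReal_nonneg (abs_nonneg _) (abs_nonneg _), mul_assoc]
  congr 1
  rw [← mul_assoc, ← Complex.cpow_add _ _ hd0', add_neg_cancel, Complex.cpow_zero, one_mul]

/-- The integral Plücker vector of a flag. -/
def flagVec (q : Flag ℤ) : Pair → ℤ := plucker (Units.val (Quotient.out q : G ℤ))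

/-- The value of the quadratic form `⋀² X` at an integral flag. -/
def flagValue (X : M4 ℝ) (q : Flag ℤ) : ℝ := QWedge X fun J => (flagVec q J : ℝ)

/-- The inclusion `GL_4(ℤ) → GL_4(ℝ)`. -/
abbrev intToReal : G ℤ →* G ℝ := Matrix.GeneralLinearGroup.map (Int.castRingHom ℝ)

theorem plucker_intToReal (δ : G ℤ) :
    plucker (intToReal δ : M4 ℝ) = fun J => ((plucker (δ : M4 ℤ) J : ℤ) : ℝ) := by
  ext J
  simp [plucker]

theorem flagValue_eq_det (X : M4 ℝ) (q : Flag ℤ) :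
    flagValue X q = (blockLR (act (intToReal (Quotient.out q)) X)).det := by
  rw [act, det_blockLR_conj, plucker_intToReal]
  rfl

theorem flagValue_pos {X : M4 ℝ} (hX : X.PosDef) (q : Flag ℤ) : 0 < flagValue X q := by
  rw [flagValue_eq_det]
  exact blockLR_det_pos (posDef_act hX)

/-- The terms of the Eisenstein series in terms of integral flags. -/
theorem eisensteinTerm_flagEquiv {μ : ℂ × ℂ} (hμ : μ.1 + μ.2 = 0) (γ : G ℚ) {k : G Adele}
    (hk : k ∈ GInfKf) (q : Flag ℤ) :
    eisensteinTerm (ratToG γ * k) μ (flagEquiv γ q) =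
      ((|((atReal k : G ℝ) : M4 ℝ).det| : ℝ) : ℂ) ^ (μ.1 + 1) *
        (flagValue (act (atReal k) 1) q : ℂ) ^ (-(μ.1 + 1)) := by
  set δ : G ℤ := Quotient.out q
  have h1 : flagEquiv γ q = Quotient.mk _ (intToG δ * γ⁻¹) := rfl
  have hδ : ratToG (intToG δ) ∈ GInfKf := ratToG_mem_GInfKf_iff.2 ⟨δ, rfl⟩
  have h2 : atReal (ratToG (intToG δ)) = intToReal δ := by
    apply Units.ext
    ext i j
    change ((((δ : M4 ℤ) i j : ℚ)) : ℝ) = ((δ : M4 ℤ) i j : ℝ)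
    rw [Rat.cast_intCast]
  have h3 : |((intToReal δ : G ℝ) : M4 ℝ).det| = 1 := by
    have h4 : ((intToReal δ : G ℝ) : M4 ℝ).det = (((δ : M4 ℤ).det : ℤ) : ℝ) :=
      ((Int.castRingHom ℝ).map_det (δ : M4 ℤ)).symm
    rw [h4, ← Int.cast_abs]
    have h5 : IsUnit (δ : M4 ℤ).det := (Matrix.isUnit_iff_isUnit_det _).1 δ.isUnit
    rw [Int.isUnit_iff_abs_eq.1 h5, Int.cast_one]
  rw [h1, eisensteinTerm_mk, ← mul_assoc, map_mul, mul_assoc (ratToG (intToG δ)), ← map_mul,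
    inv_mul_cancel, map_one, mul_one, sphericalSection_of_mem_GInfKf hμ (mul_mem hδ hk), map_mul,
    h2, act_mul, ← flagValue_eq_det, Units.val_mul, det_mul, abs_mul, h3, one_mul]

end

section


/-! ### Absolute convergence -/

open Matrix

/-- Equality of Plücker vectors gives `m = δ δ'⁻¹` the Plücker vector of the identity. Its lower
left entries then vanish by three-term identities, namely the vanishing of `3 × 3` determinants with
a repeated row. -/
theorem flagVec_injective : Function.Injective flagVec := by
  intro q q' h
  set δ : G ℤ := Quotient.out q with hδ
  set δ' : G ℤ := Quotient.out q' with hδ'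
  set m : M4 ℤ := ((δ * δ'⁻¹ : G ℤ) : M4 ℤ) with hm
  have h1 : plucker m = plucker (1 : M4 ℤ) := by
    rw [hm, Units.val_mul, plucker_mul, show plucker (δ : M4 ℤ) = plucker (δ' : M4 ℤ) from h,
      ← plucker_mul, Units.mul_inv]
  have h02 := congrFun h1 ⟨(0, 2), by decide⟩
  have h03 := congrFun h1 ⟨(0, 3), by decide⟩
  have h12 := congrFun h1 ⟨(1, 2), by decide⟩
  have h13 := congrFun h1 ⟨(1, 3), by decide⟩
  have h23 := congrFun h1 ⟨(2, 3), by decide⟩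
  simp [plucker, one_apply] at h02 h03 h12 h13 h23
  have h2 : δ * δ'⁻¹ ∈ parabolic ℤ := by
    intro i j
    fin_cases i <;> fin_cases j
    · change m 2 0 = 0
      linear_combination -(m 2 0) * h23 + m 2 2 * h03 - m 2 3 * h02
    · change m 2 1 = 0
      linear_combination -(m 2 1) * h23 + m 2 2 * h13 - m 2 3 * h12
    · change m 3 0 = 0
      linear_combination -(m 3 0) * h23 + m 3 2 * h03 - m 3 3 * h02
    · change m 3 1 = 0
      linear_combination -(m 3 1) * h23 + m 3 2 * h13 - m 3 3 * h12
  rw [← Quotient.out_eq q, ← Quotient.out_eq q']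
  apply Quotient.sound
  change (QuotientGroup.rightRel (parabolic ℤ)) _ _
  rw [QuotientGroup.rightRel_apply]
  have h3 := inv_mem h2
  rwa [_root_.mul_inv_rev, inv_inv] at h3

/-- The real Plücker vector of an integral flag. -/
def realFlagVec (q : Flag ℤ) : Pair → ℝ := fun J => (flagVec q J : ℝ)

theorem card_pair : Fintype.card Pair = 6 := by decide

/-- The standard lattice in `⋀² ℝ⁴`. -/
abbrev pairLattice : Submodule ℤ (Pair → ℝ) := Submodule.span ℤ (Set.range (Pi.basisFun ℝ Pair))

theorem finrank_pairLattice : Module.finrank ℤ pairLattice = 6 := by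
  rw [ZLattice.rank ℝ pairLattice, Module.finrank_fintype_fun_eq_card]
  exact card_pair

theorem realFlagVec_mem_pairLattice (q : Flag ℤ) : realFlagVec q ∈ pairLattice := by
  rw [(Pi.basisFun ℝ Pair).mem_span_iff_repr_mem ℤ]
  intro J
  exact ⟨flagVec q J, by simp [realFlagVec]⟩

theorem summable_norm_pairLattice {r : ℝ} (hr : r < -6) :
    Summable fun z : pairLattice => ‖z‖ ^ r :=
  ZLattice.summable_norm_rpow pairLattice r (by
    rw [finrank_pairLattice]
    exact_mod_cast hr)

theorem summable_norm_realFlagVec {r : ℝ} (hr : r < -6) :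
    Summable fun q => ‖realFlagVec q‖ ^ r := by
  refine (summable_norm_pairLattice hr).comp_injective
    (i := fun q => (⟨realFlagVec q, realFlagVec_mem_pairLattice q⟩ : pairLattice)) ?_
  intro q q' h
  apply flagVec_injective
  ext J
  have h2 : realFlagVec q = realFlagVec q' := congrArg Subtype.val h
  exact Int.cast_injective (α := ℝ) (congrFun h2 J)

theorem QWedge_one {R : Type} [CommRing R] (v : Pair → R) : QWedge 1 v = v ⬝ᵥ v := by
  rw [QWedge, wedgeSq_one, one_mulVec]

/-- In terms of the minors `w` of the two bottom rows of `δ θ` the form is the sum of squares, and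
the integral Plücker vector is `w` times the fixed matrix `⋀² θ⁻¹`. -/
theorem exists_norm_realFlagVec_le (θ : G ℝ) :
    ∃ C : ℝ, 0 < C ∧ ∀ q, ‖realFlagVec q‖ ≤ C * √(flagValue (act θ 1) q) := by
  let T : Matrix Pair Pair ℝ := wedgeSq ((θ⁻¹ : G ℝ) : M4 ℝ)
  have hC : 0 ≤ ∑ I, ∑ J, |T I J| := Finset.sum_nonneg fun I _ => Finset.sum_nonneg fun J _ =>
    abs_nonneg _
  refine ⟨(∑ I, ∑ J, |T I J|) + 1, by linarith, fun q => ?_⟩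
  set Q := flagValue (act θ 1) q with hQ
  set w := plucker ((intToReal (Quotient.out q) * θ : G ℝ) : M4 ℝ) with hw
  have h1 : Q = w ⬝ᵥ w := by
    rw [hQ, flagValue_eq_det, ← act_mul, act, det_blockLR_conj, QWedge_one]
  have h2 : realFlagVec q = w ᵥ* T := by
    rw [hw, ← plucker_mul, ← Units.val_mul, mul_inv_cancel_right, plucker_intToReal]
    rfl
  have h3 : ∀ I, |w I| ≤ √Q := by
    intro I
    refine Real.abs_le_sqrt ?_
    rw [h1, dotProduct, sq]
    exact Finset.single_le_sum (f := fun I => w I * w I) (fun I _ => mul_self_nonneg _)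
      (Finset.mem_univ I)
  rw [pi_norm_le_iff_of_nonneg (by positivity)]
  intro J
  rw [h2, Real.norm_eq_abs, vecMul, dotProduct]
  calc |∑ I, w I * T I J| ≤ ∑ I, |w I * T I J| := Finset.abs_sum_le_sum_abs _ _
    _ ≤ ∑ I, √Q * ∑ J, |T I J| := by
        refine Finset.sum_le_sum fun I _ => ?_
        rw [abs_mul]
        exact mul_le_mul (h3 I) (Finset.single_le_sum (f := fun J => |T I J|)
          (fun _ _ => abs_nonneg _) (Finset.mem_univ J)) (abs_nonneg _) (Real.sqrt_nonneg _)
    _ = (∑ I, ∑ J, |T I J|) * √Q := by rw [← Finset.mul_sum, mul_comm]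
    _ ≤ _ := mul_le_mul_of_nonneg_right (by linarith) (Real.sqrt_nonneg _)

theorem realFlagVec_ne_zero (q : Flag ℤ) : realFlagVec q ≠ 0 := by
  intro h
  have h1 := flagValue_pos (X := 1) PosDef.one q
  rw [flagValue, QWedge_one] at h1
  change 0 < realFlagVec q ⬝ᵥ realFlagVec q at h1
  rw [h, zero_dotProduct] at h1
  exact lt_irrefl _ h1

theorem posDef_act_one (θ : G ℝ) : (act θ 1).PosDef := posDef_act PosDef.one

/-- The form is quadratic, so the terms are dominated by `‖v‖ ^ (-2 Re s)` at distinct points of a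
lattice of rank 6; this converges for `2 Re s > 6`. -/
theorem summable_flagValue (θ : G ℝ) {s : ℂ} (hs : 3 < s.re) :
    Summable fun q => ((flagValue (act θ 1) q : ℝ) : ℂ) ^ (-s) := by
  obtain ⟨C, hC, hb⟩ := exists_norm_realFlagVec_le θ
  refine Summable.of_norm_bounded ((summable_norm_realFlagVec (r := -2 * s.re)
    (by linarith)).mul_left (C ^ (2 * s.re))) fun q => ?_
  have hQ := flagValue_pos (posDef_act_one θ) q
  have hv : 0 < ‖realFlagVec q‖ := norm_pos_iff.2 (realFlagVec_ne_zero q)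
  rw [Complex.norm_cpow_eq_rpow_re_of_pos hQ, Complex.neg_re]
  have h1 : ‖realFlagVec q‖ / C ≤ √(flagValue (act θ 1) q) := by
    rw [div_le_iff₀ hC, mul_comm]
    exact hb q
  have h2 : flagValue (act θ 1) q ^ (-s.re) = √(flagValue (act θ 1) q) ^ (-2 * s.re) := by
    rw [Real.sqrt_eq_rpow, ← Real.rpow_mul hQ.le]
    congr 1
    ring
  rw [h2]
  refine (Real.rpow_le_rpow_of_nonpos (by positivity) h1 (by linarith)).trans (le_of_eq ?_)
  rw [Real.div_rpow hv.le hC.le, div_eq_mul_inv, ← Real.rpow_neg hC.le, mul_comm]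
  congr 2
  ring

theorem summable_eisensteinTerm {μ : ℂ × ℂ} (hμ : μ.1 + μ.2 = 0) (hc : 4 < (μ.1 - μ.2).re)
    (g : G Adele) : Summable (eisensteinTerm g μ) := by
  obtain ⟨γ, k, hk, rfl⟩ := exists_rat_mul_GInfKf g
  rw [← (flagEquiv γ).summable_iff]
  have h1 : μ.2 = -μ.1 := by linear_combination hμ
  rw [h1, sub_neg_eq_add, Complex.add_re] at hc
  have h2 : (eisensteinTerm (ratToG γ * k) μ ∘ flagEquiv γ) = fun q =>
      ((|((atReal k : G ℝ) : M4 ℝ).det| : ℝ) : ℂ) ^ (μ.1 + 1) *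
        (flagValue (act (atReal k) 1) q : ℂ) ^ (-(μ.1 + 1)) :=
    funext fun q => eisensteinTerm_flagEquiv hμ γ hk q
  rw [h2]
  refine (summable_flagValue _ ?_).mul_left _
  rw [Complex.add_re, Complex.one_re]
  linarith

theorem eisenstein_rat_mul {μ : ℂ × ℂ} (hμ : μ.1 + μ.2 = 0) (γ : G ℚ) {k : G Adele}
    (hk : k ∈ GInfKf) :
    eisenstein (ratToG γ * k) μ = ((|((atReal k : G ℝ) : M4 ℝ).det| : ℝ) : ℂ) ^ (μ.1 + 1) *
      ∑' q, (flagValue (act (atReal k) 1) q : ℂ) ^ (-(μ.1 + 1)) := by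
  rw [eisenstein, ← (flagEquiv γ).tsum_eq, ← tsum_mul_left]
  exact tsum_congr fun q => eisensteinTerm_flagEquiv hμ γ hk q

/-! ### The Dirichlet series -/

theorem QWedge_map {R S : Type} [CommRing R] [CommRing S] (f : R →+* S) (x : M4 R)
    (v : Pair → R) : QWedge (x.map f) (fun J => f (v J)) = f (QWedge x v) := by
  simp only [QWedge, dotProduct, mulVec, map_sum, map_mul]
  refine Finset.sum_congr rfl fun I _ => ?_
  congr 1
  refine Finset.sum_congr rfl fun J _ => ?_
  congr 1
  simp [wedgeSq]

theorem flagValue_eq_pluckerValue (y : M4 ℚ) (q : Flag ℤ) :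
    flagValue (y.map (Rat.castHom ℝ)) q = (pluckerValue y q : ℝ) := by
  have := QWedge_map (Rat.castHom ℝ) y fun J => ((flagVec q J : ℤ) : ℚ)
  simp only [eq_ratCast, Rat.cast_intCast] at this
  exact this

/-- The `2 × 2` minors of `M y` are integers, so `M²` is a common denominator of the values; this is
the role of `N`. -/
theorem exists_pluckerValue_eq {y : M4 ℚ} (hy : (y.map (Rat.castHom ℝ)).PosDef) {M : ℕ}
    (hM0 : 0 < M) (hM : ∀ i j, ∃ m : ℤ, (M : ℚ) * y i j = m) (q : Flag ℤ) :
    ∃ n : ℕ+, pluckerValue y q = (n : ℚ) / (M ^ 2 : ℕ) := by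
  have hpos : 0 < pluckerValue y q := by
    have := flagValue_pos hy q
    rw [flagValue_eq_pluckerValue] at this
    exact_mod_cast this
  have hMq : (0 : ℚ) < M := by exact_mod_cast hM0
  choose m hm using hM
  have hQ : (M : ℚ) ^ 2 * pluckerValue y q = ((QWedge (Matrix.of m) (flagVec q) : ℤ) : ℚ) := by
    have h1 := QWedge_map (Int.castRingHom ℚ) (Matrix.of m) (flagVec q)
    simp only [eq_intCast] at h1
    rw [← h1]
    simp only [pluckerValue, QWedge, dotProduct, mulVec, Finset.mul_sum]
    refine Finset.sum_congr rfl fun I _ => Finset.sum_congr rfl fun J _ => ?_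
    simp only [wedgeSq, Matrix.of_apply, Matrix.map_apply, eq_intCast, ← hm, flagVec]
    ring
  have hpos' : 0 < QWedge (Matrix.of m) (flagVec q) := by
    have h2 : (0 : ℚ) < ((QWedge (Matrix.of m) (flagVec q) : ℤ) : ℚ) := by
      rw [← hQ]; positivity
    exact_mod_cast h2
  obtain ⟨n, hn⟩ := Int.eq_ofNat_of_zero_le hpos'.le
  have hn0 : 0 < n := by omega
  refine ⟨⟨n, hn0⟩, ?_⟩
  rw [eq_div_iff (by positivity)]
  push_cast
  rw [mul_comm, hQ, hn]
  simp

theorem hasSum_dirichletTerm {y : M4 ℚ} (hy : (y.map (Rat.castHom ℝ)).PosDef) {M : ℕ}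
    (hM0 : 0 < M) (hM : ∀ i j, ∃ m : ℤ, (M : ℚ) * y i j = m) {s : ℂ}
    (hs : Summable fun q => ((flagValue (y.map (Rat.castHom ℝ)) q : ℝ) : ℂ) ^ (-s)) :
    HasSum (dirichletTerm (fun k => (rP y k : ℂ)) (M ^ 2) s)
      (∑' q, ((flagValue (y.map (Rat.castHom ℝ)) q : ℝ) : ℂ) ^ (-s)) := by
  choose n hn using exists_pluckerValue_eq hy hM0 hM
  have hMq : ((M ^ 2 : ℕ) : ℚ) ≠ 0 := by positivity
  have h := hs.hasSum.tsum_fiberwise n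
  suffices e : dirichletTerm (fun k => (rP y k : ℂ)) (M ^ 2) s = fun k => ∑' b : n ⁻¹' {k},
      ((flagValue (y.map (Rat.castHom ℝ)) b : ℝ) : ℂ) ^ (-s) by
    rw [e]
    exact h
  funext k
  have h1 : ∀ b : n ⁻¹' {k}, ((flagValue (y.map (Rat.castHom ℝ)) b : ℝ) : ℂ) ^ (-s)
      = (((((k : ℚ) / (M ^ 2 : ℕ)) : ℚ)) : ℂ) ^ (-s) := by
    rintro ⟨b, hb⟩
    rw [flagValue_eq_pluckerValue, hn, show n b = k from hb, Complex.ofReal_ratCast]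
  -- Both `tsum_const` and `rP` count the fibre by `Nat.card`, so its finiteness need not be
  -- verified here.
  rw [tsum_congr h1, tsum_const, nsmul_eq_mul, dirichletTerm, Complex.cpow_neg, ← div_eq_mul_inv]
  congr 2
  rw [rP]
  refine Nat.card_congr (Equiv.subtypeEquivRight fun q => ?_)
  rw [hn, div_left_inj' hMq]
  constructor
  · intro h
    exact PNat.coe_injective (by exact_mod_cast h)
  · intro h
    rw [show n q = k from h]

end

section


/-! ### Topology of the adelic orthogonal group -/

open Matrix

instance factIsOpenPadicInt : Fact (∀ p : Nat.Primes,
    IsOpen ((PadicInt.subring (p : ℕ) : Subring ℚ_[(p : ℕ)]) : Set ℚ_[(p : ℕ)])) := ⟨fun p => by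
  have h : ((PadicInt.subring (p : ℕ) : Subring ℚ_[(p : ℕ)]) : Set ℚ_[(p : ℕ)])
      = Metric.closedBall 0 1 := by
    ext a
    rw [mem_closedBall_zero_iff]
    rfl
  rw [h]
  exact IsUltrametricDist.isOpen_closedBall _ one_ne_zero⟩

instance isTopologicalRingFinAdele : IsTopologicalRing FinAdele :=
  RestrictedProduct.isTopologicalRing (fun p : Nat.Primes => ℚ_[(p : ℕ)])
    (B := fun p : Nat.Primes => PadicInt.subring (p : ℕ))

instance isTopologicalRingAdele : IsTopologicalRing Adele := inferInstance

instance isTopologicalGroupGAdele : IsTopologicalGroup (G Adele) := inferInstance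

instance t2SpaceGAdele : T2Space (G Adele) := inferInstance

/-- The integral finite adeles. -/
def integralFinAdele : Set FinAdele := {a | ∀ p : Nat.Primes, ‖a p‖ ≤ 1}

theorem isOpen_integralFinAdele : IsOpen integralFinAdele :=
  RestrictedProduct.isOpen_forall_mem (R := fun p : Nat.Primes => ℚ_[(p : ℕ)])
    (A := fun p : Nat.Primes => (PadicInt.subring (p : ℕ) : Set ℚ_[(p : ℕ)]))
    factIsOpenPadicInt.out

theorem isCompact_integralFinAdele : IsCompact integralFinAdele := by
  have h1 : integralFinAdele = Set.range (RestrictedProduct.structureMap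
      (fun p : Nat.Primes => ℚ_[(p : ℕ)])
      (fun p : Nat.Primes => (PadicInt.subring (p : ℕ) : Set ℚ_[(p : ℕ)])) cofinite) := by
    rw [RestrictedProduct.range_structureMap]
    rfl
  rw [h1]
  have : ∀ p : Nat.Primes, CompactSpace
      (PadicInt.subring (p : ℕ) : Set ℚ_[(p : ℕ)]) := fun p =>
    (inferInstance : CompactSpace ℤ_[(p : ℕ)])
  exact isCompact_range RestrictedProduct.isEmbedding_structureMap.continuous

theorem continuous_entry (i j : Fin 4) : Continuous fun g : G Adele => (g : M4 Adele) i j :=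
  (Units.continuous_val (M := M4 Adele)).matrix_elem i j

theorem continuous_inv_entry (i j : Fin 4) :
    Continuous fun g : G Adele => ((g⁻¹ : G Adele) : M4 Adele) i j :=
  (continuous_entry i j).comp continuous_inv

theorem isOpen_GInfKf : IsOpen (GInfKf : Set (G Adele)) := by
  have h : (GInfKf : Set (G Adele)) = ⋂ ij : Fin 4 × Fin 4,
      ((fun g : G Adele => ((g : M4 Adele) ij.1 ij.2).2) ⁻¹' integralFinAdele ∩
        (fun g : G Adele => (((g⁻¹ : G Adele) : M4 Adele) ij.1 ij.2).2) ⁻¹' integralFinAdele) := by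
    ext g
    rw [SetLike.mem_coe, mem_GInfKf_iff]
    simp only [Set.mem_iInter, Set.mem_inter_iff, Set.mem_preimage, integralFinAdele,
      Set.mem_ofPred_eq, Prod.forall]
    exact ⟨fun h i j => ⟨fun p => (h p).1 i j, fun p => (h p).2 i j⟩,
      fun h p => ⟨fun i j => (h i j).1 p, fun i j => (h i j).2 p⟩⟩
  rw [h]
  exact isOpen_iInter_of_finite fun ij =>
    (isOpen_integralFinAdele.preimage (continuous_snd.comp (continuous_entry _ _))).inter
      (isOpen_integralFinAdele.preimage (continuous_snd.comp (continuous_inv_entry _ _)))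

theorem isClosed_HA (x : M4 ℚ) : IsClosed (HA x : Set (G Adele)) := by
  have hc : Continuous fun g : G Adele => act g (toAdeleMatrix x) := by
    have h1 : Continuous fun g : G Adele => (g : M4 Adele) := Units.continuous_val
    exact (h1.mul continuous_const).mul h1.matrix_transpose
  exact isClosed_eq hc continuous_const

/-- Conjugation by `θ` carries the group to `O(4)`, where matrix entries are at most one in absolute
value. -/
theorem exists_orthGroup_bound (θ : G ℝ) :
    ∃ R : ℝ, ∀ h ∈ orthGroup ℝ (act θ 1), ∀ i j, |(h : M4 ℝ) i j| ≤ R := by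
  refine ⟨∑ a, ∑ b, ∑ i, ∑ j, |(θ : M4 ℝ) i a| * |((θ⁻¹ : G ℝ) : M4 ℝ) b j|, fun h hh i j => ?_⟩
  set o : G ℝ := θ⁻¹ * h * θ with ho
  have ho1 : act o 1 = 1 := by
    rw [ho, act_mul, act_mul, show act h (act θ 1) = act θ 1 from hh, ← act_mul, inv_mul_cancel,
      act_one]
  have hoo : ∀ a b, |(o : M4 ℝ) a b| ≤ 1 := by
    intro a b
    rw [act_one_eq] at ho1
    have h1 := congrFun (congrFun ho1 a) a
    rw [Matrix.mul_apply, one_apply_eq] at h1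
    have h2 : (o : M4 ℝ) a b * (o : M4 ℝ) a b ≤ 1 := by
      rw [← h1]
      exact Finset.single_le_sum (f := fun b => (o : M4 ℝ) a b * (o : M4 ℝ) a b)
        (fun _ _ => mul_self_nonneg _) (Finset.mem_univ b)
    exact abs_le_one_iff_mul_self_le_one.2 h2
  have hh' : h = θ * o * θ⁻¹ := by rw [ho]; group
  have e : (h : M4 ℝ) i j
      = ∑ b, ∑ a, (θ : M4 ℝ) i a * (o : M4 ℝ) a b * ((θ⁻¹ : G ℝ) : M4 ℝ) b j := by
    rw [hh', Units.val_mul, Units.val_mul, Matrix.mul_apply]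
    refine Finset.sum_congr rfl fun b _ => ?_
    rw [Matrix.mul_apply, Finset.sum_mul]
  rw [e, Finset.sum_comm]
  refine (Finset.abs_sum_le_sum_abs _ _).trans (Finset.sum_le_sum fun a _ => ?_)
  refine (Finset.abs_sum_le_sum_abs _ _).trans (Finset.sum_le_sum fun b _ => ?_)
  rw [abs_mul, abs_mul]
  calc |(θ : M4 ℝ) i a| * |(o : M4 ℝ) a b| * |((θ⁻¹ : G ℝ) : M4 ℝ) b j|
      ≤ |(θ : M4 ℝ) i a| * |((θ⁻¹ : G ℝ) : M4 ℝ) b j| := by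
        refine mul_le_mul_of_nonneg_right ?_ (abs_nonneg _)
        exact mul_le_of_le_one_right (abs_nonneg _) (hoo a b)
    _ ≤ ∑ j, |(θ : M4 ℝ) i a| * |((θ⁻¹ : G ℝ) : M4 ℝ) b j| :=
        Finset.single_le_sum (f := fun j => |(θ : M4 ℝ) i a| * |((θ⁻¹ : G ℝ) : M4 ℝ) b j|)
          (fun _ _ => by positivity) (Finset.mem_univ j)
    _ ≤ _ := Finset.single_le_sum
          (f := fun i => ∑ j, |(θ : M4 ℝ) i a| * |((θ⁻¹ : G ℝ) : M4 ℝ) b j|)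
          (fun _ _ => Finset.sum_nonneg fun _ _ => by positivity) (Finset.mem_univ i)

/-- The integral automorphism group of a positive definite form is finite. -/
theorem finite_aut {y : M4 ℚ} {θ : G ℝ} (hθ : act θ 1 = y.map (Rat.castHom ℝ)) :
    Finite {g : G ℤ // act (intToG g) y = y} := by
  obtain ⟨R, hR⟩ := exists_orthGroup_bound θ
  let S : Set (Fin 4 → Fin 4 → ℤ) :=
    Set.univ.pi fun _ => Set.univ.pi fun _ => Set.Icc (-⌈R⌉) ⌈R⌉
  have hS : S.Finite := Set.Finite.pi fun _ => Set.Finite.pi fun _ => Set.finite_Icc _ _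
  have : Finite S := hS
  refine Finite.of_injective (β := S) (fun g => ⟨fun i j => (g.1 : M4 ℤ) i j, fun i _ j _ => ?_⟩) ?_
  · have h1 : intToReal g.1 ∈ orthGroup ℝ (act θ 1) := by
      have h2 := act_map (Rat.castHom ℝ) (intToG g.1) y
      rw [g.2] at h2
      have e : Matrix.GeneralLinearGroup.map (Rat.castHom ℝ) (intToG g.1) = intToReal g.1 := by
        apply Units.ext
        ext i j
        change ((((g.1 : M4 ℤ) i j : ℤ) : ℚ) : ℝ) = (((g.1 : M4 ℤ) i j : ℤ) : ℝ)
        rw [Rat.cast_intCast]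
      change act _ _ = _
      rw [hθ, ← e]
      exact h2
    have h3 := hR _ h1 i j
    have h4 : |((g.1 : M4 ℤ) i j : ℝ)| ≤ R := h3
    have h5 := abs_le.1 (h4.trans (Int.le_ceil _))
    exact ⟨by exact_mod_cast h5.1, by exact_mod_cast h5.2⟩
  · intro g g' h
    apply Subtype.ext
    apply Units.ext
    ext i j
    exact congrFun (congrFun (congrArg Subtype.val h) i) j

theorem isOpen_HCompact (x : M4 ℚ) : IsOpen (HCompact x) :=
  isOpen_GInfKf.preimage continuous_subtype_val

theorem atReal_mem_orthGroup {x : M4 ℚ} {h : G Adele} (hh : h ∈ HA x) :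
    atReal h ∈ orthGroup ℝ (x.map (Rat.castHom ℝ)) :=
  act_real_of_act_adele (show act h (toAdeleMatrix x) = toAdeleMatrix x from hh)

/-- The topology of the unit group involves an element together with its inverse. The real entries
of both are bounded because the form is definite, the finite ones are integral, and `H^x_𝔸` is
closed. -/
theorem isCompact_HCompact {x : M4 ℚ} {θ : G ℝ} (hθ : act θ 1 = x.map (Rat.castHom ℝ)) :
    IsCompact (HCompact x) := by
  obtain ⟨R, hR⟩ := exists_orthGroup_bound θ
  rw [hθ] at hR
  let B : Set Adele := Set.Icc (-R) R ×ˢ integralFinAdele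
  have hB : IsCompact B := isCompact_Icc.prod isCompact_integralFinAdele
  let T : Set (M4 Adele) := Set.univ.pi fun _ : Fin 4 => Set.univ.pi fun _ : Fin 4 => B
  have hT : IsCompact T := isCompact_univ_pi fun _ => isCompact_univ_pi fun _ => hB
  have hTT : IsCompact (T ×ˢ (MulOpposite.op '' T)) :=
    hT.prod (hT.image MulOpposite.continuous_op)
  have h1 := (Units.isClosedEmbedding_embedProduct (α := M4 Adele)).isCompact_preimage hTT
  rw [Subtype.isCompact_iff]
  have h2 : Subtype.val '' HCompact x
      = (Units.embedProduct (M4 Adele)) ⁻¹' (T ×ˢ (MulOpposite.op '' T)) ∩ (HA x) := by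
    ext g
    constructor
    · rintro ⟨h, hh, rfl⟩
      have hint := mem_GInfKf_iff.1 (show (h : G Adele) ∈ GInfKf from hh)
      have hreal := hR _ (atReal_mem_orthGroup h.2)
      have hreal' := hR _ (atReal_mem_orthGroup (inv_mem h.2))
      refine ⟨⟨fun i _ j _ => ⟨abs_le.1 (hreal i j), fun p => (hint p).1 i j⟩, _,
        fun i _ j _ => ⟨abs_le.1 (hreal' i j), fun p => (hint p).2 i j⟩, rfl⟩, h.2⟩
    · rintro ⟨⟨hg1, w, hw, hg2⟩, hg⟩
      refine ⟨⟨g, hg⟩, ?_, rfl⟩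
      have hw' : w = ((g⁻¹ : G Adele) : M4 Adele) := MulOpposite.op_injective hg2
      subst hw'
      exact mem_GInfKf_iff.2 fun p => ⟨fun i j => (hg1 i trivial j trivial).2 p,
        fun i j => (hw i trivial j trivial).2 p⟩
  rw [h2]
  exact h1.inter_right (isClosed_HA x)

end

section


/-! ### Quotient measures -/

open Matrix

/-- Countability is what permits sums over `H^x_ℚ` to be measurable and to be exchanged with
integrals. -/
instance countable_HQ (x : M4 ℚ) : Countable (HQ x) := by
  have h1 : Countable (M4 ℚ) := inferInstanceAs (Countable (Fin 4 → Fin 4 → ℚ))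
  have h2 : Countable (G ℚ) := (Units.val_injective (α := M4 ℚ)).countable
  have h3 : Countable (ratToG.range : Subgroup (G Adele)) :=
    (MonoidHom.rangeRestrict_surjective ratToG).countable
  refine Function.Injective.countable
    (f := fun γ : HQ x => (⟨((γ : HA x) : G Adele), γ.2⟩ : (ratToG.range : Subgroup (G Adele)))) ?_
  intro a b h
  exact Subtype.ext (Subtype.ext (Subtype.mk.inj h))

/-- The projection `H^x_𝔸 → H^x_ℚ \ H^x_𝔸`. -/
def toHQuot {x : M4 ℚ} (h : HA x) : HQuot x := Quotient.mk _ h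

theorem exists_out_toHQuot {x : M4 ℚ} (h : HA x) :
    ∃ γ : HQ x, Quotient.out (toHQuot h) = (γ : HA x) * h := by
  have h1 : (QuotientGroup.rightRel (HQ x)) (Quotient.out (Quotient.mk
      (QuotientGroup.rightRel (HQ x)) h)) h := Quotient.mk_out h
  rw [QuotientGroup.rightRel_apply] at h1
  refine ⟨⟨_, inv_mem h1⟩, ?_⟩
  change _ = (h * _⁻¹)⁻¹ * h
  rw [_root_.mul_inv_rev, inv_inv, inv_mul_cancel_right]
  rfl

theorem toHQuot_mul {x : M4 ℚ} (γ : HQ x) (h : HA x) : toHQuot ((γ : HA x) * h) = toHQuot h := by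
  apply Quotient.sound
  change (QuotientGroup.rightRel (HQ x)) _ _
  rw [QuotientGroup.rightRel_apply, _root_.mul_inv_rev, mul_inv_cancel_left]
  exact inv_mem γ.2

theorem toHQuot_out {x : M4 ℚ} (q : HQuot x) : toHQuot (Quotient.out q) = q := Quotient.out_eq q

theorem tsum_mul_out {x : M4 ℚ} (f : HA x → ℝ≥0∞) (h : HA x) :
    ∑' γ : HQ x, f ((γ : HA x) * Quotient.out (toHQuot h)) = ∑' γ : HQ x, f ((γ : HA x) * h) := by
  obtain ⟨γ₀, hγ₀⟩ := exists_out_toHQuot h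
  rw [hγ₀, ← (Equiv.mulRight γ₀).tsum_eq fun γ : HQ x => f ((γ : HA x) * h)]
  refine tsum_congr fun γ => ?_
  rw [Equiv.coe_mulRight, Subgroup.coe_mul, mul_assoc]

variable {x : M4 ℚ} [MeasurableSpace (HA x)]

theorem measurable_toHQuot : Measurable (toHQuot : HA x → HQuot x) := measurable_quotient_mk''

theorem measurable_tsum_mul_out [BorelSpace (HA x)] {f : HA x → ℝ≥0∞} (hf : Measurable f) :
    Measurable fun q : HQuot x => ∑' γ : HQ x, f ((γ : HA x) * Quotient.out q) := by
  refine measurable_from_quotient.2 ?_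
  have : ((fun q : HQuot x => ∑' γ : HQ x, f ((γ : HA x) * Quotient.out q)) ∘ Quotient.mk'')
      = fun h => ∑' γ : HQ x, f ((γ : HA x) * h) := funext fun h => tsum_mul_out f h
  rw [this]
  exact Measurable.tsum fun γ => hf.comp (measurable_const_mul _)

/-- A quotient measure is determined by any weight whose sum over `H^x_ℚ`-orbits is one. -/
theorem isQuotientMeasure_iff [BorelSpace (HA x)] (μ : Measure (HA x)) [μ.IsMulLeftInvariant]
    {w : HA x → ℝ≥0∞} (hw : Measurable w) (hw1 : ∀ h, ∑' γ : HQ x, w ((γ : HA x) * h) = 1)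
    (ν : Measure (HQuot x)) :
    IsQuotientMeasure x μ ν ↔ ν = (μ.withDensity w).map toHQuot := by
  constructor
  · intro hν
    -- The test function is the weight restricted to the preimage of `B`; its orbit sums are the
    -- indicator of `B`.
    ext B hB
    rw [Measure.map_apply measurable_toHQuot hB,
      withDensity_apply _ (measurable_toHQuot hB), ← lintegral_indicator (measurable_toHQuot hB),
      hν _ (hw.indicator (measurable_toHQuot hB)), ← lintegral_indicator_one hB]
    refine lintegral_congr fun q => ?_
    by_cases hq : q ∈ B
    · rw [Set.indicator_of_mem hq, Pi.one_apply, ← hw1 (Quotient.out q)]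
      refine tsum_congr fun γ => ?_
      rw [Set.indicator_of_mem]
      rwa [Set.mem_preimage, toHQuot_mul, toHQuot_out]
    · rw [Set.indicator_of_notMem hq]
      symm
      rw [ENNReal.tsum_eq_zero]
      intro γ
      rw [Set.indicator_of_notMem]
      rwa [Set.mem_preimage, toHQuot_mul, toHQuot_out]
  · rintro rfl f hf
    rw [lintegral_map (measurable_tsum_mul_out hf) measurable_toHQuot]
    simp_rw [tsum_mul_out]
    have hF : Measurable fun h : HA x => ∑' γ : HQ x, f ((γ : HA x) * h) :=
      Measurable.tsum fun γ => hf.comp (measurable_const_mul _)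
    rw [lintegral_withDensity_eq_lintegral_mul _ hw hF]
    simp only [Pi.mul_apply, ← ENNReal.tsum_mul_left]
    have hm : ∀ γ : HQ x, AEMeasurable (fun h => w h * f ((γ : HA x) * h)) μ := fun γ =>
      (hw.mul (hf.comp (measurable_const_mul (γ : HA x)))).aemeasurable
    have hm' : ∀ γ : HQ x, AEMeasurable (fun h => w (((γ⁻¹ : HQ x) : HA x) * h) * f h) μ :=
      fun γ => ((hw.comp (measurable_const_mul ((γ⁻¹ : HQ x) : HA x))).mul hf).aemeasurable
    rw [lintegral_tsum hm]
    -- Left invariance moves `γ` from `f` to the weight, and summing over `γ` then replaces the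
    -- weight by one.
    have h1 : ∀ γ : HQ x, ∫⁻ h, w h * f ((γ : HA x) * h) ∂μ
        = ∫⁻ h, w (((γ⁻¹ : HQ x) : HA x) * h) * f h ∂μ := by
      intro γ
      rw [← lintegral_mul_left_eq_self (μ := μ) (fun h => w (((γ⁻¹ : HQ x) : HA x) * h) * f h)
        (γ : HA x)]
      simp only [Subgroup.coe_inv, inv_mul_cancel_left]
    rw [tsum_congr h1, ← lintegral_tsum hm']
    refine lintegral_congr fun h => ?_
    have h2 := (Equiv.inv (HQ x)).tsum_eq fun γ : HQ x => w ((γ : HA x) * h)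
    rw [hw1] at h2
    rw [ENNReal.tsum_mul_right]
    exact (one_mul _).symm.trans (congrArg (· * f h) h2.symm)

/-! ### The class of a point of the adelic orthogonal group -/

theorem act_inv_eq {R : Type} [CommRing R] {g : G R} {x y : M4 R} (h : act g y = x) :
    act g⁻¹ x = y := by
  rw [← h, ← act_mul, inv_mul_cancel, act_one]

/-- The point `h` of `H^x_𝔸` lies over the class `C`: it is `γ k` with `k ∈ G_∞ K_f` and `γ ∈ G_ℚ`
carrying the representative of `C` to `x`. -/
def LiesOver (x : M4 ℚ) (h : HA x) (C : GenusClass x) : Prop :=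
  ∃ γ : G ℚ, ∃ k ∈ GInfKf, act γ (classRep C) = x ∧ (h : G Adele) = ratToG γ * k

/-- If `h = γ k` fixes `x`, then `k` carries `x` to `γ⁻¹ • x`, which is thus in the genus; an
element of `GL_4(ℤ)` corrects `γ` to reach the chosen representative. -/
theorem exists_liesOver {x : M4 ℚ} (hx : (x.map (Rat.castHom ℝ)).PosDef) (h : HA x) :
    ∃ C, LiesOver x h C := by
  obtain ⟨γ, k, hk, hγ⟩ := exists_rat_mul_GInfKf (h : G Adele)
  have hh : act (h : G Adele) (toAdeleMatrix x) = toAdeleMatrix x := h.2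
  have h1 : act k (toAdeleMatrix x) = toAdeleMatrix (act γ⁻¹ x) := by
    have e : k = ratToG γ⁻¹ * h := by rw [hγ, map_inv, inv_mul_cancel_left]
    rw [e, act_mul, hh, act_toAdeleMatrix]
  have hmem : act γ⁻¹ x ∈ genus x := by
    refine ⟨?_, ?_, k, hk, h1⟩
    · rw [act, IsSymm, transpose_mul, transpose_mul, transpose_transpose,
        (isSymm_of_posDef hx).eq, Matrix.mul_assoc]
    · rw [det_act]
      exact (((Matrix.isUnit_iff_isUnit_det _).1 (γ⁻¹ : G ℚ).isUnit).pow 2).mul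
        (det_rat_pos hx).ne'.isUnit
  let C : GenusClass x := Quotient.mk _ ⟨_, hmem⟩
  have hC : classSetoid (classRep C) (act γ⁻¹ x) :=
    Quotient.mk_out (s := classSetoid.comap (Subtype.val : genus x → M4 ℚ)) ⟨_, hmem⟩
  obtain ⟨u, hu⟩ := hC
  refine ⟨C, γ * intToG u, ratToG (intToG u⁻¹) * k,
    mul_mem (ratToG_mem_GInfKf_iff.2 ⟨_, rfl⟩) hk, ?_, ?_⟩
  · rw [act_mul, hu, ← act_mul, mul_inv_cancel, act_one]
  · rw [hγ, map_mul, map_inv, map_inv, mul_assoc, mul_inv_cancel_left]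

/-- Two decompositions of `h` differ by an element of `G_ℚ ∩ G_∞ K_f = GL_4(ℤ)`, which links the two
representatives. -/
theorem LiesOver.unique {x : M4 ℚ} {h : HA x} {C D : GenusClass x} (hC : LiesOver x h C)
    (hD : LiesOver x h D) : C = D := by
  obtain ⟨γ, k, hk, h1, h2⟩ := hC
  obtain ⟨γ', k', hk', h1', h2'⟩ := hD
  have h3 : ratToG (γ'⁻¹ * γ) = k' * k⁻¹ := by
    rw [map_mul, map_inv, inv_mul_eq_iff_eq_mul, ← mul_assoc, ← h2', h2, mul_inv_cancel_right]
  obtain ⟨u, hu⟩ := ratToG_mem_GInfKf_iff.1 (h3 ▸ mul_mem hk' (inv_mem hk))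
  rw [← Quotient.out_eq C, ← Quotient.out_eq D]
  apply Quotient.sound
  refine ⟨u, ?_⟩
  change act (intToG u) (classRep C) = classRep D
  rw [hu, act_mul, h1, act_inv_eq h1']

theorem LiesOver.rat_mul {x : M4 ℚ} {h : HA x} {C : GenusClass x} (hC : LiesOver x h C)
    (γ : HQ x) : LiesOver x ((γ : HA x) * h) C := by
  obtain ⟨γ', k, hk, h1, h2⟩ := hC
  obtain ⟨γ₀, hγ₀⟩ := γ.2
  refine ⟨γ₀ * γ', k, hk, ?_, ?_⟩
  · have h3 : act (ratToG γ₀) (toAdeleMatrix x) = toAdeleMatrix x := by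
      have : ratToG γ₀ = ((γ : HA x) : G Adele) := hγ₀
      rw [this]
      exact (γ : HA x).2
    rw [act_toAdeleMatrix] at h3
    rw [act_mul, h1, toAdeleMatrix_injective h3]
  · rw [Subgroup.coe_mul, h2, map_mul, mul_assoc]
    congr 1
    exact hγ₀.symm

theorem LiesOver.mul {x : M4 ℚ} {h : HA x} {C : GenusClass x} (hC : LiesOver x h C) {u : HA x}
    (hu : u ∈ HCompact x) : LiesOver x (h * u) C := by
  obtain ⟨γ', k, hk, h1, h2⟩ := hC
  exact ⟨γ', k * u, mul_mem hk hu, h1, by rw [Subgroup.coe_mul, h2, mul_assoc]⟩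

/-- The Hasse principle is used here and only here: a member of the genus is rationally equivalent
to `x`, so the adelic element carrying `x` to it can be brought back into `H^x_𝔸` by a rational one.
-/
theorem exists_liesOver_class {x : M4 ℚ} (hx : (x.map (Rat.castHom ℝ)).PosDef)
    (C : GenusClass x) : ∃ h, LiesOver x h C := by
  obtain ⟨-, -, g, hg, h⟩ := (Quotient.out C).2
  have hC : act g (toAdeleMatrix x) = toAdeleMatrix (classRep C) := h
  obtain ⟨γ, hγ⟩ := exists_rat_act_eq hx (posDef_of_mem_genus hx (Quotient.out C).2) h
  have hγ' : act γ⁻¹ (classRep C) = x := act_inv_eq hγ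
  refine ⟨⟨ratToG γ⁻¹ * g, ?_⟩, γ⁻¹, g, hg, hγ', rfl⟩
  change act _ _ = _
  rw [act_mul, hC, act_toAdeleMatrix, hγ']

/-- Points over the same class differ by `H^x_ℚ` and `H^x_𝔸 ∩ G_∞ K_f`. -/
theorem LiesOver.exists_eq {x : M4 ℚ} {h h' : HA x} {C : GenusClass x} (hC : LiesOver x h C)
    (hC' : LiesOver x h' C) : ∃ γ : HQ x, ∃ u ∈ HCompact x, h = γ * h' * u := by
  obtain ⟨γ, k, hk, h1, h2⟩ := hC
  obtain ⟨γ', k', hk', h1', h2'⟩ := hC'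
  have hmem : ratToG (γ * γ'⁻¹) ∈ HA x := by
    change act _ _ = _
    rw [act_toAdeleMatrix, act_mul]
    congr 1
    rw [act_inv_eq h1', h1]
  let δ : HQ x := ⟨⟨_, hmem⟩, ⟨_, rfl⟩⟩
  refine ⟨δ, h'⁻¹ * (δ : HA x)⁻¹ * h, ?_, by group⟩
  change (((h'⁻¹ * (δ : HA x)⁻¹ * h : HA x)) : G Adele) ∈ GInfKf
  have : (((h'⁻¹ * (δ : HA x)⁻¹ * h : HA x)) : G Adele) = k'⁻¹ * k := by
    rw [Subgroup.coe_mul, Subgroup.coe_mul, Subgroup.coe_inv, Subgroup.coe_inv, h2, h2']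
    change (ratToG γ' * k')⁻¹ * (ratToG (γ * γ'⁻¹))⁻¹ * (ratToG γ * k) = _
    rw [map_mul, map_inv]
    group
  rw [this]
  exact mul_mem (inv_mem hk') hk

/-- The number of rational points carrying a point over `C` into a fixed open coset. -/
theorem LiesOver.card_eq {x : M4 ℚ} {h h' : HA x} {C : GenusClass x} (hC : LiesOver x h C)
    (hC' : LiesOver x h' C) :
    Nat.card {γ : HQ x // h'⁻¹ * ((γ : HA x) * h) ∈ HCompact x} = autCard (classRep C) := by
  obtain ⟨γ₀, u, hu, rfl⟩ := hC.exists_eq hC'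
  obtain ⟨γ', k, hk, h1, h2⟩ := hC'
  have hstab : ∀ g : {g : G ℤ // act (intToG g) (classRep C) = classRep C},
      ratToG (γ' * intToG g.1 * γ'⁻¹) ∈ HA x := by
    intro g
    change act _ _ = _
    rw [act_toAdeleMatrix]
    congr 1
    rw [act_mul, act_inv_eq h1, act_mul, g.2, h1]
  -- Conjugation by `γ'` carries integral automorphisms of the representative into `H^x_ℚ`; the
  -- translation by `γ₀⁻¹` accounts for the relative position of the two points.
  let δ : {g : G ℤ // act (intToG g) (classRep C) = classRep C} → HQ x :=
    fun g => ⟨⟨_, hstab g⟩, ⟨_, rfl⟩⟩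
  have hδ : ∀ g, (((δ g : HQ x) : HA x) : G Adele) = ratToG (γ' * intToG g.1 * γ'⁻¹) :=
    fun g => rfl
  symm
  refine Nat.card_eq_of_bijective (fun g => ⟨δ g * γ₀⁻¹, ?_⟩) ⟨?_, ?_⟩
  · change ((_ : HA x) : G Adele) ∈ GInfKf
    have : ((h'⁻¹ * (((δ g * γ₀⁻¹ : HQ x) : HA x) * ((γ₀ : HA x) * h' * u)) : HA x) : G Adele)
        = k⁻¹ * ratToG (intToG g.1) * k * u := by
      rw [Subgroup.coe_mul (HQ x), Subgroup.coe_inv (HQ x)]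
      have e : h'⁻¹ * (((δ g : HQ x) : HA x) * (γ₀ : HA x)⁻¹ * ((γ₀ : HA x) * h' * u))
          = h'⁻¹ * ((δ g : HQ x) : HA x) * h' * u := by group
      rw [e, Subgroup.coe_mul, Subgroup.coe_mul, Subgroup.coe_mul, Subgroup.coe_inv, hδ, h2,
        map_mul, map_mul, map_inv]
      group
    rw [this]
    exact mul_mem (mul_mem (mul_mem (inv_mem hk) (ratToG_mem_GInfKf_iff.2 ⟨_, rfl⟩)) hk) hu
  · intro g g' hg
    have h3 : δ g = δ g' := mul_right_cancel (Subtype.mk.inj hg)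
    have h4 : ratToG (γ' * intToG g.1 * γ'⁻¹) = ratToG (γ' * intToG g'.1 * γ'⁻¹) := by
      rw [← hδ, ← hδ, h3]
    apply Subtype.ext
    apply Units.ext
    ext i j
    have h5 : Function.Injective (ratToG) := by
      intro a b hab
      apply Units.ext
      ext i j
      have := congrArg (fun z : G Adele => ((z : M4 Adele) i j).1) hab
      exact Rat.cast_injective (α := ℝ) this
    have h6 := mul_left_cancel (mul_right_cancel (h5 h4))
    have h7 := congrArg (fun z : G ℚ => (z : M4 ℚ) i j) h6
    exact Int.cast_injective (α := ℚ) h7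
  · rintro ⟨γ, hγ⟩
    obtain ⟨γ₁, hγ₁⟩ := (γ * γ₀).2
    have hγ₁' : ratToG γ₁ = (((γ * γ₀ : HQ x) : HA x) : G Adele) := hγ₁
    have h3 : ratToG (γ'⁻¹ * γ₁ * γ') ∈ GInfKf := by
      have h4 : ((h'⁻¹ * ((γ : HA x) * ((γ₀ : HA x) * h' * u)) : HA x) : G Adele) ∈ GInfKf := hγ
      have h5 : ratToG (γ'⁻¹ * γ₁ * γ') = k *
          ((h'⁻¹ * ((γ : HA x) * ((γ₀ : HA x) * h' * u)) : HA x) : G Adele) * (u : G Adele)⁻¹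
            * k⁻¹ := by
        have e : h'⁻¹ * ((γ : HA x) * ((γ₀ : HA x) * h' * u))
            = h'⁻¹ * (((γ * γ₀ : HQ x) : HA x)) * h' * u := by
          rw [Subgroup.coe_mul]; group
        rw [e, Subgroup.coe_mul, Subgroup.coe_mul, Subgroup.coe_mul, Subgroup.coe_inv, ← hγ₁', h2,
          map_mul, map_mul, map_inv]
        group
      rw [h5]
      exact mul_mem (mul_mem (mul_mem hk h4) (inv_mem hu)) (inv_mem hk)
    obtain ⟨g, hg⟩ := ratToG_mem_GInfKf_iff.1 h3
    have hγ₁x : act γ₁ x = x := by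
      apply toAdeleMatrix_injective
      rw [← act_toAdeleMatrix, hγ₁']
      exact ((γ * γ₀ : HQ x) : HA x).2
    refine ⟨⟨g, ?_⟩, ?_⟩
    · rw [hg, act_mul, act_mul, h1, hγ₁x, act_inv_eq h1]
    · apply Subtype.ext
      change δ _ * γ₀⁻¹ = γ
      rw [mul_inv_eq_iff_eq_mul]
      apply Subtype.ext
      apply Subtype.ext
      rw [hδ, ← hγ₁']
      change ratToG (γ' * intToG g * γ'⁻¹) = _
      rw [hg]
      congr 1
      group

end

section


/-! ### Integration of functions of the genus class -/

open Matrix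

/-- Such a set is a union of left cosets of the open subgroup `HCompact x`. -/
theorem isOpen_of_mul_mem_HCompact {x : M4 ℚ} {S : Set (HA x)}
    (hS : ∀ s ∈ S, ∀ u ∈ HCompact x, s * u ∈ S) : IsOpen S := by
  rw [isOpen_iff_mem_nhds]
  intro s hs
  have h1 : IsOpen ((fun t : HA x => s⁻¹ * t) ⁻¹' HCompact x) :=
    (isOpen_HCompact x).preimage (continuous_const_mul _)
  refine mem_of_superset (h1.mem_nhds ?_) fun t ht => ?_
  · rw [Set.mem_preimage, inv_mul_cancel]
    exact one_mem GInfKf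
  · have := hS s hs _ ht
    rwa [mul_inv_cancel_left] at this

theorem mul_mem_HCompact_iff {x : M4 ℚ} {h u : HA x} (hu : u ∈ HCompact x) :
    h * u ∈ HCompact x ↔ h ∈ HCompact x :=
  Subgroup.mul_mem_cancel_right (GInfKf.subgroupOf (HA x)) (Subgroup.mem_subgroupOf.2 hu)

/-- The class over which a point of `H^x_𝔸` lies. -/
def classOf {x : M4 ℚ} (hx : (x.map (Rat.castHom ℝ)).PosDef) (h : HA x) : GenusClass x :=
  (exists_liesOver hx h).choose

theorem classOf_eq_iff {x : M4 ℚ} {hx : (x.map (Rat.castHom ℝ)).PosDef} {h : HA x}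
    {C : GenusClass x} : classOf hx h = C ↔ LiesOver x h C := by
  have h1 : LiesOver x h (classOf hx h) := (exists_liesOver hx h).choose_spec
  exact ⟨fun h2 => h2 ▸ h1, fun h2 => h1.unique h2⟩

theorem liesOver_classOf {x : M4 ℚ} (hx : (x.map (Rat.castHom ℝ)).PosDef) (h : HA x) :
    LiesOver x h (classOf hx h) := classOf_eq_iff.1 rfl

/-- A point of `H^x_𝔸` over a given class. -/
def basePoint {x : M4 ℚ} (hx : (x.map (Rat.castHom ℝ)).PosDef) (C : GenusClass x) : HA x :=
  (exists_liesOver_class hx C).choose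

theorem liesOver_basePoint {x : M4 ℚ} (hx : (x.map (Rat.castHom ℝ)).PosDef) (C : GenusClass x) :
    LiesOver x (basePoint hx C) C := (exists_liesOver_class hx C).choose_spec

open Classical in
/-- A weight on `H^x_𝔸` with sum one over every orbit of `H^x_ℚ`. -/
def orbitWeight {x : M4 ℚ} (hx : (x.map (Rat.castHom ℝ)).PosDef) (h : HA x) : ℝ≥0∞ :=
  if (basePoint hx (classOf hx h))⁻¹ * h ∈ HCompact x then
    (autCard (classRep (classOf hx h)) : ℝ≥0∞)⁻¹ else 0

open Classical in
theorem orbitWeight_mul {x : M4 ℚ} (hx : (x.map (Rat.castHom ℝ)).PosDef) (h : HA x) {u : HA x}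
    (hu : u ∈ HCompact x) : orbitWeight hx (h * u) = orbitWeight hx h := by
  have h1 : classOf hx (h * u) = classOf hx h := classOf_eq_iff.2 ((liesOver_classOf hx h).mul hu)
  rw [orbitWeight, orbitWeight, h1, ← mul_assoc]
  exact if_congr (mul_mem_HCompact_iff hu) rfl rfl

theorem autCard_pos {x : M4 ℚ} {θ : G ℝ} (hθ : act θ 1 = x.map (Rat.castHom ℝ))
    (C : GenusClass x) : 0 < autCard (classRep C) := by
  obtain ⟨-, -, g, -, h⟩ := (Quotient.out C).2
  have h1 : act (atReal g * θ) 1 = (classRep C).map (Rat.castHom ℝ) := by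
    rw [act_mul, hθ]
    exact act_real_of_act_adele h
  have := finite_aut h1
  have : Nonempty {g : G ℤ // act (intToG g) (classRep C) = classRep C} :=
    ⟨1, by rw [map_one, act_one]⟩
  exact Nat.card_pos

/-- By `LiesOver.card_eq`, exactly `ε` rational points carry `h` into the coset of the base point of
its class, and each contributes `ε⁻¹`. -/
theorem tsum_orbitWeight {x : M4 ℚ} (hx : (x.map (Rat.castHom ℝ)).PosDef) {θ : G ℝ}
    (hθ : act θ 1 = x.map (Rat.castHom ℝ)) (h : HA x) :
    ∑' γ : HQ x, orbitWeight hx ((γ : HA x) * h) = 1 := by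
  classical
  set C := classOf hx h
  have hC : ∀ γ : HQ x, classOf hx ((γ : HA x) * h) = C := fun γ =>
    classOf_eq_iff.2 ((liesOver_classOf hx h).rat_mul γ)
  let S : Set (HQ x) := {γ | (basePoint hx C)⁻¹ * ((γ : HA x) * h) ∈ HCompact x}
  have h1 : ∀ γ : HQ x, orbitWeight hx ((γ : HA x) * h)
      = S.indicator (fun _ => (autCard (classRep C) : ℝ≥0∞)⁻¹) γ := by
    intro γ
    rw [orbitWeight, hC, Set.indicator_apply]
    rfl
  have h2 : Nat.card S = autCard (classRep C) :=
    (liesOver_classOf hx h).card_eq (liesOver_basePoint hx C)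
  have h3 := autCard_pos hθ C
  have : Finite S := Nat.finite_of_card_ne_zero (by omega)
  have : Fintype S := Fintype.ofFinite S
  rw [tsum_congr h1, ← tsum_subtype, tsum_fintype, Finset.sum_const, Finset.card_univ,
    ← Nat.card_eq_fintype_card, h2, nsmul_eq_mul]
  exact ENNReal.mul_inv_cancel (by exact_mod_cast h3.ne') (ENNReal.natCast_ne_top _)

/-- The points of `H^x_ℚ \ H^x_𝔸` over a class. -/
def classFiber (x : M4 ℚ) (C : GenusClass x) : Set (HQuot x) := {q | LiesOver x (Quotient.out q) C}

theorem preimage_classFiber {x : M4 ℚ} (C : GenusClass x) :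
    toHQuot ⁻¹' classFiber x C = {h | LiesOver x h C} := by
  ext h
  obtain ⟨γ, hγ⟩ := exists_out_toHQuot h
  rw [Set.mem_preimage, classFiber, Set.mem_ofPred_eq, hγ, Set.mem_ofPred_eq]
  refine ⟨fun h1 => ?_, fun h1 => h1.rat_mul γ⟩
  have := h1.rat_mul γ⁻¹
  rwa [Subgroup.coe_inv, inv_mul_cancel_left] at this

variable {x : M4 ℚ} [MeasurableSpace (HA x)] [BorelSpace (HA x)]

/-- The weight is right invariant under an open subgroup, so every preimage is open. -/
theorem measurable_orbitWeight (hx : (x.map (Rat.castHom ℝ)).PosDef) :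
    Measurable (orbitWeight hx) := fun S _ =>
  (isOpen_of_mul_mem_HCompact fun s hs u hu => by
    rwa [Set.mem_preimage, orbitWeight_mul hx s hu]).measurableSet

theorem existsUnique_isQuotientMeasure (hx : (x.map (Rat.castHom ℝ)).PosDef) {θ : G ℝ}
    (hθ : act θ 1 = x.map (Rat.castHom ℝ)) (vol : Measure (HA x)) [vol.IsMulLeftInvariant] :
    ∃! ν : Measure (HQuot x), IsQuotientMeasure x vol ν :=
  ⟨_, (isQuotientMeasure_iff vol (measurable_orbitWeight hx) (tsum_orbitWeight hx hθ) _).2 rfl,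
    fun _ => (isQuotientMeasure_iff vol (measurable_orbitWeight hx) (tsum_orbitWeight hx hθ) _).1⟩

theorem measurableSet_classFiber (C : GenusClass x) : MeasurableSet (classFiber x C) := by
  refine measurableSet_quotient.2 ?_
  change MeasurableSet (toHQuot ⁻¹' classFiber x C)
  rw [preimage_classFiber]
  exact (isOpen_of_mul_mem_HCompact (S := {h | LiesOver x h C})
    fun s hs u hu => LiesOver.mul hs hu).measurableSet

/-- Over `C` the weight is `ε⁻¹` on the single left coset of `HCompact x` through the base point and
zero elsewhere; by left invariance the coset has the volume of `HCompact x`. -/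
theorem quotientMeasure_classFiber (hx : (x.map (Rat.castHom ℝ)).PosDef) {θ : G ℝ}
    (hθ : act θ 1 = x.map (Rat.castHom ℝ)) {vol : Measure (HA x)} [vol.IsMulLeftInvariant]
    {ν : Measure (HQuot x)} (hν : IsQuotientMeasure x vol ν) (C : GenusClass x) :
    ν (classFiber x C) = (autCard (classRep C) : ℝ≥0∞)⁻¹ * vol (HCompact x) := by
  classical
  rw [(isQuotientMeasure_iff vol (measurable_orbitWeight hx) (tsum_orbitWeight hx hθ) _).1 hν,
    Measure.map_apply measurable_toHQuot (measurableSet_classFiber C),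
    withDensity_apply _ (measurable_toHQuot (measurableSet_classFiber C)),
    ← lintegral_indicator (measurable_toHQuot (measurableSet_classFiber C)), preimage_classFiber]
  have hU : MeasurableSet ((fun h : HA x => (basePoint hx C)⁻¹ * h) ⁻¹' HCompact x) :=
    ((isOpen_HCompact x).preimage (continuous_const_mul _)).measurableSet
  have h1 : Set.indicator {h | LiesOver x h C} (orbitWeight hx)
      = Set.indicator ((fun h : HA x => (basePoint hx C)⁻¹ * h) ⁻¹' HCompact x)
        fun _ => (autCard (classRep C) : ℝ≥0∞)⁻¹ := by
    funext h
    by_cases hh : LiesOver x h C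
    · rw [Set.indicator_of_mem (show h ∈ {h | LiesOver x h C} from hh), orbitWeight,
        classOf_eq_iff.2 hh, Set.indicator_apply]
      rfl
    · rw [Set.indicator_of_notMem (show h ∉ {h | LiesOver x h C} from hh),
        Set.indicator_of_notMem]
      intro h2
      apply hh
      have := (liesOver_basePoint hx C).mul h2
      rwa [mul_inv_cancel_left] at this
  rw [h1, lintegral_indicator_const hU, measure_preimage_mul]

/-- The integrand is a step function on the finitely many class fibres, whose measures are finite
because `HCompact x` is compact. -/
theorem integrable_and_integral_of_liesOver [Fintype (GenusClass x)]
    (hx : (x.map (Rat.castHom ℝ)).PosDef) {θ : G ℝ} (hθ : act θ 1 = x.map (Rat.castHom ℝ))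
    {vol : Measure (HA x)} [vol.IsHaarMeasure] {ν : Measure (HQuot x)}
    (hν : IsQuotientMeasure x vol ν) {φ : HQuot x → ℂ} {f : GenusClass x → ℂ}
    (hφ : ∀ q C, LiesOver x (Quotient.out q) C → φ q = f C) :
    Integrable φ ν ∧ ∫ q, φ q ∂ν =
      ((vol (HCompact x)).toReal : ℂ) * ∑ C, (autCard (classRep C) : ℂ)⁻¹ * f C := by
  classical
  have hfin : ∀ C, ν (classFiber x C) ≠ ∞ := by
    intro C
    rw [quotientMeasure_classFiber hx hθ hν]
    exact ENNReal.mul_ne_top (ENNReal.inv_ne_top.2 (by exact_mod_cast (autCard_pos hθ C).ne'))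
      (isCompact_HCompact hθ).measure_lt_top.ne
  have h1 : φ = fun q => ∑ C, (classFiber x C).indicator (fun _ => f C) q := by
    funext q
    have hq := liesOver_classOf hx (Quotient.out q)
    rw [Finset.sum_eq_single (classOf hx (Quotient.out q)), Set.indicator_of_mem, hφ q _ hq]
    · exact hq
    · intro C _ hC
      rw [Set.indicator_of_notMem]
      intro h2
      exact hC (LiesOver.unique h2 hq)
    · intro h2
      exact (h2 (Finset.mem_univ _)).elim
  have h2 : ∀ C ∈ Finset.univ, Integrable ((classFiber x C).indicator fun _ => f C) ν :=
    fun C _ => (integrable_indicator_iff (measurableSet_classFiber C)).2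
      (integrableOn_const (hfin C))
  rw [h1]
  refine ⟨integrable_finsetSum _ h2, ?_⟩
  rw [integral_finsetSum _ h2, Finset.mul_sum]
  refine Finset.sum_congr rfl fun C _ => ?_
  rw [integral_indicator_const _ (measurableSet_classFiber C), Measure.real,
    quotientMeasure_classFiber hx hθ hν, ENNReal.toReal_mul, ENNReal.toReal_inv,
    ENNReal.toReal_natCast, Complex.real_smul]
  push_cast
  ring

end

section


/-! ### Eisenstein series as Dirichlet series -/

open Matrix

theorem posDef_of_act_one {y : M4 ℚ} {θ : G ℝ} (hθ : act θ 1 = y.map (Rat.castHom ℝ)) :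
    (y.map (Rat.castHom ℝ)).PosDef := hθ ▸ posDef_act_one θ

theorem summable_flagValue_rat {y : M4 ℚ} {θ : G ℝ} (hθ : act θ 1 = y.map (Rat.castHom ℝ)) {s : ℂ}
    (hs : 3 < s.re) :
    Summable fun q => ((flagValue (y.map (Rat.castHom ℝ)) q : ℝ) : ℂ) ^ (-s) :=
  hθ ▸ summable_flagValue θ hs

theorem hasSum_ZP {y : M4 ℚ} {θ : G ℝ} (hθ : act θ 1 = y.map (Rat.castHom ℝ)) {M : ℕ}
    (hM0 : 0 < M) (hM : ∀ i j, ∃ m : ℤ, (M : ℚ) * y i j = m) {s : ℂ} (hs : 3 < s.re) :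
    HasSum (dirichletTerm (fun k => (rP y k : ℂ)) (M ^ 2) s) (ZP (M ^ 2) y s) :=
  (hasSum_dirichletTerm (posDef_of_act_one hθ) hM0 hM (summable_flagValue_rat hθ hs)).summable.hasSum

theorem ZP_eq_tsum {y : M4 ℚ} {θ : G ℝ} (hθ : act θ 1 = y.map (Rat.castHom ℝ)) {M : ℕ}
    (hM0 : 0 < M) (hM : ∀ i j, ∃ m : ℤ, (M : ℚ) * y i j = m) {s : ℂ} (hs : 3 < s.re) :
    ZP (M ^ 2) y s = ∑' q, ((flagValue (y.map (Rat.castHom ℝ)) q : ℝ) : ℂ) ^ (-s) :=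
  (hasSum_dirichletTerm (posDef_of_act_one hθ) hM0 hM (summable_flagValue_rat hθ hs)).tsum_eq

/-- The determinant of `y` is the square of `|det θ|`, and powers of positive reals multiply without
branch problems. -/
theorem cpow_abs_det {y : M4 ℚ} {θ : G ℝ} (hθ : act θ 1 = y.map (Rat.castHom ℝ)) (s : ℂ) :
    ((|(θ : M4 ℝ).det| : ℝ) : ℂ) ^ s = (y.det : ℂ) ^ (s / 2) := by
  have h1 : ((y.det : ℚ) : ℝ) = |(θ : M4 ℝ).det| * |(θ : M4 ℝ).det| := by
    have h2 := congrArg det hθ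
    rw [det_act, det_one, mul_one, show (y.map (Rat.castHom ℝ)).det = ((y.det : ℚ) : ℝ) from
      ((Rat.castHom ℝ).map_det y).symm] at h2
    rw [abs_mul_abs_self, ← h2, sq]
  have h3 : (y.det : ℂ) = ((|(θ : M4 ℝ).det| : ℝ) : ℂ) * ((|(θ : M4 ℝ).det| : ℝ) : ℂ) := by
    rw [← Complex.ofReal_mul, ← h1, Complex.ofReal_ratCast]
  have h4 : ((|(θ : M4 ℝ).det| : ℝ) : ℂ) ≠ 0 := by
    have : (θ : M4 ℝ).det ≠ 0 := ((Matrix.isUnit_iff_isUnit_det _).1 θ.isUnit).ne_zero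
    exact_mod_cast abs_ne_zero.2 this
  rw [h3, Complex.mul_cpow_ofReal_nonneg (abs_nonneg _) (abs_nonneg _), ← Complex.cpow_add _ _ h4,
    add_halves]

theorem eisenstein_eq_ZP {μ : ℂ × ℂ} (hμ : μ.1 + μ.2 = 0) (hc : 4 < (μ.1 - μ.2).re) (γ : G ℚ)
    {k : G Adele} (hk : k ∈ GInfKf) {y : M4 ℚ}
    (h : act (atReal k) 1 = y.map (Rat.castHom ℝ)) {M : ℕ} (hM0 : 0 < M)
    (hM : ∀ i j, ∃ m : ℤ, (M : ℚ) * y i j = m) :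
    eisenstein (ratToG γ * k) μ = (y.det : ℂ) ^ ((μ.1 + 1) / 2) *
      ZP (M ^ 2) y ((μ.1 - μ.2 + 2) / 2) := by
  have h1 : μ.2 = -μ.1 := by linear_combination hμ
  have h2 : (μ.1 - μ.2 + 2) / 2 = μ.1 + 1 := by rw [h1]; ring
  have h3 : 3 < (μ.1 + 1).re := by
    rw [h1, sub_neg_eq_add, Complex.add_re] at hc
    rw [Complex.add_re, Complex.one_re]
    linarith
  rw [eisenstein_rat_mul hμ γ hk, h, h2, ZP_eq_tsum h hM0 hM h3, cpow_abs_det h]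

/-- No convergence is assumed: both sides are the same factor times the same `tsum`. The two
functions of `z` therefore agree everywhere, which lets their continuations be identified. -/
theorem eisenstein_congr {μ : ℂ × ℂ} (hμ : μ.1 + μ.2 = 0) (γ : G ℚ) {k : G Adele}
    (hk : k ∈ GInfKf) {θ : G ℝ} {y : M4 ℚ} (h : act (atReal k) 1 = y.map (Rat.castHom ℝ))
    (hθ : act θ 1 = y.map (Rat.castHom ℝ)) :
    eisenstein (ratToG γ * k) μ = eisenstein (realToG θ) μ := by
  have h1 := eisenstein_rat_mul hμ 1 (realToG_mem_GInfKf θ)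
  rw [map_one, one_mul, atReal_realToG] at h1
  rw [h1, eisenstein_rat_mul hμ γ hk, h, hθ, cpow_abs_det h, cpow_abs_det hθ]

theorem LiesOver.periodPoint_eq {x : M4 ℚ} {θ : G ℝ} (hθ : act θ 1 = x.map (Rat.castHom ℝ))
    {q : HQuot x} {C : GenusClass x} (hq : LiesOver x (Quotient.out q) C) :
    ∃ γ : G ℚ, ∃ k ∈ GInfKf, periodPoint x θ q = ratToG γ * k ∧
      act (atReal k) 1 = (classRep C).map (Rat.castHom ℝ) := by
  obtain ⟨γ, k, hk, h1, h2⟩ := hq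
  refine ⟨γ, k * realToG θ, mul_mem hk (realToG_mem_GInfKf θ), ?_, ?_⟩
  · rw [periodPoint, h2, mul_assoc]
  · rw [map_mul, atReal_realToG, act_mul, hθ]
    apply act_real_of_act_adele
    have h3 : act ((Quotient.out q : HA x) : G Adele) (toAdeleMatrix x) = toAdeleMatrix x :=
      (Quotient.out q : HA x).2
    rw [h2, act_mul] at h3
    rw [← act_inv_eq h3, ← map_inv, act_toAdeleMatrix, act_inv_eq h1]

theorem exists_act_one_eq_classRep {x : M4 ℚ} {θ : G ℝ} (hθ : act θ 1 = x.map (Rat.castHom ℝ))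
    (C : GenusClass x) : ∃ θ' : G ℝ, act θ' 1 = (classRep C).map (Rat.castHom ℝ) := by
  obtain ⟨-, -, g, -, h⟩ := (Quotient.out C).2
  refine ⟨atReal g * θ, ?_⟩
  rw [act_mul, hθ]
  exact act_real_of_act_adele h

theorem hasSum_ZPGen {x : M4 ℚ} [Fintype (GenusClass x)] {θ : G ℝ}
    (hθ : act θ 1 = x.map (Rat.castHom ℝ)) {M : ℕ} (hM0 : 0 < M)
    (hM : ∀ i j, ∃ m : ℤ, (M : ℚ) * x i j = m) {s : ℂ} (hs : 3 < s.re) :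
    HasSum (dirichletTerm (fun k => (rPGen x k : ℂ)) (M ^ 2) s)
      (∑ C : GenusClass x, (autCard (classRep C) : ℂ)⁻¹ * ZP (M ^ 2) (classRep C) s) := by
  have h1 : dirichletTerm (fun k => (rPGen x k : ℂ)) (M ^ 2) s = fun n =>
      ∑ C : GenusClass x, (autCard (classRep C) : ℂ)⁻¹ *
        dirichletTerm (fun k => (rP (classRep C) k : ℂ)) (M ^ 2) s n := by
    funext n
    simp only [dirichletTerm, rPGen, finsum_eq_sum_of_fintype]
    push_cast
    rw [Finset.sum_div]
    exact Finset.sum_congr rfl fun C _ => by rw [mul_div_assoc]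
  rw [h1]
  refine hasSum_sum fun C _ => HasSum.mul_left _ ?_
  obtain ⟨θ', hθ'⟩ := exists_act_one_eq_classRep hθ C
  exact hasSum_ZP hθ' hM0 (integral_of_mem_genus hM (Quotient.out C).2) hs

theorem ZPGen_eq_sum {x : M4 ℚ} [Fintype (GenusClass x)] {θ : G ℝ}
    (hθ : act θ 1 = x.map (Rat.castHom ℝ)) {M : ℕ} (hM0 : 0 < M)
    (hM : ∀ i j, ∃ m : ℤ, (M : ℚ) * x i j = m) {s : ℂ} (hs : 3 < s.re) :
    ZPGen (M ^ 2) x s =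
      ∑ C : GenusClass x, (autCard (classRep C) : ℂ)⁻¹ * ZP (M ^ 2) (classRep C) s :=
  (hasSum_ZPGen hθ hM0 hM hs).tsum_eq

/-! ### Analyticity and continuation of the Dirichlet series -/

/-- The values of the form may lie on either side of one, so on the strip `a < Re w < b` a term is
dominated by the sum of its absolute values at `a` and at `b`. -/
theorem analyticAt_ZP {y : M4 ℚ} {θ : G ℝ} (hθ : act θ 1 = y.map (Rat.castHom ℝ)) {M : ℕ}
    (hM0 : 0 < M) (hM : ∀ i j, ∃ m : ℤ, (M : ℚ) * y i j = m) {s : ℂ} (hs : 3 < s.re) :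
    AnalyticAt ℂ (ZP (M ^ 2) y) s := by
  obtain ⟨a, ha3, has⟩ := exists_between hs
  set b := s.re + 1
  let U : Set ℂ := {w | a < w.re ∧ w.re < b}
  have hU : IsOpen U :=
    (isOpen_lt continuous_const Complex.continuous_re).inter
      (isOpen_lt Complex.continuous_re continuous_const)
  have hsU : s ∈ U := ⟨has, by simp [b]⟩
  have hpos := fun q => flagValue_pos (posDef_of_act_one hθ) q
  have hsum : ∀ r : ℝ, 3 < r →
      Summable fun q => flagValue (y.map (Rat.castHom ℝ)) q ^ (-r) := by
    intro r hr
    have h1 := (summable_flagValue_rat hθ (s := (r : ℂ)) (by simpa using hr)).norm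
    refine h1.congr fun q => ?_
    rw [Complex.norm_cpow_eq_rpow_re_of_pos (hpos q), Complex.neg_re, Complex.ofReal_re]
  have hb3 : 3 < b := by simp only [b]; linarith
  have hd : DifferentiableOn ℂ
      (fun w => ∑' q, ((flagValue (y.map (Rat.castHom ℝ)) q : ℝ) : ℂ) ^ (-w)) U := by
    refine Complex.differentiableOn_tsum_of_summable_norm ((hsum a ha3).add (hsum b hb3)) (fun q => ?_) hU
      fun q w hw => ?_
    · refine DifferentiableOn.const_cpow differentiableOn_id.neg (Or.inl ?_)
      exact_mod_cast (hpos q).ne'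
    · rw [Complex.norm_cpow_eq_rpow_re_of_pos (hpos q), Complex.neg_re]
      rcases le_total 1 (flagValue (y.map (Rat.castHom ℝ)) q) with h1 | h1
      · have h2 := Real.rpow_le_rpow_of_exponent_le h1 (neg_le_neg hw.1.le)
        have h3 := Real.rpow_nonneg (hpos q).le (-b)
        linarith
      · have h2 := Real.rpow_le_rpow_of_exponent_ge (hpos q) h1 (neg_le_neg hw.2.le)
        have h3 := Real.rpow_nonneg (hpos q).le (-a)
        linarith
  refine (hd.analyticAt (hU.mem_nhds hsU)).congr ?_
  filter_upwards [hU.mem_nhds hsU] with w hw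
  exact (ZP_eq_tsum hθ hM0 hM (ha3.trans hw.1)).symm

theorem eventually_codiscrete_iff {P : ℂ → Prop} :
    (∀ᶠ z in codiscrete ℂ, P z) ↔ ∀ z, ∀ᶠ w in nhdsWithin z {z}ᶜ, P w := by
  change {z | P z} ∈ codiscrete ℂ ↔ _
  rw [mem_codiscrete]
  refine forall_congr' fun z => ?_
  rw [disjoint_principal_right, compl_compl]
  rfl

theorem eventually_codiscrete_add {P : ℂ → Prop} (h : ∀ᶠ z in codiscrete ℂ, P z) (a : ℂ) :
    ∀ᶠ z in codiscrete ℂ, P (z + a) := by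
  rw [eventually_codiscrete_iff] at h ⊢
  intro z
  have h1 : Tendsto (fun w => w + a) (nhdsWithin z {z}ᶜ) (nhdsWithin (z + a) {z + a}ᶜ) := by
    refine tendsto_nhdsWithin_of_tendsto_nhds_of_eventually_within _ ?_ ?_
    · exact ((continuous_add_const a).tendsto z).mono_left nhdsWithin_le_nhds
    · filter_upwards [self_mem_nhdsWithin] with w hw h2
      exact hw (add_right_cancel h2)
  exact h1.eventually (h (z + a))

/-- A meromorphic function that agrees on a half-plane with an analytic function yields its
meromorphic continuation, after correction on a discrete set. -/
theorem isMeromorphicContinuation_toMeromorphicNFOn {f F : ℂ → ℂ} (hf : MeromorphicOn f Set.univ)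
    {c : ℝ} (hF : ∀ z : ℂ, c < z.re → AnalyticAt ℂ F z) (hfF : ∀ z : ℂ, c < z.re → f z = F z) :
    IsMeromorphicContinuation F (toMeromorphicNFOn f Set.univ) := by
  refine ⟨meromorphicNFOn_toMeromorphicNFOn f Set.univ, c, fun z hz => ?_⟩
  have hopen : IsOpen {w : ℂ | c < w.re} := isOpen_lt continuous_const Complex.continuous_re
  have h1 : toMeromorphicNFOn f Set.univ =ᶠ[nhdsWithin z {z}ᶜ] F := by
    refine (hf.toMeromorphicNFOn_eq_self_on_nhdsNE (Set.mem_univ z)).trans ?_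
    filter_upwards [nhdsWithin_le_nhds (hopen.mem_nhds hz)] with w hw
    exact hfF w hw
  exact (((meromorphicNFOn_toMeromorphicNFOn f Set.univ
    (Set.mem_univ z)).eventuallyEq_nhdsNE_iff_eventuallyEq_nhds (hF z hz).meromorphicNFAt).1
      h1).eq_of_nhds

/-- Meromorphic continuations are unique. -/
theorem IsMeromorphicContinuation.unique {f F F' : ℂ → ℂ} (hF : IsMeromorphicContinuation f F)
    (hF' : IsMeromorphicContinuation f F') : F = F' := by
  obtain ⟨h1, c, hc⟩ := hF
  obtain ⟨h1', c', hc'⟩ := hF'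
  have hm : MeromorphicOn (F - F') Set.univ := h1.meromorphicOn.sub h1'.meromorphicOn
  let z₀ : ℂ := ((max c c' + 1 : ℝ) : ℂ)
  have hopen : IsOpen {w : ℂ | max c c' < w.re} := isOpen_lt continuous_const Complex.continuous_re
  have htop : meromorphicOrderAt (F - F') z₀ = ⊤ := by
    rw [meromorphicOrderAt_eq_top_iff]
    filter_upwards [nhdsWithin_le_nhds (hopen.mem_nhds (show max c c' < z₀.re by simp [z₀]))]
      with w hw
    rw [Pi.sub_apply, hc w ((le_max_left _ _).trans_lt hw), hc' w ((le_max_right _ _).trans_lt hw),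
      sub_self]
  funext z
  -- Identity principle: infinite order at one point spreads over the connected plane, and the
  -- normal form then upgrades equality on punctured neighbourhoods to equality.
  have hz : meromorphicOrderAt (F - F') z = ⊤ := by
    by_contra hne
    exact hm.meromorphicOrderAt_ne_top_of_isPreconnected isPreconnected_univ (Set.mem_univ z)
      (Set.mem_univ z₀) hne htop
  rw [meromorphicOrderAt_eq_top_iff] at hz
  have h2 : F =ᶠ[nhdsWithin z {z}ᶜ] F' := by
    filter_upwards [hz] with w hw
    exact sub_eq_zero.1 hw
  exact (((h1 (Set.mem_univ z)).eventuallyEq_nhdsNE_iff_eventuallyEq_nhds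
    (h1' (Set.mem_univ z))).1 h2).eq_of_nhds

/-- Polarization shows that `2 x` has integral entries when the form takes integral values, which
gives `M = 2` and `N = 4`. -/
theorem exists_scale {N : ℕ} {x : M4 ℚ} (hx : (x.map (Rat.castHom ℝ)).PosDef)
    (h : (N = 1 ∧ ∀ i j, ∃ m : ℤ, x i j = (m : ℚ)) ∨ (N = 4 ∧ IntegralForm x)) :
    ∃ M : ℕ, 0 < M ∧ N = M ^ 2 ∧ ∀ i j, ∃ m : ℤ, (M : ℚ) * x i j = m := by
  rcases h with ⟨rfl, h⟩ | ⟨rfl, h⟩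
  · exact ⟨1, one_pos, rfl, fun i j => by simpa using h i j⟩
  · refine ⟨2, two_pos, rfl, fun i j => ?_⟩
    have hs := (isSymm_of_posDef hx).apply i j
    obtain ⟨a, ha⟩ := h (Pi.single i 1 + Pi.single j 1)
    obtain ⟨b, hb⟩ := h (Pi.single i 1)
    obtain ⟨c, hc⟩ := h (Pi.single j 1)
    have e : ∀ l : Fin 4, (fun t => (((Pi.single l 1 : Fin 4 → ℤ) t : ℤ) : ℚ)) = Pi.single l 1 := by
      intro l
      ext t
      by_cases ht : t = l
      · subst ht; simp
      · simp [ht]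
    have e2 : (fun t => (((Pi.single i 1 + Pi.single j 1 : Fin 4 → ℤ) t : ℤ) : ℚ))
        = Pi.single i 1 + Pi.single j 1 := by
      rw [← e i, ← e j]
      ext t
      simp
    rw [e2] at ha
    rw [e] at hb hc
    simp only [mulVec_add, add_dotProduct, dotProduct_add, mulVec_single_one,
      single_one_dotProduct, col_apply] at ha hb hc
    refine ⟨a - b - c, ?_⟩
    push_cast
    linarith

end

section


/-! ### The identities -/

open Matrix

theorem eisenstein_realToG_eq_ZP {μ : ℂ × ℂ} (hμ : μ.1 + μ.2 = 0) (hc : 4 < (μ.1 - μ.2).re)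
    {θ : G ℝ} {y : M4 ℚ} (hθ : act θ 1 = y.map (Rat.castHom ℝ)) {M : ℕ} (hM0 : 0 < M)
    (hM : ∀ i j, ∃ m : ℤ, (M : ℚ) * y i j = m) :
    eisenstein (realToG θ) μ = (y.det : ℂ) ^ ((μ.1 + 1) / 2) *
      ZP (M ^ 2) y ((μ.1 - μ.2 + 2) / 2) := by
  have h := eisenstein_eq_ZP hμ hc 1 (realToG_mem_GInfKf θ)
    (show act (atReal (realToG θ)) 1 = _ by rw [atReal_realToG, hθ]) hM0 hM
  rwa [map_one, one_mul] at h

theorem three_lt_re_of_four_lt {μ : ℂ × ℂ} (hc : 4 < (μ.1 - μ.2).re) :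
    3 < ((μ.1 - μ.2 + 2) / 2).re := by
  have h : ((μ.1 - μ.2 + 2) / 2).re = ((μ.1 - μ.2).re + 2) / 2 := by
    rw [show (μ.1 - μ.2 + 2) / 2 = ((2⁻¹ : ℝ) : ℂ) * (μ.1 - μ.2 + 2) by push_cast; ring,
      Complex.re_ofReal_mul, Complex.add_re, Complex.re_ofNat]
    ring
  rw [h]
  linarith

variable {x : M4 ℚ} [MeasurableSpace (HA x)] [BorelSpace (HA x)]

theorem period_eq_ZPGen [Fintype (GenusClass x)] {θ : G ℝ}
    (hθ : act θ 1 = x.map (Rat.castHom ℝ)) {M : ℕ} (hM0 : 0 < M)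
    (hM : ∀ i j, ∃ m : ℤ, (M : ℚ) * x i j = m) {vol : Measure (HA x)} [vol.IsHaarMeasure]
    {ν : Measure (HQuot x)} (hν : IsQuotientMeasure x vol ν) {μ : ℂ × ℂ} (hμ : μ.1 + μ.2 = 0)
    (hc : 4 < (μ.1 - μ.2).re) :
    Integrable (fun q => eisenstein (periodPoint x θ q) μ) ν ∧
      ∫ q, eisenstein (periodPoint x θ q) μ ∂ν =
        ((vol (HCompact x)).toReal : ℂ) * (x.det : ℂ) ^ ((μ.1 + 1) / 2) *
          ZPGen (M ^ 2) x ((μ.1 - μ.2 + 2) / 2) := by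
  have hx := posDef_of_act_one hθ
  have h1 := integrable_and_integral_of_liesOver hx hθ hν
    (φ := fun q => eisenstein (periodPoint x θ q) μ)
    (f := fun C => (x.det : ℂ) ^ ((μ.1 + 1) / 2) *
      ZP (M ^ 2) (classRep C) ((μ.1 - μ.2 + 2) / 2)) (by
    intro q C hq
    obtain ⟨γ, k, hk, h1, h2⟩ := hq.periodPoint_eq hθ
    have hC : classRep C ∈ genus x := (Quotient.out C).2
    rw [h1, eisenstein_eq_ZP hμ hc γ hk h2 hM0 (integral_of_mem_genus hM hC),
      det_of_mem_genus hx hC])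
  refine ⟨h1.1, h1.2.trans ?_⟩
  rw [ZPGen_eq_sum hθ hM0 hM (three_lt_re_of_four_lt hc), mul_assoc, Finset.mul_sum, Finset.mul_sum,
    Finset.mul_sum]
  exact Finset.sum_congr rfl fun C _ => by ring

/-- The candidate for the continuation of the Dirichlet series, obtained from a continuation `F` of
the Eisenstein series. -/
def dirichletOf (d : ℚ) (F : ℂ → ℂ) (s : ℂ) : ℂ := F (s - 1) * (d : ℂ) ^ (-(s / 2))

theorem meromorphicOn_dirichletOf {d : ℚ} (hd : 0 < d) {F : ℂ → ℂ}
    (hF : MeromorphicNFOn F Set.univ) : MeromorphicOn (dirichletOf d F) Set.univ := by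
  intro s _
  have h1 : MeromorphicAt (fun s => F (s - 1)) s :=
    MeromorphicAt.comp_analyticAt (g := fun s => s - 1)
      (hF (Set.mem_univ (s - 1))).meromorphicAt (analyticAt_id.sub analyticAt_const)
  have h2 : AnalyticAt ℂ (fun s : ℂ => (d : ℂ) ^ (-(s / 2))) s := by
    refine AnalyticAt.cpow analyticAt_const ?_ ?_
    · exact (analyticAt_id.div analyticAt_const two_ne_zero).neg
    · rw [← Complex.ofReal_ratCast]
      exact Complex.ofReal_mem_slitPlane.2 (by exact_mod_cast hd)
  exact h1.mul h2.meromorphicAt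

theorem mul_dirichletOf {d : ℚ} (hd : 0 < d) (F : ℂ → ℂ) (z : ℂ) :
    (d : ℂ) ^ ((z + 1) / 2) * dirichletOf d F (z + 1) = F z := by
  have hd0 : (d : ℂ) ≠ 0 := by exact_mod_cast hd.ne'
  rw [dirichletOf, add_sub_cancel_right, mul_comm, mul_assoc, ← Complex.cpow_add _ _ hd0,
    neg_add_cancel, Complex.cpow_zero, mul_one]

theorem exists_dirichletOf_eq_ZP {y : M4 ℚ} {θ : G ℝ} (hθ : act θ 1 = y.map (Rat.castHom ℝ))
    {M : ℕ} (hM0 : 0 < M) (hM : ∀ i j, ∃ m : ℤ, (M : ℚ) * y i j = m) {F : ℂ → ℂ}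
    (hF : IsMeromorphicContinuation (fun z => eisenstein (realToG θ) (z, -z)) F) :
    ∃ c : ℝ, ∀ s : ℂ, c < s.re → dirichletOf y.det F s = ZP (M ^ 2) y s := by
  obtain ⟨-, c, hc⟩ := hF
  refine ⟨max (c + 1) 3, fun s hs => ?_⟩
  have h1 : c < (s - 1).re := by
    rw [Complex.sub_re, Complex.one_re]
    linarith [le_max_left (c + 1) 3]
  have h2 : 4 < ((s - 1) - -(s - 1)).re := by
    rw [sub_neg_eq_add, Complex.add_re, Complex.sub_re, Complex.one_re]
    linarith [le_max_right (c + 1) 3]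
  have hd0 : (y.det : ℂ) ≠ 0 := by exact_mod_cast (det_rat_pos (posDef_of_act_one hθ)).ne'
  rw [dirichletOf, hc _ h1]
  beta_reduce
  rw [eisenstein_realToG_eq_ZP (add_neg_cancel _) h2 hθ hM0 hM]
  have e1 : ((s - 1) - -(s - 1) + 2) / 2 = s := by ring
  have e2 : (s - 1 + 1) / 2 = s / 2 := by ring
  simp only [e1, e2]
  rw [mul_right_comm, ← Complex.cpow_add _ _ hd0, add_neg_cancel, Complex.cpow_zero, one_mul]

/-- The continued series are the continued Eisenstein series divided by the determinant factor, with
a finite weighted sum over classes for the genus. Continuation need not be exchanged with the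
integral: by uniqueness the continued integrand depends only on the class, so the period is a finite
sum for every `z`. -/
theorem continuation_identities [Fintype (GenusClass x)] {θ : G ℝ}
    (hθ : act θ 1 = x.map (Rat.castHom ℝ)) {M : ℕ} (hM0 : 0 < M)
    (hM : ∀ i j, ∃ m : ℤ, (M : ℚ) * x i j = m) {vol : Measure (HA x)} [vol.IsHaarMeasure]
    {ν : Measure (HQuot x)} (hν : IsQuotientMeasure x vol ν) {E : G Adele → ℂ → ℂ}
    (hE : ∀ g, IsMeromorphicContinuation (fun z => eisenstein g (z, -z)) (E g)) :
    ∃ Z Zgen : ℂ → ℂ,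
      IsMeromorphicContinuation (ZP (M ^ 2) x) Z ∧
      IsMeromorphicContinuation (ZPGen (M ^ 2) x) Zgen ∧
      ∀ᶠ z in codiscrete ℂ,
        E (realToG θ) z = (x.det : ℂ) ^ ((z + 1) / 2) * Z ((z - -z + 2) / 2) ∧
        Integrable (fun q => E (periodPoint x θ q) z) ν ∧
        ∫ q, E (periodPoint x θ q) z ∂ν =
          ((vol (HCompact x)).toReal : ℂ) * (x.det : ℂ) ^ ((z + 1) / 2) *
            Zgen ((z - -z + 2) / 2) := by
  have hx := posDef_of_act_one hθ
  have hd := det_rat_pos hx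
  choose θ' hθ' using exists_act_one_eq_classRep hθ
  have hint : ∀ C : GenusClass x, ∀ i j, ∃ m : ℤ, (M : ℚ) * classRep C i j = m :=
    fun C => integral_of_mem_genus hM (Quotient.out C).2
  have hdet : ∀ C : GenusClass x, (classRep C).det = x.det :=
    fun C => det_of_mem_genus hx (Quotient.out C).2
  let f : ℂ → ℂ := dirichletOf x.det (E (realToG θ))
  let fgen : ℂ → ℂ := fun s => ∑ C : GenusClass x, (autCard (classRep C) : ℂ)⁻¹ *
    dirichletOf x.det (E (realToG (θ' C))) s
  have hf : MeromorphicOn f Set.univ := meromorphicOn_dirichletOf hd (hE _).1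
  have hfgen : MeromorphicOn fgen Set.univ := fun s hs => MeromorphicAt.fun_sum fun C _ =>
    (MeromorphicAt.const _ s).mul (meromorphicOn_dirichletOf hd (hE _).1 s hs)
  obtain ⟨c, hc⟩ := exists_dirichletOf_eq_ZP hθ hM0 hM (hE (realToG θ))
  have hgen : ∀ C : GenusClass x, ∃ c : ℝ, ∀ s : ℂ, c < s.re →
      dirichletOf x.det (E (realToG (θ' C))) s = ZP (M ^ 2) (classRep C) s := fun C => by
    have := exists_dirichletOf_eq_ZP (hθ' C) hM0 (hint C) (hE (realToG (θ' C)))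
    rwa [hdet] at this
  choose c' hc' using hgen
  have hle : ∀ C, c' C ≤ ∑ D, |c' D| := fun C => (le_abs_self _).trans
    (Finset.single_le_sum (f := fun D => |c' D|) (fun _ _ => abs_nonneg _) (Finset.mem_univ C))
  have hperiod : ∀ q C, LiesOver x (Quotient.out q) C → ∀ z,
      E (periodPoint x θ q) z = E (realToG (θ' C)) z := by
    intro q C hq
    obtain ⟨γ, k, hk, h1, h2⟩ := hq.periodPoint_eq hθ
    have h3 : (fun z => eisenstein (periodPoint x θ q) (z, -z))
        = fun z => eisenstein (realToG (θ' C)) (z, -z) := by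
      funext z
      rw [h1]
      exact eisenstein_congr (add_neg_cancel z) γ hk h2 (hθ' C)
    have h4 := hE (periodPoint x θ q)
    rw [h3] at h4
    exact congrFun (h4.unique (hE _))
  refine ⟨toMeromorphicNFOn f Set.univ, toMeromorphicNFOn fgen Set.univ,
    isMeromorphicContinuation_toMeromorphicNFOn hf (c := max c 3)
      (fun s hs => analyticAt_ZP hθ hM0 hM ((le_max_right _ _).trans_lt hs))
      (fun s hs => hc s ((le_max_left _ _).trans_lt hs)),
    isMeromorphicContinuation_toMeromorphicNFOn hfgen (c := max (∑ D, |c' D|) 3)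
      (fun s hs => ?_) (fun s hs => ?_), ?_⟩
  · have hs3 : 3 < s.re := (le_max_right _ _).trans_lt hs
    have h1 : AnalyticAt ℂ (fun s => ∑ C : GenusClass x, (autCard (classRep C) : ℂ)⁻¹ *
        ZP (M ^ 2) (classRep C) s) s := Finset.analyticAt_fun_sum _ fun C _ =>
      analyticAt_const.mul (analyticAt_ZP (hθ' C) hM0 (hint C) hs3)
    refine h1.congr ?_
    have hopen : IsOpen {w : ℂ | 3 < w.re} := isOpen_lt continuous_const Complex.continuous_re
    filter_upwards [hopen.mem_nhds hs3] with w hw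
    exact (ZPGen_eq_sum hθ hM0 hM hw).symm
  · rw [ZPGen_eq_sum hθ hM0 hM ((le_max_right _ _).trans_lt hs)]
    refine Finset.sum_congr rfl fun C _ => ?_
    rw [hc' C s ((hle C).trans_lt ((le_max_left _ _).trans_lt hs))]
  -- Passing to normal form alters `f` and `fgen` only on a discrete set; the shift by one is the
  -- substitution `s = z + 1`.
  · filter_upwards [eventually_codiscrete_add (toMeromorphicNFOn_eqOn_codiscrete hf) 1,
      eventually_codiscrete_add (toMeromorphicNFOn_eqOn_codiscrete hfgen) 1] with z hz hzgen
    have e1 : (z - -z + 2) / 2 = z + 1 := by ring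
    rw [e1, ← hz, ← hzgen]
    refine ⟨(mul_dirichletOf hd _ z).symm, ?_⟩
    have h1 := integrable_and_integral_of_liesOver hx hθ hν
      (φ := fun q => E (periodPoint x θ q) z) (f := fun C => E (realToG (θ' C)) z)
      fun q C hq => hperiod q C hq z
    refine ⟨h1.1, h1.2.trans ?_⟩
    rw [mul_assoc]
    congr 1
    rw [Finset.mul_sum]
    refine Finset.sum_congr rfl fun C _ => ?_
    rw [mul_left_comm, mul_dirichletOf hd]

end

end OrthPeriod

end

theorem mainTheorem6 :
    ∃ c : ℝ,
      -- absolute convergence of the Eisenstein series on a right half-plane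
      (∀ μ : ℂ × ℂ, μ.1 + μ.2 = 0 → c < (μ.1 - μ.2).re →
        ∀ g : G Adele, Summable (eisensteinTerm g μ)) ∧
      ∀ (N : ℕ) (x : M4 ℚ),
        (x.map (Rat.castHom ℝ)).PosDef →
        ((N = 1 ∧ ∀ i j, ∃ m : ℤ, x i j = (m : ℚ)) ∨ (N = 4 ∧ IntegralForm x)) →
        ∀ θ : G ℝ, act θ 1 = x.map (Rat.castHom ℝ) →
        ∀ (_ : MeasurableSpace (HA x)) (_ : BorelSpace (HA x))
          (vol : Measure (HA x)) (_ : vol.IsHaarMeasure),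
          Finite (GenusClass x) ∧
          (∃! ν : Measure (HQuot x), IsQuotientMeasure x vol ν) ∧
          ∀ ν : Measure (HQuot x), IsQuotientMeasure x vol ν →
            -- the identities in the range of absolute convergence
            (∀ μ : ℂ × ℂ, μ.1 + μ.2 = 0 → c < (μ.1 - μ.2).re →
              Summable (dirichletTerm (fun k => (rP x k : ℂ)) N ((μ.1 - μ.2 + 2) / 2)) ∧
              eisenstein (realToG θ) μ =
                (x.det : ℂ) ^ ((μ.1 + 1) / 2) * ZP N x ((μ.1 - μ.2 + 2) / 2) ∧
              Summable (dirichletTerm (fun k => (rPGen x k : ℂ)) N ((μ.1 - μ.2 + 2) / 2)) ∧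
              Integrable (fun q => eisenstein (periodPoint x θ q) μ) ν ∧
              ∫ q, eisenstein (periodPoint x θ q) μ ∂ν =
                ((vol (HCompact x)).toReal : ℂ) * (x.det : ℂ) ^ ((μ.1 + 1) / 2) *
                  ZPGen N x ((μ.1 - μ.2 + 2) / 2)) ∧
            -- the identities between the meromorphic continuations in `μ₁ = z`, `μ₂ = -z`
            (∀ E : G Adele → ℂ → ℂ,
              (∀ g, IsMeromorphicContinuation (fun z => eisenstein g (z, -z)) (E g)) →
              ∃ Z Zgen : ℂ → ℂ,
                IsMeromorphicContinuation (ZP N x) Z ∧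
                IsMeromorphicContinuation (ZPGen N x) Zgen ∧
                ∀ᶠ z in codiscrete ℂ,
                  E (realToG θ) z =
                    (x.det : ℂ) ^ ((z + 1) / 2) * Z ((z - -z + 2) / 2) ∧
                  Integrable (fun q => E (periodPoint x θ q) z) ν ∧
                  ∫ q, E (periodPoint x θ q) z ∂ν =
                    ((vol (HCompact x)).toReal : ℂ) * (x.det : ℂ) ^ ((z + 1) / 2) *
                      Zgen ((z - -z + 2) / 2)) := by
  -- The bound `4` corresponds to `Re s > 3`, half the rank of `⋀² ℤ⁴`.
  refine ⟨4, fun μ hμ hc g => summable_eisensteinTerm hμ hc g, ?_⟩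
  intro N x hx hN θ hθ _ _ vol _
  obtain ⟨M, hM0, rfl, hM⟩ := exists_scale hx hN
  have hfin : Finite (GenusClass x) := finite_genusClass hx hM0 hM
  have : Fintype (GenusClass x) := Fintype.ofFinite _
  refine ⟨hfin, existsUnique_isQuotientMeasure hx hθ vol, fun ν hν => ⟨fun μ hμ hc => ?_,
    fun E hE => continuation_identities hθ hM0 hM hν hE⟩⟩
  have h3 := three_lt_re_of_four_lt hc
  exact ⟨(hasSum_ZP hθ hM0 hM h3).summable, eisenstein_realToG_eq_ZP hμ hc hθ hM0 hM,
    (hasSum_ZPGen hθ hM0 hM h3).summable, period_eq_ZPGen hθ hM0 hM hν hμ hc⟩
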